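/- Conventions. A Young diagram $\lambda$ is a finite, left-justified set of boxes with weakly decreasing row lengths; the $u$-coordinate of a box is (column index) $-$ (row index). The concave (respectively convex) corners of $\lambda$ correspond to the boxes that can be added to (respectively removed from) $\lambda$ so that the result is a Young diagram; the $u$-coordinate of a corner is that of the box. With products over the $u$-coordinates $y$ of the convex corners and $x$ of the concave corners, the Cauchy transform is $$\mathbf G_\lambda(z)=\frac{\prod_{y}(z-y)}{\prod_{x}(z-x)},\qquad \mathbf G_\lambda^{\underline{m}}(z)=\mathbf G_\lambda(z)\,\mathbf G_\lambda(z-1)\cdots \mathbf G_\lambda(z-m+1),\quad \mathbf G_\lambda^{\underline 0}=1,$$ and the transition measure $\mu_\lambda$ gives a concave corner $x$ the weight $\mu_\lambda(x)=\operatorname{Res}_{z=x}\mathbf G_\lambda(z)$. Let $f^\lambda$ be the number of standard Young tableaux of shape $\lambda$. The Plancherel growth process started at $\lambda$ is the Markov chain of Young diagrams with initial state $\lambda$ that in each step passes from $\mu$ to a diagram $\nu$ with one more box, $\nu\supset\mu$, with probability $\frac{f^\nu}{(|\mu|+1)f^\mu}$. A Poissonized tableau of shape $\lambda$ is a filling $T$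 of the boxes of $\lambda$ with numbers from $[0,1]$ that increase along rows and columns; a random one is taken with respect to the normalized Lebesgue measure on the set of these. The threshold $F_T(u_0)$ is the supremum of the $z\in[0,1]$ for which the Schensted row insertion of $z$ into $T$ creates a new box with $u$-coordinate at most $u_0$ ($\sup\emptyset=0$). Statement. Let $\lambda$ be a Young diagram with $n\ge 0$ boxes, let $k\ge1$ be an integer, let $\lambda=\lambda^{(n)}\nearrow\lambda^{(n+1)}\nearrow\cdots\nearrow\lambda^{(n+k)}$ be the Plancherel growth process started at $\lambda$, and let $\mathbf U=(U_1,\dots,U_k)$, where $U_i$ is the $u$-coordinate of the box $\lambda^{(n+i)}\setminus\lambda^{(n+i-1)}$. For $\mathbf x=(x_1,\dots,x_\ell)$ and integers $\mathbf a=(a_1,\dots,a_\ell)$, $a_i\ge1$, put $$\mathbf x^{\underline{\mathbf a}}=(x_1,x_1-1,\dots,x_1-a_1+1,\;\dots,\;x_\ell,x_\ell-1,\dots,x_\ell-a_\ell+1).$$ (a) Let $T$ be a random Poissonized tableau of shape $\lambda$. For every $u_0\in\mathbb R$ the variable $F_T(u_0)^k$ is integrable and $$\mathbb E\big[F_T(u_0)^k\big]=k!\;\mathbb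 P\big(u_0\ge U_1>\cdots>U_k\big).$$ (b) If $U_1>\cdots>U_k$, then $\mathbf U$ can be written in exactly one way as $\mathbf x^{\underline{\mathbf a}}$ with $x_1>\cdots>x_\ell$ being $u$-coordinates of some concave corners of $\lambda$ and integers $a_1,\dots,a_\ell\ge1$ such that $a_1+\cdots+a_\ell=k$. (c) Let $x_1>\cdots>x_\ell$ be the $u$-coordinates of some concave corners of $\lambda$ and let $a_1,\dots,a_\ell\ge1$ be integers with $a_1+\cdots+a_\ell=k$. Assume (X) for each $i\in\{1,\dots,\ell\}$ the set $\{x_i-1,x_i-2,\dots,x_i-a_i+1\}$ contains no $u$-coordinate of a concave corner of $\lambda$. Then $$\mathbb P\big[\mathbf U=\mathbf x^{\underline{\mathbf a}}\big]=\Theta(x_1,\dots,x_\ell)\prod_{i=1}^{\ell}\frac{(-1)^{a_i-1}}{a_i}\,\mu_\lambda(x_i)\,\mathbf G_\lambda^{\underline{a_i-1}}(x_i-1),$$ $$\Theta(x_1,\dots,x_\ell)=\prod_{1\le i<j\le\ell}\frac{(x_i-x_j)(x_i-x_j-a_i+a_j)}{(x_i-x_j+a_j)(x_i-x_j-a_i)}.$$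 Here a denominator in $\Theta$ can vanish only if $x_i-a_i=x_j$ for some $i<j$; such a factor of $\Theta$ is read as $0$, so that in this case (where also $\mathbf G_\lambda^{\underline{a_i-1}}(x_i-1)=0$) the assertion is $\mathbb P[\mathbf U=\mathbf x^{\underline{\mathbf a}}]=0$. -/

import Mathlib

open MeasureTheory ProbabilityTheory

namespace PlancherelGrowth

/-- The `u`-coordinate (content) of the box in row `c.1` and column `c.2`. -/
def uCoord (c : ℕ × ℕ) : ℤ := (c.2 : ℤ) - (c.1 : ℤ)

/-- The boxes that can be added to `lam` so that it stays a Young diagram. -/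
def addableBoxes (lam : YoungDiagram) : Finset (ℕ × ℕ) :=
  (Finset.range (lam.colLen 0 + 1) ×ˢ Finset.range (lam.rowLen 0 + 1)).filter
    fun c => c ∉ lam ∧ Finset.Iio c ⊆ lam.cells

/-- The bounding rectangle in the definition of `addableBoxes` is no restriction. -/
theorem mem_addableBoxes (lam : YoungDiagram) (c : ℕ × ℕ) :
    c ∈ addableBoxes lam ↔ c ∉ lam ∧ ∀ b < c, b ∈ lam := by
  have h : (Finset.Iio c ⊆ lam.cells) ↔ ∀ b < c, b ∈ lam := by
    simp [Finset.subset_iff]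
  rw [addableBoxes, Finset.mem_filter, h, and_iff_right_iff_imp]
  rintro ⟨-, hb⟩
  obtain ⟨i, j⟩ := c
  simp only [Finset.mem_product, Finset.mem_range]
  constructor
  · rcases i with _ | i
    · omega
    · have h1 : ((i, 0) : ℕ × ℕ) ∈ lam :=
        hb _ (Prod.mk_lt_mk.2 (Or.inl ⟨Nat.lt_succ_self i, Nat.zero_le j⟩))
      have := YoungDiagram.mem_iff_lt_colLen.1 h1
      omega
  · rcases j with _ | j
    · omega
    · have h1 : ((0, j) : ℕ × ℕ) ∈ lam :=
        hb _ (Prod.mk_lt_mk.2 (Or.inr ⟨Nat.zero_le i, Nat.lt_succ_self j⟩))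
      have := YoungDiagram.mem_iff_lt_rowLen.1 h1
      omega

/-- The boxes that can be removed from `lam` so that it stays a Young diagram. -/
def removableBoxes (lam : YoungDiagram) : Finset (ℕ × ℕ) :=
  lam.cells.filter fun c => (c.1 + 1, c.2) ∉ lam ∧ (c.1, c.2 + 1) ∉ lam

/-- The `u`-coordinates of the concave corners of `lam`. -/
def concaveCorners (lam : YoungDiagram) : Finset ℤ := (addableBoxes lam).image uCoord

/-- The `u`-coordinates of the convex corners of `lam`. -/
def convexCorners (lam : YoungDiagram) : Finset ℤ := (removableBoxes lam).image uCoord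

/-- The Cauchy transform `G_lam(z) = ∏ (z - y) / ∏ (z - x)`, the products being over the convex
corners `y` and over the concave corners `x`. -/
noncomputable def cauchyTransform (lam : YoungDiagram) (z : ℝ) : ℝ :=
  (∏ y ∈ convexCorners lam, (z - (y : ℝ))) / ∏ x ∈ concaveCorners lam, (z - (x : ℝ))

/-- The analogue of the falling factorial: `G(z) G(z-1) ⋯ G(z-k+1)` (`k` factors). -/
noncomputable def cauchyFalling (lam : YoungDiagram) (k : ℕ) (z : ℝ) : ℝ :=
  ∏ m ∈ Finset.range k, cauchyTransform lam (z - (m : ℝ))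

/-- The weight of the atom of Kerov's transition measure of `lam` at `x`: the residue at `x` of the
Cauchy transform, i.e. `G_lam(z) = ∑ μ_lam(x) / (z - x)` over the concave corners `x`. -/
noncomputable def transitionMeasure (lam : YoungDiagram) (x : ℤ) : ℝ :=
  if x ∈ concaveCorners lam then
    (∏ y ∈ convexCorners lam, ((x : ℝ) - (y : ℝ))) /
      ∏ x' ∈ (concaveCorners lam).erase x, ((x : ℝ) - (x' : ℝ))
  else 0

/-- The number of standard Young tableaux of shape `lam` (boxes are ordered componentwise, so
`StrictMono` says that the entries increase along rows and columns). -/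
noncomputable def numSYT (lam : YoungDiagram) : ℕ :=
  Nat.card {T : lam.cells ≃ Fin lam.card // StrictMono T}

/-- `mu ↗ nu`: the diagram `nu` arises from `mu` by adding one box. -/
def Grows (mu nu : YoungDiagram) : Prop := mu ≤ nu ∧ nu.card = mu.card + 1

/-- The transition probability of the Plancherel growth process from `mu` to `nu`, for
`mu ↗ nu`. -/
noncomputable def transitionProb (mu nu : YoungDiagram) : ℝ :=
  (numSYT nu : ℝ) / (((mu.card : ℝ) + 1) * (numSYT mu : ℝ))

/-- A path `lam = nu 0 ↗ nu 1 ↗ ⋯ ↗ nu k` of Young diagrams. -/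
def IsGrowthPath (lam : YoungDiagram) {k : ℕ} (nu : Fin (k + 1) → YoungDiagram) : Prop :=
  nu 0 = lam ∧ ∀ i : Fin k, Grows (nu i.castSucc) (nu i.succ)

/-- `D` is (the first `k` steps of) the Plancherel growth process started at `lam`: the Markov
chain with initial state `lam` and the transition probabilities `transitionProb`. -/
structure IsPlancherelGrowth {Ω : Type*} [MeasurableSpace Ω] (P : Measure Ω)
    (lam : YoungDiagram) {k : ℕ} (D : Fin (k + 1) → Ω → YoungDiagram) : Prop where
  measurable : ∀ (i : Fin (k + 1)) (nu : YoungDiagram), MeasurableSet {ω | D i ω = nu}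
  growth : ∀ ω, IsGrowthPath lam fun i => D i ω
  law : ∀ nu : Fin (k + 1) → YoungDiagram, IsGrowthPath lam nu →
    P.real {ω | ∀ i, D i ω = nu i} = ∏ i : Fin k, transitionProb (nu i.castSucc) (nu i.succ)

/-- The `u`-coordinates of the boxes added along a growth path. (The set difference consists of a
single box, so the sum has one term.) -/
def addedU {k : ℕ} (nu : Fin (k + 1) → YoungDiagram) (i : Fin k) : ℤ :=
  ∑ c ∈ (nu i.succ).cells \ (nu i.castSucc).cells, uCoord c

/-- The tuple `x₁, x₁ - 1, …, x₁ - a₁ + 1, …, x_ℓ, x_ℓ - 1, …, x_ℓ - a_ℓ + 1`. -/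
def stringTuple {l : ℕ} (x : Fin l → ℤ) (a : Fin l → ℕ) : List ℤ :=
  (List.finRange l).flatMap fun i => (List.range (a i)).map fun m => x i - (m : ℤ)

/-- The product `Θ` over the pairs `i < j`, where a factor with zero denominator counts as `0`.
(For decreasing concave corners `x` this only happens when `x i - a i = x j`; then a convex corner
lies strictly between `x j` and `x i`.) -/
noncomputable def theta {l : ℕ} (x : Fin l → ℤ) (a : Fin l → ℕ) : ℝ :=
  ∏ i : Fin l, ∏ j ∈ Finset.Ioi i,
    (((x i : ℝ) - x j) * ((x i : ℝ) - x j - a i + a j)) /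
      (((x i : ℝ) - x j + a j) * ((x i : ℝ) - x j - a i))

/-- The Poissonized tableaux of shape `lam`: fillings of the boxes with numbers from `[0,1]` that
increase along rows and columns. -/
def poissonizedTableaux (lam : YoungDiagram) : Set (lam.cells → ℝ) :=
  {T | (∀ c, T c ∈ Set.Icc (0 : ℝ) 1) ∧ StrictMono T}

/-- The uniform distribution on the Poissonized tableaux of shape `lam`. -/
noncomputable def uniformTableau (lam : YoungDiagram) : Measure (lam.cells → ℝ) :=
  cond volume (poissonizedTableaux lam)

/-- The number bumped out of row `i` by `z` in Schensted row insertion: the smallest entry of the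
row which is larger than `z`. The value `⊤` means that nothing is bumped. -/
noncomputable def bump {lam : YoungDiagram} (T : lam.cells → ℝ) (i : ℕ) (z : WithTop ℝ) :
    WithTop ℝ :=
  (Finset.univ.filter fun c : lam.cells => c.1.1 = i ∧ z < (T c : WithTop ℝ)).inf
    fun c => (T c : WithTop ℝ)

/-- The number inserted into row `i` in the course of the row insertion of `z` into `T` (`⊤` if the
insertion has stopped in an earlier row). -/
noncomputable def bumpSeq {lam : YoungDiagram} (T : lam.cells → ℝ) (z : ℝ) : ℕ → WithTop ℝ
  | 0 => (z : WithTop ℝ)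
  | i + 1 => bump T i (bumpSeq T z i)

theorem exists_bumpSeq_eq_top {lam : YoungDiagram} (T : lam.cells → ℝ) (z : ℝ) :
    ∃ i, bumpSeq T z (i + 1) = ⊤ := by
  refine ⟨lam.colLen 0, ?_⟩
  rw [bumpSeq, bump, Finset.filter_eq_empty_iff.2, Finset.inf_empty]
  rintro ⟨⟨i, j⟩, hc⟩ -
  rintro ⟨rfl, -⟩
  have h : (lam.colLen 0, 0) ∈ lam := lam.up_left_mem le_rfl (Nat.zero_le j) hc
  exact lt_irrefl _ (YoungDiagram.mem_iff_lt_colLen.1 h)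

/-- The new box created by the Schensted row insertion of `z` into `T`: the insertion stops in the
first row in which nothing is bumped, and the new box is put at the end of this row. -/
noncomputable def newBox {lam : YoungDiagram} (T : lam.cells → ℝ) (z : ℝ) : ℕ × ℕ :=
  let i := sInf {i | bumpSeq T z (i + 1) = ⊤}
  (i, lam.rowLen i)

/-- The threshold `F_T(u₀)`: the supremum of the `z ∈ [0,1]` whose row insertion into `T` creates
a new box with `u`-coordinate at most `u₀` (the supremum of the empty set being `0`). -/
noncomputable def threshold {lam : YoungDiagram} (T : lam.cells → ℝ) (u₀ : ℝ) : ℝ :=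
  sSup {z : ℝ | z ∈ Set.Icc (0 : ℝ) 1 ∧ (uCoord (newBox T z) : ℝ) ≤ u₀}

end PlancherelGrowth

namespace PlancherelGrowth

/-- The Maya diagram of `lam`: the set of the numbers `lam_i - i`. -/
def maya (lam : YoungDiagram) : Set ℤ := {x | ∃ i : ℕ, (lam.rowLen i : ℤ) - i = x}

theorem rowLen_sub_strictAnti (lam : YoungDiagram) :
    StrictAnti fun i : ℕ => (lam.rowLen i : ℤ) - i := by
  refine strictAnti_nat_of_succ_lt fun i => ?_
  have := lam.rowLen_anti i (i + 1) (Nat.le_succ i)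
  push_cast
  omega

theorem mem_addableBoxes_iff (lam : YoungDiagram) (i j : ℕ) :
    (i, j) ∈ addableBoxes lam ↔ j = lam.rowLen i ∧ (i = 0 ∨ lam.rowLen i < lam.rowLen (i - 1)) := by
  rw [mem_addableBoxes, YoungDiagram.mem_iff_lt_rowLen]
  constructor
  · rintro ⟨h1, h2⟩
    have hj : j = lam.rowLen i := by
      rcases j with _ | j
      · omega
      · have := h2 (i, j) (Prod.mk_lt_mk.2 (Or.inr ⟨le_rfl, Nat.lt_succ_self j⟩))
        rw [YoungDiagram.mem_iff_lt_rowLen] at this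
        omega
    refine ⟨hj, ?_⟩
    rcases i with _ | i
    · exact Or.inl rfl
    · have := h2 (i, j) (Prod.mk_lt_mk.2 (Or.inl ⟨Nat.lt_succ_self i, le_rfl⟩))
      rw [YoungDiagram.mem_iff_lt_rowLen] at this
      right
      simpa [← hj] using this
  · rintro ⟨rfl, h⟩
    refine ⟨lt_irrefl _, ?_⟩
    rintro ⟨a, b⟩ hab
    rw [YoungDiagram.mem_iff_lt_rowLen]
    rcases Prod.mk_lt_mk.1 hab with ⟨h1, h2⟩ | ⟨h1, h2⟩
    · have := lam.rowLen_anti a (i - 1) (by omega)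
      omega
    · have := lam.rowLen_anti a i h1
      omega

theorem mem_removableBoxes_iff (lam : YoungDiagram) (i j : ℕ) :
    (i, j) ∈ removableBoxes lam ↔ j + 1 = lam.rowLen i ∧ lam.rowLen (i + 1) < lam.rowLen i := by
  simp only [removableBoxes, Finset.mem_filter, YoungDiagram.mem_cells,
    YoungDiagram.mem_iff_lt_rowLen]
  omega

theorem mem_concaveCorners (lam : YoungDiagram) (x : ℤ) :
    x ∈ concaveCorners lam ↔ x ∈ maya lam ∧ x + 1 ∉ maya lam := by
  simp only [concaveCorners, Finset.mem_image, Prod.exists, mem_addableBoxes_iff, uCoord, maya,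
    Set.mem_ofPred_eq, not_exists]
  constructor
  · rintro ⟨i, j, ⟨rfl, h⟩, rfl⟩
    refine ⟨⟨i, rfl⟩, fun k hk => ?_⟩
    rcases lt_trichotomy k i with h1 | rfl | h1
    · have h2 := lam.rowLen_anti k (i - 1) (by omega)
      omega
    · omega
    · have h2 := lam.rowLen_anti i k (by omega)
      omega
  · rintro ⟨⟨i, rfl⟩, h⟩
    refine ⟨i, _, ⟨rfl, ?_⟩, rfl⟩
    rcases i with _ | i
    · exact Or.inl rfl
    · have h1 := h i
      have h2 := lam.rowLen_anti i (i + 1) (Nat.le_succ i)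
      right
      simp only [Nat.add_sub_cancel]
      push_cast at h1
      omega

theorem mem_convexCorners (lam : YoungDiagram) (x : ℤ) :
    x ∈ convexCorners lam ↔ x ∉ maya lam ∧ x + 1 ∈ maya lam := by
  simp only [convexCorners, Finset.mem_image, Prod.exists, mem_removableBoxes_iff, uCoord, maya,
    Set.mem_ofPred_eq, not_exists]
  constructor
  · rintro ⟨i, j, ⟨hj, h⟩, rfl⟩
    refine ⟨fun k hk => ?_, i, by omega⟩
    rcases lt_trichotomy k i with h1 | rfl | h1
    · have h2 := lam.rowLen_anti k i (by omega)
      omega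
    · omega
    · have h2 := lam.rowLen_anti (i + 1) k (by omega)
      omega
  · rintro ⟨h, ⟨i, hi⟩⟩
    have h1 := h (i + 1)
    have h2 := lam.rowLen_anti i (i + 1) (Nat.le_succ i)
    push_cast at h1
    exact ⟨i, lam.rowLen i - 1, ⟨by omega, by omega⟩, by omega⟩

/-- The diagram `nu` arises from `lam` by adding a box with `u`-coordinate `x`. -/
def GrowsAt (lam : YoungDiagram) (x : ℤ) (nu : YoungDiagram) : Prop :=
  ∃ c ∉ lam.cells, nu.cells = insert c lam.cells ∧ uCoord c = x

theorem Grows.exists_growsAt {lam nu : YoungDiagram} (h : Grows lam nu) :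
    ∃ x, GrowsAt lam x nu := by
  have hsub : lam.cells ⊆ nu.cells := h.1
  have hcard : (nu.cells \ lam.cells).card = 1 := by
    have h2 : nu.cells.card = lam.cells.card + 1 := h.2
    rw [Finset.card_sdiff_of_subset hsub]
    omega
  obtain ⟨c, hc⟩ := Finset.card_eq_one.1 hcard
  have hc' : c ∈ nu.cells \ lam.cells := hc ▸ Finset.mem_singleton_self c
  refine ⟨uCoord c, c, (Finset.mem_sdiff.1 hc').2, ?_, rfl⟩
  rw [Finset.insert_eq, ← hc, Finset.sdiff_union_of_subset hsub]

theorem GrowsAt.grows {lam nu : YoungDiagram} {x : ℤ} (h : GrowsAt lam x nu) : Grows lam nu := by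
  obtain ⟨c, hc, hnu, -⟩ := h
  constructor
  · intro b hb
    have : b ∈ nu.cells := by rw [hnu]; exact Finset.mem_insert_of_mem hb
    exact this
  · simp only [YoungDiagram.card, hnu, Finset.card_insert_of_notMem hc]

theorem GrowsAt.card {lam nu : YoungDiagram} {x : ℤ} (h : GrowsAt lam x nu) :
    nu.card = lam.card + 1 := h.grows.2

theorem mem_addableBoxes_of_insert {lam nu : YoungDiagram} {c : ℕ × ℕ} (hc : c ∉ lam.cells)
    (hnu : nu.cells = insert c lam.cells) : c ∈ addableBoxes lam := by
  rw [mem_addableBoxes]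
  refine ⟨hc, fun b hb => ?_⟩
  have h1 : b ∈ nu.cells := nu.isLowerSet hb.le (by rw [hnu]; simp)
  rw [hnu, Finset.mem_insert] at h1
  exact h1.resolve_left hb.ne

theorem eq_of_mem_addableBoxes {lam : YoungDiagram} {b c : ℕ × ℕ} (hb : b ∈ addableBoxes lam)
    (hc : c ∈ addableBoxes lam) (h : uCoord b = uCoord c) : b = c := by
  rw [mem_addableBoxes] at hb hc
  obtain ⟨i, j⟩ := b
  obtain ⟨k, l⟩ := c
  simp only [uCoord] at h
  rcases lt_trichotomy i k with h1 | rfl | h1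
  · exact absurd (hc.2 _ (Prod.mk_lt_mk.2 (Or.inl ⟨h1, by omega⟩))) hb.1
  · congr 1
    omega
  · exact absurd (hb.2 _ (Prod.mk_lt_mk.2 (Or.inl ⟨h1, by omega⟩))) hc.1

theorem GrowsAt.unique {lam nu nu' : YoungDiagram} {x : ℤ} (h : GrowsAt lam x nu)
    (h' : GrowsAt lam x nu') : nu = nu' := by
  obtain ⟨c, hc, hnu, hx⟩ := h
  obtain ⟨c', hc', hnu', hx'⟩ := h'
  have := eq_of_mem_addableBoxes (mem_addableBoxes_of_insert hc hnu)
    (mem_addableBoxes_of_insert hc' hnu') (hx.trans hx'.symm)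
  subst this
  exact YoungDiagram.ext (hnu.trans hnu'.symm)

theorem exists_insert_of_mem_addableBoxes {lam : YoungDiagram} {c : ℕ × ℕ}
    (hc : c ∈ addableBoxes lam) : c ∉ lam.cells ∧ ∃ nu : YoungDiagram, nu.cells = insert c lam.cells := by
  rw [mem_addableBoxes] at hc
  refine ⟨hc.1, ⟨insert c lam.cells, ?_⟩, rfl⟩
  intro a b hab ha
  simp only [Finset.coe_insert, Set.mem_insert_iff, Finset.mem_coe] at ha ⊢
  rcases ha with rfl | ha
  · rcases hab.eq_or_lt with rfl | h
    · exact Or.inl rfl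
    · exact Or.inr (hc.2 b h)
  · exact Or.inr (lam.isLowerSet hab ha)

theorem exists_growsAt {lam : YoungDiagram} {x : ℤ} (hx : x ∈ concaveCorners lam) :
    ∃ nu, GrowsAt lam x nu := by
  obtain ⟨c, hc, rfl⟩ := Finset.mem_image.1 hx
  obtain ⟨h1, nu, h2⟩ := exists_insert_of_mem_addableBoxes hc
  exact ⟨nu, c, h1, h2, rfl⟩

theorem GrowsAt.mem_concaveCorners {lam nu : YoungDiagram} {x : ℤ} (h : GrowsAt lam x nu) :
    x ∈ concaveCorners lam := by
  obtain ⟨c, hc, hnu, rfl⟩ := h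
  exact Finset.mem_image_of_mem _ (mem_addableBoxes_of_insert hc hnu)

theorem exists_erase_of_mem_removableBoxes {nu : YoungDiagram} {c : ℕ × ℕ}
    (hc : c ∈ removableBoxes nu) : ∃ lam : YoungDiagram, lam.cells = nu.cells.erase c := by
  refine ⟨⟨nu.cells.erase c, ?_⟩, rfl⟩
  intro a b hab ha
  simp only [Finset.coe_erase, Set.mem_sdiff, Finset.mem_coe, Set.mem_singleton_iff] at ha ⊢
  refine ⟨nu.isLowerSet hab ha.1, ?_⟩
  rintro rfl
  obtain ⟨i, j⟩ := a
  obtain ⟨k, l⟩ := b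
  simp only [removableBoxes, Finset.mem_filter] at hc
  rcases hab.eq_or_lt with h | h
  · exact ha.2 h.symm
  · rcases Prod.mk_lt_mk.1 h with ⟨h1, h2⟩ | ⟨h1, h2⟩
    · exact hc.2.1 (nu.isLowerSet (Prod.mk_le_mk.2 ⟨h1, h2⟩) ha.1)
    · exact hc.2.2 (nu.isLowerSet (Prod.mk_le_mk.2 ⟨h1, h2⟩) ha.1)

theorem exists_growsAt_of_mem_convexCorners {nu : YoungDiagram} {y : ℤ}
    (hy : y ∈ convexCorners nu) : ∃ lam, GrowsAt lam y nu := by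
  obtain ⟨c, hc, rfl⟩ := Finset.mem_image.1 hy
  obtain ⟨lam, h⟩ := exists_erase_of_mem_removableBoxes hc
  refine ⟨lam, c, by simp [h], ?_, rfl⟩
  rw [h, Finset.insert_erase (Finset.mem_filter.1 hc).1]

theorem rowLen_of_insert {lam nu : YoungDiagram} {i j : ℕ} (hc : (i, j) ∉ lam.cells)
    (hnu : nu.cells = insert (i, j) lam.cells) (k : ℕ) :
    nu.rowLen k = lam.rowLen k + if k = i then 1 else 0 := by
  have hj := ((mem_addableBoxes_iff lam i j).1 (mem_addableBoxes_of_insert hc hnu)).1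
  refine Nat.le_antisymm ?_ ?_ <;> refine le_of_forall_lt fun l hl => ?_
  · rw [← YoungDiagram.mem_iff_lt_rowLen, ← YoungDiagram.mem_cells, hnu, Finset.mem_insert,
      YoungDiagram.mem_cells, YoungDiagram.mem_iff_lt_rowLen, Prod.mk.injEq] at hl
    split_ifs with h
    · subst h
      omega
    · omega
  · rw [← YoungDiagram.mem_iff_lt_rowLen, ← YoungDiagram.mem_cells, hnu, Finset.mem_insert,
      YoungDiagram.mem_cells, YoungDiagram.mem_iff_lt_rowLen, Prod.mk.injEq]
    split_ifs at hl with h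
    · subst h
      omega
    · omega

theorem GrowsAt.mem_maya {lam nu : YoungDiagram} {x : ℤ} (h : GrowsAt lam x nu) (z : ℤ) :
    z ∈ maya nu ↔ (z ∈ maya lam ∧ z ≠ x) ∨ z = x + 1 := by
  obtain ⟨⟨i, j⟩, hc, hnu, rfl⟩ := h
  have hj := ((mem_addableBoxes_iff lam i j).1 (mem_addableBoxes_of_insert hc hnu)).1
  have hr := rowLen_of_insert hc hnu
  simp only [maya, Set.mem_ofPred_eq, uCoord]
  constructor
  · rintro ⟨k, rfl⟩
    rw [hr]
    split_ifs with hk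
    · subst hk
      right
      omega
    · left
      refine ⟨⟨k, by simp⟩, fun h => hk ?_⟩
      apply (rowLen_sub_strictAnti lam).injective
      simp only
      omega
  · rintro (⟨⟨k, rfl⟩, h⟩ | rfl)
    · refine ⟨k, ?_⟩
      rw [hr, if_neg]
      · simp
      · rintro rfl
        omega
    · refine ⟨i, ?_⟩
      rw [hr, if_pos rfl]
      omega

theorem GrowsAt.mem_maya_left {lam nu : YoungDiagram} {x : ℤ} (h : GrowsAt lam x nu) :
    x ∈ maya lam ∧ x + 1 ∉ maya lam :=
  (PlancherelGrowth.mem_concaveCorners lam x).1 h.mem_concaveCorners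

theorem GrowsAt.mem_convexCorners {lam nu : YoungDiagram} {x : ℤ} (h : GrowsAt lam x nu) :
    x ∈ convexCorners nu := by
  rw [PlancherelGrowth.mem_convexCorners, h.mem_maya, h.mem_maya]
  simp

theorem GrowsAt.unique_left {lam lam' nu : YoungDiagram} {x : ℤ} (h : GrowsAt lam x nu)
    (h' : GrowsAt lam' x nu) : lam = lam' := by
  obtain ⟨c, hc, hnu, hx⟩ := h
  obtain ⟨c', hc', hnu', hx'⟩ := h'
  have hcc : c = c' := by
    have h1 : c ∈ addableBoxes lam := mem_addableBoxes_of_insert hc hnu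
    have h2 : c' ∈ addableBoxes lam' := mem_addableBoxes_of_insert hc' hnu'
    rw [mem_addableBoxes] at h1 h2
    by_contra hne
    have h3 : c' ∈ lam.cells := by
      have : c' ∈ nu.cells := by rw [hnu']; simp
      rw [hnu, Finset.mem_insert] at this
      exact this.resolve_left (Ne.symm hne)
    have h4 : c ∈ lam'.cells := by
      have : c ∈ nu.cells := by rw [hnu]; simp
      rw [hnu', Finset.mem_insert] at this
      exact this.resolve_left hne
    obtain ⟨i, j⟩ := c
    obtain ⟨k, l⟩ := c'
    simp only [uCoord] at hx hx'
    rcases le_total i k with h5 | h5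
    · exact hc (lam.isLowerSet (Prod.mk_le_mk.2 ⟨h5, by omega⟩) h3)
    · exact hc' (lam'.isLowerSet (Prod.mk_le_mk.2 ⟨h5, by omega⟩) h4)
  subst hcc
  apply YoungDiagram.ext
  rw [← Finset.erase_insert hc, ← hnu, hnu', Finset.erase_insert hc']

theorem GrowsAt.diamond {lam kap nu : YoungDiagram} {x y : ℤ} (h : GrowsAt lam x nu)
    (h' : GrowsAt kap y nu) (hxy : x ≠ y) : GrowsAt (lam ⊓ kap) y lam ∧ GrowsAt (lam ⊓ kap) x kap := by
  obtain ⟨c, hc, hnu, hx⟩ := h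
  obtain ⟨d, hd, hnu', hy⟩ := h'
  have hcd : c ≠ d := by
    rintro rfl
    exact hxy (hx.symm.trans hy)
  have e : insert c lam.cells = insert d kap.cells := hnu.symm.trans hnu'
  have hmem : ∀ b, (b = c ∨ b ∈ lam.cells) ↔ (b = d ∨ b ∈ kap.cells) := fun b => by
    rw [← Finset.mem_insert, e, Finset.mem_insert]
  have hdl : d ∈ lam.cells := ((hmem d).2 (Or.inl rfl)).resolve_left hcd.symm
  have hck : c ∈ kap.cells := ((hmem c).1 (Or.inl rfl)).resolve_left hcd
  refine ⟨⟨d, by simp [YoungDiagram.cells_inf, hd], ?_, hy⟩,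
    ⟨c, by simp [YoungDiagram.cells_inf, hc], ?_, hx⟩⟩
  · ext b
    simp only [YoungDiagram.cells_inf, Finset.mem_insert, Finset.mem_inter]
    have := hmem b
    constructor
    · intro hb
      rcases this.1 (Or.inr hb) with h | h
      · exact Or.inl h
      · exact Or.inr ⟨hb, h⟩
    · rintro (rfl | hb)
      · exact hdl
      · exact hb.1
  · ext b
    simp only [YoungDiagram.cells_inf, Finset.mem_insert, Finset.mem_inter]
    have := hmem b
    constructor
    · intro hb
      rcases this.2 (Or.inr hb) with h | h
      · exact Or.inl h
      · exact Or.inr ⟨h, hb⟩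
    · rintro (rfl | hb)
      · exact hck
      · exact hb.2

theorem exists_mem_convexCorners {lam : YoungDiagram} (h : lam.card ≠ 0) :
    ∃ y, y ∈ convexCorners lam := by
  have hne : lam.cells.Nonempty := Finset.card_ne_zero.1 h
  obtain ⟨c, hc⟩ := lam.cells.exists_maximal hne
  refine ⟨uCoord c, Finset.mem_image_of_mem _ (Finset.mem_filter.2 ⟨hc.1, fun h => ?_, fun h => ?_⟩)⟩
  · have := (hc.2 h (Prod.mk_le_mk.2 ⟨Nat.le_succ _, le_rfl⟩)).1
    simp at this
  · have := (hc.2 h (Prod.mk_le_mk.2 ⟨le_rfl, Nat.le_succ _⟩)).2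
    simp at this

theorem growsAt_induction {p : YoungDiagram → Prop} (h0 : p ⊥)
    (h1 : ∀ lam x nu, GrowsAt lam x nu → p lam → p nu) (lam : YoungDiagram) : p lam := by
  induction hn : lam.card generalizing lam with
  | zero =>
    have : lam = ⊥ := by
      apply YoungDiagram.ext
      simpa [YoungDiagram.card] using hn
    exact this ▸ h0
  | succ n ih =>
    obtain ⟨y, hy⟩ := exists_mem_convexCorners (lam := lam) (by omega)
    obtain ⟨kap, hk⟩ := exists_growsAt_of_mem_convexCorners hy
    exact h1 _ _ _ hk (ih kap (by have := hk.card; omega))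

/-- `1` at the concave corners of `lam`, `-1` at the convex corners, `0` elsewhere. -/
noncomputable def cornerSign (lam : YoungDiagram) (z : ℤ) : ℤ :=
  (if z ∈ concaveCorners lam then 1 else 0) - if z ∈ convexCorners lam then 1 else 0

open Classical in
theorem cornerSign_eq_maya (lam : YoungDiagram) (z : ℤ) :
    cornerSign lam z = (if z ∈ maya lam then 1 else 0) - if z + 1 ∈ maya lam then 1 else 0 := by
  simp only [cornerSign, mem_concaveCorners, mem_convexCorners]
  by_cases h1 : z ∈ maya lam <;> by_cases h2 : z + 1 ∈ maya lam <;> simp [h1, h2]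

theorem disjoint_corners {lam : YoungDiagram} {z : ℤ} (h : z ∈ concaveCorners lam) :
    z ∉ convexCorners lam := by
  rw [mem_concaveCorners] at h
  rw [mem_convexCorners]
  tauto

theorem cornerSign_eq_one_iff (lam : YoungDiagram) (z : ℤ) :
    cornerSign lam z = 1 ↔ z ∈ concaveCorners lam := by
  unfold cornerSign
  split_ifs with h1 h2 h2
  · exact absurd h2 (disjoint_corners h1)
  all_goals simp [h1]

/-- The change of the corners caused by a new box at `x`. -/
def boxSign (x z : ℤ) : ℤ :=
  (if z = x + 1 then 1 else 0) + (if z = x - 1 then 1 else 0) - 2 * if z = x then 1 else 0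

theorem GrowsAt.cornerSign_eq {lam nu : YoungDiagram} {x : ℤ} (h : GrowsAt lam x nu) (z : ℤ) :
    cornerSign nu z = cornerSign lam z + boxSign x z := by
  classical
  rw [cornerSign_eq_maya, cornerSign_eq_maya]
  simp only [h.mem_maya, boxSign]
  obtain ⟨h1, h2⟩ := h.mem_maya_left
  by_cases e1 : z = x
  · subst e1
    simp [h1, h2, show z ≠ z - 1 by omega]
  by_cases e2 : z = x + 1
  · subst e2
    simp [h2, show x + 1 + 1 ≠ x by omega, show x + 1 ≠ x - 1 by omega]
    ring
  by_cases e3 : z = x - 1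
  · subst e3
    simp [h1, show x - 1 ≠ x + 1 by omega]
  · simp [e1, e2, e3, show z + 1 ≠ x by omega]

@[to_additive]
theorem prod_zpow_cornerSign {G : Type*} [CommGroup G] (lam : YoungDiagram) (g : ℤ → G)
    (S : Finset ℤ) (h1 : concaveCorners lam ⊆ S) (h2 : convexCorners lam ⊆ S) :
    (∏ z ∈ concaveCorners lam, g z) / ∏ z ∈ convexCorners lam, g z =
      ∏ z ∈ S, g z ^ cornerSign lam z := by
  have e : ∀ T ⊆ S, ∏ z ∈ T, g z = ∏ z ∈ S, g z ^ (if z ∈ T then (1 : ℤ) else 0) := by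
    intro T hT
    rw [← Finset.prod_subset hT]
    · exact Finset.prod_congr rfl fun z hz => by rw [if_pos hz, zpow_one]
    · intro z _ hz
      rw [if_neg hz, zpow_zero]
  rw [e _ h1, e _ h2, ← Finset.prod_div_distrib]
  exact Finset.prod_congr rfl fun z _ => by rw [cornerSign, zpow_sub, div_eq_mul_inv]

@[to_additive]
theorem GrowsAt.prod_corners {G : Type*} [CommGroup G] {lam nu : YoungDiagram} {x : ℤ}
    (h : GrowsAt lam x nu) (g : ℤ → G) :
    (∏ z ∈ concaveCorners nu, g z) / ∏ z ∈ convexCorners nu, g z =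
      ((∏ z ∈ concaveCorners lam, g z) / ∏ z ∈ convexCorners lam, g z) *
        (g (x + 1) * g (x - 1) / (g x * g x)) := by
  classical
  let S := (concaveCorners nu ∪ convexCorners nu) ∪ (concaveCorners lam ∪ convexCorners lam) ∪
    {x, x + 1, x - 1}
  have hS : ∀ a ∈ ({x, x + 1, x - 1} : Finset ℤ), a ∈ S := fun a ha =>
    Finset.mem_union_right _ ha
  rw [prod_zpow_cornerSign nu g S (fun z hz => by simp [S, hz]) (fun z hz => by simp [S, hz]),
    prod_zpow_cornerSign lam g S (fun z hz => by simp [S, hz]) (fun z hz => by simp [S, hz])]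
  have e : ∀ a ∈ ({x, x + 1, x - 1} : Finset ℤ),
      ∏ z ∈ S, g z ^ (if z = a then (1 : ℤ) else 0) = g a := by
    intro a ha
    rw [Finset.prod_eq_single a]
    · simp
    · intro b _ hb
      simp [hb]
    · intro h
      exact absurd (hS a ha) h
  rw [← e (x + 1) (by simp), ← e (x - 1) (by simp), ← e x (by simp), ← Finset.prod_mul_distrib,
    ← Finset.prod_mul_distrib, ← Finset.prod_div_distrib, ← Finset.prod_mul_distrib]
  refine Finset.prod_congr rfl fun z _ => ?_
  rw [h.cornerSign_eq, boxSign, zpow_add, zpow_sub, zpow_add, two_mul, zpow_add, div_eq_mul_inv]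

theorem concaveCorners_bot : concaveCorners ⊥ = {0} := by
  ext z
  have h : ∀ i, (⊥ : YoungDiagram).rowLen i = 0 := fun i => by
    by_contra h
    have : (i, 0) ∈ (⊥ : YoungDiagram) := YoungDiagram.mem_iff_lt_rowLen.2 (by omega)
    simp at this
  simp only [mem_concaveCorners, maya, h, Set.mem_ofPred_eq, Finset.mem_singleton]
  constructor
  · rintro ⟨⟨i, hi⟩, h2⟩
    by_contra h3
    exact h2 ⟨i - 1, by omega⟩
  · rintro rfl
    exact ⟨⟨0, by simp⟩, by rintro ⟨i, hi⟩; omega⟩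

theorem convexCorners_bot : convexCorners ⊥ = ∅ := by
  simp [convexCorners, removableBoxes]

theorem card_bot : (⊥ : YoungDiagram).card = 0 := by
  simp [YoungDiagram.card]

theorem sum_corners_pow (lam : YoungDiagram) :
    (((concaveCorners lam).card : ℝ) - (convexCorners lam).card = 1) ∧
    (∑ x ∈ concaveCorners lam, (x : ℝ) - ∑ y ∈ convexCorners lam, (y : ℝ) = 0) ∧
    (∑ x ∈ concaveCorners lam, (x : ℝ) ^ 2 - ∑ y ∈ convexCorners lam, (y : ℝ) ^ 2 =
      2 * lam.card) := by
  induction lam using growsAt_induction with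
  | h0 => simp [concaveCorners_bot, convexCorners_bot, card_bot]
  | h1 lam x nu h ih =>
    obtain ⟨h1, h2, h3⟩ := ih
    have e1 := h.sum_corners (fun _ => (1 : ℝ))
    have e2 := h.sum_corners (fun z => (z : ℝ))
    have e3 := h.sum_corners (fun z => (z : ℝ) ^ 2)
    simp only [Finset.sum_const, nsmul_eq_mul, mul_one] at e1
    rw [e1, e2, e3, h1, h2, h3, h.card]
    push_cast
    refine ⟨by ring, by ring, by ring⟩

theorem card_concaveCorners (lam : YoungDiagram) :
    (concaveCorners lam).card = (convexCorners lam).card + 1 := by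
  have := (sum_corners_pow lam).1
  have h : ((concaveCorners lam).card : ℝ) = ((convexCorners lam).card + 1 : ℕ) := by
    push_cast
    linarith
  exact_mod_cast h

/-- The factor by which a box at distance `d` multiplies the Cauchy transform. -/
noncomputable def boxFactor (d : ℝ) : ℝ := d ^ 2 / ((d - 1) * (d + 1))

theorem GrowsAt.cauchyTransform_eq {lam nu : YoungDiagram} {x : ℤ} (h : GrowsAt lam x nu) {z : ℝ}
    (hz : ∀ w : ℤ, z ≠ w) :
    cauchyTransform nu z = cauchyTransform lam z * boxFactor (z - x) := by
  have hz' : ∀ w : ℤ, z - w ≠ 0 := fun w => sub_ne_zero.2 (hz w)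
  have e := congrArg Units.val (h.prod_corners fun w => Units.mk0 (z - w) (hz' w))
  simp only [Units.val_div_eq_div_val, Units.val_mul, Units.coe_prod, Units.val_mk0] at e
  rw [cauchyTransform, ← inv_div, e, mul_inv, inv_div, inv_div,
    cauchyTransform, boxFactor]
  push_cast
  congr 1
  ring_nf

open Filter Topology

theorem eventually_ne_intCast (u : ℤ) : ∀ᶠ z : ℝ in 𝓝[≠] (u : ℝ), ∀ w : ℤ, z ≠ w := by
  have h : Set.Ioo ((u : ℝ) - 1) (u + 1) ∈ 𝓝 (u : ℝ) := Ioo_mem_nhds (by linarith) (by linarith)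
  filter_upwards [nhdsWithin_le_nhds h, self_mem_nhdsWithin] with z hz hne w hw
  subst hw
  have h1 : u - 1 < w := by exact_mod_cast hz.1
  have h2 : w < u + 1 := by exact_mod_cast hz.2
  exact hne (by simp [show w = u by omega])

theorem prod_sub_ne_zero {S : Finset ℤ} {u : ℤ} (h : u ∉ S) : ∏ x ∈ S, ((u : ℝ) - x) ≠ 0 := by
  refine Finset.prod_ne_zero_iff.2 fun x hx => sub_ne_zero.2 fun e => h ?_
  rwa [Int.cast_injective e]

theorem tendsto_prod_sub (S : Finset ℤ) (u : ℝ) :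
    Tendsto (fun z : ℝ => ∏ x ∈ S, (z - x)) (𝓝[≠] u) (𝓝 (∏ x ∈ S, (u - x))) :=
  ((continuous_finsetProd S fun _ _ => continuous_id.sub continuous_const).tendsto u).mono_left
    nhdsWithin_le_nhds

theorem tendsto_cauchyTransform {lam : YoungDiagram} {u : ℤ} (hu : u ∉ concaveCorners lam) :
    Tendsto (cauchyTransform lam) (𝓝[≠] (u : ℝ)) (𝓝 (cauchyTransform lam u)) :=
  (tendsto_prod_sub _ _).div (tendsto_prod_sub _ _) (prod_sub_ne_zero hu)

theorem tendsto_mul_cauchyTransform {lam : YoungDiagram} {u : ℤ} (hu : u ∈ concaveCorners lam) :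
    Tendsto (fun z : ℝ => (z - u) * cauchyTransform lam z) (𝓝[≠] (u : ℝ))
      (𝓝 (transitionMeasure lam u)) := by
  rw [transitionMeasure, if_pos hu]
  have h := (tendsto_prod_sub (convexCorners lam) u).div
    (tendsto_prod_sub ((concaveCorners lam).erase u) u)
    (prod_sub_ne_zero (Finset.notMem_erase _ _))
  refine h.congr' ?_
  filter_upwards [self_mem_nhdsWithin] with z hz
  have hz' : z - u ≠ 0 := sub_ne_zero.2 hz
  rw [cauchyTransform, ← Finset.mul_prod_erase _ _ hu, mul_div_assoc', mul_div_mul_left _ _ hz']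
  rfl

theorem tendsto_cauchyTransform_div {lam : YoungDiagram} {u : ℤ} (hu : u ∈ convexCorners lam) :
    Tendsto (fun z : ℝ => cauchyTransform lam z / (z - u)) (𝓝[≠] (u : ℝ))
      (𝓝 ((∏ y ∈ (convexCorners lam).erase u, ((u : ℝ) - y)) /
        ∏ x ∈ concaveCorners lam, ((u : ℝ) - x))) := by
  have h := (tendsto_prod_sub ((convexCorners lam).erase u) u).div
    (tendsto_prod_sub (concaveCorners lam) u)
    (prod_sub_ne_zero fun h => disjoint_corners h hu)
  refine h.congr' ?_
  filter_upwards [self_mem_nhdsWithin] with z hz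
  have hz' : z - u ≠ 0 := sub_ne_zero.2 hz
  rw [cauchyTransform, ← Finset.mul_prod_erase _ _ hu, div_right_comm, mul_div_cancel_left₀ _ hz']
  rfl

theorem transitionMeasure_ne_zero {lam : YoungDiagram} {x : ℤ} (hx : x ∈ concaveCorners lam) :
    transitionMeasure lam x ≠ 0 := by
  rw [transitionMeasure, if_pos hx]
  exact div_ne_zero (prod_sub_ne_zero (disjoint_corners hx))
    (prod_sub_ne_zero (Finset.notMem_erase _ _))

theorem boxFactor_neg (d : ℝ) : boxFactor (-d) = boxFactor d := by
  unfold boxFactor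
  congr 1 <;> ring

theorem tendsto_boxFactor {u x : ℤ} (h1 : u ≠ x + 1) (h2 : u ≠ x - 1) :
    Tendsto (fun z : ℝ => boxFactor (z - x)) (𝓝[≠] (u : ℝ)) (𝓝 (boxFactor (u - x))) := by
  have : ContinuousAt (fun z : ℝ => boxFactor (z - x)) (u : ℝ) := by
    unfold boxFactor
    refine ContinuousAt.div (by fun_prop) (by fun_prop) (mul_ne_zero ?_ ?_)
    · intro h
      exact h1 (by exact_mod_cast (show (u : ℝ) = x + 1 by linarith))
    · intro h
      exact h2 (by exact_mod_cast (show (u : ℝ) = x - 1 by linarith))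
  exact this.tendsto.mono_left nhdsWithin_le_nhds

/-- Adding a box away from the concave corner `u` multiplies the weight of `u`. -/
theorem GrowsAt.transitionMeasure_of_ne {lam nu : YoungDiagram} {x u : ℤ} (h : GrowsAt lam x nu)
    (hu : u ∈ concaveCorners lam) (hu' : u ∈ concaveCorners nu) (h1 : u ≠ x + 1)
    (h2 : u ≠ x - 1) :
    transitionMeasure nu u = transitionMeasure lam u * boxFactor (u - x) := by
  refine tendsto_nhds_unique (tendsto_mul_cauchyTransform hu') ?_
  refine ((tendsto_mul_cauchyTransform hu).mul (tendsto_boxFactor h1 h2)).congr' ?_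
  filter_upwards [eventually_ne_intCast u] with z hz
  rw [h.cauchyTransform_eq hz, mul_assoc]

/-- The weight of a box before it is added, in terms of the corners afterwards. -/
theorem GrowsAt.transitionMeasure_self {lam nu : YoungDiagram} {y : ℤ} (h : GrowsAt lam y nu) :
    transitionMeasure lam y = -((∏ y' ∈ (convexCorners nu).erase y, ((y : ℝ) - y')) /
        ∏ x ∈ concaveCorners nu, ((y : ℝ) - x)) := by
  refine tendsto_nhds_unique (tendsto_mul_cauchyTransform h.mem_concaveCorners) ?_
  have hc : Tendsto (fun z : ℝ => (z - y - 1) * (z - y + 1)) (𝓝[≠] (y : ℝ)) (𝓝 (-1)) := by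
    have : Continuous fun z : ℝ => (z - y - 1) * (z - y + 1) := by fun_prop
    have := (this.tendsto (y : ℝ)).mono_left (nhdsWithin_le_nhds (s := {(y : ℝ)}ᶜ))
    simpa using this
  have := (tendsto_cauchyTransform_div h.mem_convexCorners).mul hc
  rw [mul_neg_one] at this
  refine this.congr' ?_
  filter_upwards [eventually_ne_intCast y] with z hz
  have h0 : z - y ≠ 0 := sub_ne_zero.2 (hz y)
  have h1 : z - y - 1 ≠ 0 := fun e => hz (y + 1) (by push_cast; linarith)
  have h2 : z - y + 1 ≠ 0 := fun e => hz (y - 1) (by push_cast; linarith)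
  rw [h.cauchyTransform_eq hz, boxFactor]
  field_simp

open Polynomial in
theorem two_mul_esymm_two (A : Multiset ℝ) :
    2 * A.esymm 2 = A.sum ^ 2 - (A.map (· ^ 2)).sum := by
  induction A using Multiset.induction with
  | empty =>
    have : Multiset.powersetCard 2 (0 : Multiset ℝ) = 0 := Multiset.powersetCard_zero_right 1
    simp [Multiset.esymm, this]
  | cons a A ih =>
    have h : (a ::ₘ A).esymm 2 = A.esymm 2 + a * A.sum := by
      simp only [Multiset.esymm, Multiset.powersetCard_cons, Multiset.map_add, Multiset.sum_add,
        Multiset.map_map, Function.comp_def, Multiset.prod_cons, Multiset.powersetCard_one,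
        Multiset.prod_singleton]
      rw [Multiset.sum_map_mul_left, Multiset.map_id']
    rw [h, Multiset.sum_cons, Multiset.map_cons, Multiset.sum_cons, mul_add, ih]
    ring

open Polynomial in
/-- Two monic polynomials of degree `d + 1` whose roots have the same sum. -/
theorem prod_X_sub_C_sub {A B : Multiset ℝ} {d : ℕ} (hd : 1 ≤ d) (hA : A.card = d + 1)
    (hB : B.card = d + 1) (hs : A.sum = B.sum) :
    ((A.map fun a => X - C a).prod - (B.map fun a => X - C a).prod).degree < (d : WithBot ℕ) ∧
    ((A.map fun a => X - C a).prod - (B.map fun a => X - C a).prod).coeff (d - 1) =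
      ((B.map (· ^ 2)).sum - (A.map (· ^ 2)).sum) / 2 := by
  have h1 : ∀ {S : Multiset ℝ}, S.esymm 1 = S.sum := by
    intro S
    simp [Multiset.esymm, Multiset.powersetCard_one]
  constructor
  · rw [degree_lt_iff_coeff_zero]
    intro m hm
    rw [coeff_sub]
    rcases lt_or_ge (d + 1) m with h | h
    · rw [coeff_eq_zero_of_natDegree_lt, coeff_eq_zero_of_natDegree_lt, sub_zero]
      · rw [natDegree_multiset_prod_X_sub_C_eq_card, hB]
        exact h
      · rw [natDegree_multiset_prod_X_sub_C_eq_card, hA]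
        exact h
    · rw [Multiset.prod_X_sub_C_coeff _ (by omega), Multiset.prod_X_sub_C_coeff _ (by omega), hA, hB]
      rcases (show m = d ∨ m = d + 1 by omega) with rfl | rfl
      · simp [h1, hs]
      · simp [Multiset.esymm]
  · rw [coeff_sub, Multiset.prod_X_sub_C_coeff _ (by omega), Multiset.prod_X_sub_C_coeff _ (by omega),
      hA, hB, show d + 1 - (d - 1) = 2 by omega]
    have hA2 := two_mul_esymm_two A
    have hB2 := two_mul_esymm_two B
    rw [hs] at hA2
    linarith

open Polynomial in
theorem sum_residues (lam : YoungDiagram) {x : ℤ} (hx : x ∈ concaveCorners lam) :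
    (∑ y ∈ convexCorners lam, (∏ x' ∈ concaveCorners lam, ((y : ℝ) - x')) /
      (∏ y' ∈ (convexCorners lam).erase y, ((y : ℝ) - y')) * (1 - 1 / ((x : ℝ) - y) ^ 2)) =
      (transitionMeasure lam x)⁻¹ - (lam.card + 1) := by
  set S := concaveCorners lam
  set T := convexCorners lam
  have hxT : x ∉ T := disjoint_corners hx
  obtain ⟨-, hm1, hm2⟩ := sum_corners_pow lam
  have hcard : S.card = T.card + 1 := card_concaveCorners lam
  let A : Multiset ℝ := ((x : ℝ) + 1) ::ₘ ((x : ℝ) - 1) ::ₘ (S.erase x).val.map fun z : ℤ => (z : ℝ)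
  let B : Multiset ℝ := (0 : ℝ) ::ₘ (insert x T).val.map fun z : ℤ => (z : ℝ)
  have hcB : (insert x T).card = T.card + 1 := Finset.card_insert_of_notMem hxT
  have key := prod_X_sub_C_sub (A := A) (B := B) (d := T.card + 1) (by omega)
    (by
      have : (S.erase x).card = T.card := by rw [Finset.card_erase_of_mem hx, hcard, Nat.add_sub_cancel]
      rw [Multiset.card_cons, Multiset.card_cons, Multiset.card_map, ← this]
      rfl) (by simp [B, hxT]) (by
      have := Finset.add_sum_erase S (fun z : ℤ => (z : ℝ)) hx
      have e : ((insert x T).val.map fun z : ℤ => (z : ℝ)).sum = x + ∑ y ∈ T, (y : ℝ) :=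
        Finset.sum_insert hxT
      have e' : ((S.erase x).val.map fun z : ℤ => (z : ℝ)).sum = ∑ y ∈ S.erase x, (y : ℝ) := rfl
      simp only [A, B, Multiset.sum_cons, e, e']
      linarith)
  rw [← hcB] at key
  obtain ⟨k1, k2⟩ := key
  have hL := Lagrange.coeff_eq_sum (s := insert x T) (v := fun z : ℤ => (z : ℝ))
    (Int.cast_injective.injOn) k1
  rw [k2] at hL
  have hsq : ((B.map (· ^ 2)).sum - (A.map (· ^ 2)).sum) / 2 = -((lam.card : ℝ) + 1) := by
    have := Finset.add_sum_erase S (fun z : ℤ => (z : ℝ) ^ 2) hx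
    have e : ((insert x T).val.map fun z : ℤ => (z : ℝ) ^ 2).sum = x ^ 2 + ∑ y ∈ T, (y : ℝ) ^ 2 :=
      Finset.sum_insert hxT
    have e' : ((S.erase x).val.map fun z : ℤ => (z : ℝ) ^ 2).sum = ∑ y ∈ S.erase x, (y : ℝ) ^ 2 :=
      rfl
    simp only [A, B, Multiset.map_cons, Multiset.sum_cons, Multiset.map_map, Function.comp_def, e, e']
    linarith
  have hev : ∀ w ∈ insert x T, (((A.map fun a => X - C a).prod -
      (B.map fun a => X - C a).prod).eval (w : ℝ)) =
        ((w : ℝ) - x - 1) * (w - x + 1) * ∏ x' ∈ S.erase x, ((w : ℝ) - x') := by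
    intro w hw
    have hB0 : ((B.map fun a => X - C a).prod).eval (w : ℝ) = 0 := by
      rw [eval_multiset_prod, Multiset.prod_eq_zero_iff]
      simp only [B, Multiset.map_cons, Multiset.map_map, Multiset.mem_cons, Multiset.mem_map]
      exact Or.inr ⟨w, hw, by simp⟩
    rw [eval_sub, hB0, sub_zero]
    simp only [A, Multiset.map_cons, Multiset.map_map, Multiset.prod_cons, eval_mul, eval_sub,
      eval_X, eval_C, eval_multiset_prod, Function.comp_def]
    rw [Finset.prod]
    ring
  rw [Finset.sum_congr rfl fun w hw => by rw [hev w hw], hsq, Finset.sum_insert hxT] at hL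
  have ex : (transitionMeasure lam x)⁻¹ = (∏ x' ∈ S.erase x, ((x : ℝ) - x')) /
      ∏ y ∈ T, ((x : ℝ) - y) := by
    rw [transitionMeasure, if_pos hx, inv_div]
  rw [Finset.erase_insert hxT] at hL
  have e2 : ∀ y ∈ T, ((y : ℝ) - x - 1) * (y - x + 1) * (∏ x' ∈ S.erase x, ((y : ℝ) - x')) /
      (∏ j ∈ (insert x T).erase y, ((y : ℝ) - j)) =
      (∏ x' ∈ S, ((y : ℝ) - x')) / (∏ y' ∈ T.erase y, ((y : ℝ) - y')) *
        (1 - 1 / ((x : ℝ) - y) ^ 2) := by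
    intro y hy
    have hne : y ≠ x := fun h => hxT (h ▸ hy)
    have h0 : (y : ℝ) - x ≠ 0 := sub_ne_zero.2 (by exact_mod_cast hne)
    have h0' : (x : ℝ) - y ≠ 0 := sub_ne_zero.2 (by exact_mod_cast hne.symm)
    have h1 : ∏ y' ∈ T.erase y, ((y : ℝ) - y') ≠ 0 := prod_sub_ne_zero (Finset.notMem_erase _ _)
    rw [Finset.erase_insert_of_ne hne.symm, Finset.prod_insert (fun h => hxT (Finset.mem_of_mem_erase h)),
      ← Finset.mul_prod_erase S _ hx]
    field_simp
    ring
  rw [Finset.sum_congr rfl e2] at hL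
  rw [ex]
  simp only [sub_self] at hL
  rw [show (0 - 1 : ℝ) * (0 + 1) * (∏ x' ∈ S.erase x, ((x : ℝ) - x')) =
    -∏ x' ∈ S.erase x, ((x : ℝ) - x') by ring, neg_div] at hL
  linarith

open Polynomial in
theorem sum_transitionMeasure (lam : YoungDiagram) :
    ∑ x ∈ concaveCorners lam, transitionMeasure lam x = 1 := by
  have hcard := card_concaveCorners lam
  have hdeg : (Lagrange.nodal (convexCorners lam) (fun z : ℤ => (z : ℝ))).degree =
      (convexCorners lam).card := Lagrange.degree_nodal
  have h := Lagrange.leadingCoeff_eq_sum (s := concaveCorners lam) (v := fun z : ℤ => (z : ℝ))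
    Int.cast_injective.injOn (P := Lagrange.nodal (convexCorners lam) (fun z : ℤ => (z : ℝ)))
    (by rw [hdeg, hcard]; rfl)
  rw [Lagrange.nodal_monic.leadingCoeff] at h
  rw [h]
  refine Finset.sum_congr rfl fun x hx => ?_
  rw [transitionMeasure, if_pos hx, Lagrange.eval_nodal]

theorem optionCongr_removeNone_of_none {α β : Type*} (e : Option α ≃ Option β)
    (h : e none = none) : (Equiv.removeNone e).optionCongr = e := by
  ext1 a
  cases a with
  | none => simp [h]
  | some a =>
    simp only [Equiv.optionCongr_apply, Option.map_some]
    refine Equiv.removeNone_some e ?_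
    have : e (some a) ≠ none := fun h' => by
      have := e.injective (h'.trans h.symm)
      simp at this
    exact Option.ne_none_iff_exists'.1 this

/-- Linear extensions whose last element is the maximal element `c`. -/
theorem card_linearExtensions_insert {α : Type*} [PartialOrder α] [DecidableEq α] {s t : Finset α}
    {c : α} (hc : c ∉ s) (hmax : ∀ b ∈ s, ¬ c ≤ b) (ht : t = insert c s) (hct : c ∈ t) (n : ℕ) :
    Nat.card {T : t ≃ Fin (n + 1) // StrictMono T ∧ T ⟨c, hct⟩ = Fin.last n} =
    Nat.card {T : s ≃ Fin n // StrictMono T} := by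
  subst ht
  let e1 := Finset.subtypeInsertEquivOption hc
  let e2 := finSuccEquivLast (n := n)
  have e1c : e1 ⟨c, Finset.mem_insert_self c s⟩ = none := by
    simp [e1, Finset.subtypeInsertEquivOption]
  have e1b : ∀ b : s, e1 ⟨b, Finset.mem_insert_of_mem b.2⟩ = some b := by
    rintro ⟨b, hb⟩
    have : b ≠ c := fun h => hc (h ▸ hb)
    simp [e1, Finset.subtypeInsertEquivOption, this]
  let F : (s ≃ Fin n) → ((insert c s : Finset α) ≃ Fin (n + 1)) := fun T =>
    e1.trans (T.optionCongr.trans e2.symm)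
  have Fc : ∀ T, F T ⟨c, Finset.mem_insert_self c s⟩ = Fin.last n := fun T => by
    simp [F, e1c, e2]
  have Fb : ∀ T (b : s), F T ⟨b, Finset.mem_insert_of_mem b.2⟩ = (T b).castSucc := fun T b => by
    simp [F, e1b, e2]
  have hF : ∀ T, StrictMono (F T) ↔ StrictMono T := by
    intro T
    constructor
    · intro h a b hab
      have := h (show (⟨a, Finset.mem_insert_of_mem a.2⟩ : (insert c s : Finset α)) <
        ⟨b, Finset.mem_insert_of_mem b.2⟩ from hab)
      rwa [Fb, Fb, Fin.castSucc_lt_castSucc_iff] at this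
    · rintro h ⟨a, ha⟩ ⟨b, hb⟩ hab
      have hab' : a < b := hab
      rcases Finset.mem_insert.1 ha with rfl | ha'
      · rcases Finset.mem_insert.1 hb with rfl | hb'
        · exact absurd hab' (lt_irrefl _)
        · exact absurd hab'.le (hmax _ hb')
      · rw [Fb T ⟨a, ha'⟩]
        rcases Finset.mem_insert.1 hb with rfl | hb'
        · rw [Fc]
          exact Fin.castSucc_lt_last _
        · rw [Fb T ⟨b, hb'⟩]
          exact Fin.castSucc_lt_castSucc_iff.2 (h hab')
  symm
  refine Nat.card_congr (Equiv.ofBijective (fun T => ⟨F T.1, (hF _).2 T.2, Fc _⟩) ⟨?_, ?_⟩)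
  · rintro ⟨T, hT⟩ ⟨T', hT'⟩ h
    simp only [Subtype.mk.injEq] at h ⊢
    ext1 b
    have := Fb T b
    rw [h, Fb] at this
    exact (Fin.castSucc_injective _ this).symm
  · rintro ⟨T, hT, hTc⟩
    have hFT : F (Equiv.removeNone (e1.symm.trans (T.trans e2))) = T := by
      simp only [F]
      rw [optionCongr_removeNone_of_none]
      · ext1 b
        simp
      · have : e1.symm none = ⟨c, Finset.mem_insert_self c s⟩ := by rw [← e1c, e1.symm_apply_apply]
        simp [this, hTc, e2]
    exact ⟨⟨Equiv.removeNone (e1.symm.trans (T.trans e2)), (hF _).1 (by rw [hFT]; exact hT)⟩, Subtype.ext hFT⟩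

theorem numSYT_eq {lam : YoungDiagram} {n : ℕ} (h : lam.card = n) :
    numSYT lam = Nat.card {T : lam.cells ≃ Fin n // StrictMono T} := by
  subst h
  rfl

theorem eq_of_mem_removableBoxes {nu : YoungDiagram} {b c : ℕ × ℕ} (hb : b ∈ removableBoxes nu)
    (hc : c ∈ removableBoxes nu) (h : uCoord b = uCoord c) : b = c := by
  obtain ⟨i, j⟩ := b
  obtain ⟨k, l⟩ := c
  simp only [removableBoxes, Finset.mem_filter, uCoord] at hb hc h
  rcases lt_trichotomy i k with h1 | rfl | h1
  · exact absurd (nu.isLowerSet (Prod.mk_le_mk.2 ⟨h1, by omega⟩) hc.1) hb.2.1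
  · congr 1
    omega
  · exact absurd (nu.isLowerSet (Prod.mk_le_mk.2 ⟨h1, by omega⟩) hb.1) hc.2.1

theorem not_le_of_mem_removableBoxes {nu : YoungDiagram} {b c : ℕ × ℕ} (hc : c ∈ removableBoxes nu)
    (hb : b ∈ nu.cells) (hbc : b ≠ c) : ¬ c ≤ b := by
  intro h
  obtain ⟨i, j⟩ := b
  obtain ⟨k, l⟩ := c
  simp only [removableBoxes, Finset.mem_filter] at hc
  rcases Prod.mk_lt_mk.1 (lt_of_le_of_ne h hbc.symm) with ⟨h1, h2⟩ | ⟨h1, h2⟩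
  · exact hc.2.1 (nu.isLowerSet (Prod.mk_le_mk.2 ⟨h1, h2⟩) hb)
  · exact hc.2.2 (nu.isLowerSet (Prod.mk_le_mk.2 ⟨h1, h2⟩) hb)

open Classical in
/-- The diagram with the box at the convex corner `y` removed. -/
noncomputable def shrink (nu : YoungDiagram) (y : ℤ) : YoungDiagram :=
  if h : ∃ lam, GrowsAt lam y nu then h.choose else nu

theorem growsAt_shrink {nu : YoungDiagram} {y : ℤ} (hy : y ∈ convexCorners nu) :
    GrowsAt (shrink nu y) y nu := by
  have h := exists_growsAt_of_mem_convexCorners hy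
  rw [shrink, dif_pos h]
  exact h.choose_spec

theorem GrowsAt.shrink_eq {lam nu : YoungDiagram} {y : ℤ} (h : GrowsAt lam y nu) :
    shrink nu y = lam :=
  (growsAt_shrink h.mem_convexCorners).unique_left h

theorem numSYT_eq_sum {nu : YoungDiagram} (h : nu.card ≠ 0) :
    numSYT nu = ∑ y ∈ convexCorners nu, numSYT (shrink nu y) := by
  obtain ⟨n, hn⟩ := Nat.exists_eq_succ_of_ne_zero h
  rw [numSYT_eq hn]
  have hrem : ∀ T : {T : nu.cells ≃ Fin (n + 1) // StrictMono T},
      (T.1.symm (Fin.last n)).1 ∈ removableBoxes nu := by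
    rintro ⟨T, hT⟩
    refine Finset.mem_filter.2 ⟨(T.symm (Fin.last n)).2, ?_, ?_⟩ <;> intro hm
    · have := hT (show T.symm (Fin.last n) < ⟨_, hm⟩ from
        Prod.mk_lt_mk.2 (Or.inl ⟨Nat.lt_succ_self _, le_rfl⟩))
      rw [Equiv.apply_symm_apply] at this
      exact absurd (Fin.le_last _) this.not_ge
    · have := hT (show T.symm (Fin.last n) < ⟨_, hm⟩ from
        Prod.mk_lt_mk.2 (Or.inr ⟨le_rfl, Nat.lt_succ_self _⟩))
      rw [Equiv.apply_symm_apply] at this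
      exact absurd (Fin.le_last _) this.not_ge
  let f : {T : nu.cells ≃ Fin (n + 1) // StrictMono T} → convexCorners nu := fun T =>
    ⟨uCoord (T.1.symm (Fin.last n)), Finset.mem_image_of_mem _ (hrem T)⟩
  rw [← Nat.card_congr (Equiv.sigmaFiberEquiv f), Nat.card_sigma,
    ← Finset.sum_coe_sort (convexCorners nu) fun y => numSYT (shrink nu y)]
  refine Finset.sum_congr rfl fun y _ => ?_
  obtain ⟨y, hy⟩ := y
  obtain ⟨c, hc, rfl⟩ := Finset.mem_image.1 hy
  obtain ⟨lam, hlam⟩ := exists_erase_of_mem_removableBoxes hc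
  have hcn : c ∈ nu.cells := (Finset.mem_filter.1 hc).1
  have hins : nu.cells = insert c lam.cells := by rw [hlam, Finset.insert_erase hcn]
  have hcl : c ∉ lam.cells := by simp [hlam]
  have hg : GrowsAt lam (uCoord c) nu := ⟨c, hcl, hins, rfl⟩
  have hlc : lam.card = n := by
    have := hg.card
    omega
  have hfT : ∀ T, f T = ⟨uCoord c, hy⟩ ↔ T.1 ⟨c, hcn⟩ = Fin.last n := by
    intro T
    rw [← Equiv.eq_symm_apply, Subtype.mk.injEq, Subtype.ext_iff, eq_comm (a := c)]
    exact ⟨fun h => eq_of_mem_removableBoxes (hrem T) hc h, fun h => congrArg uCoord h⟩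
  have hmax : ∀ b ∈ lam.cells, ¬ c ≤ b := by
    intro b hb
    refine not_le_of_mem_removableBoxes hc (hins ▸ Finset.mem_insert_of_mem hb) ?_
    rintro rfl
    exact hcl hb
  simp only
  rw [hg.shrink_eq, numSYT_eq hlc, ← card_linearExtensions_insert hcl hmax hins hcn n]
  exact Nat.card_congr ⟨fun T => ⟨T.1.1, T.1.2, (hfT _).1 T.2⟩,
    fun T => ⟨⟨T.1, T.2.1⟩, (hfT _).2 T.2.2⟩, fun _ => rfl, fun _ => rfl⟩

theorem numSYT_pos (lam : YoungDiagram) : 0 < numSYT lam := by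
  induction lam using growsAt_induction with
  | h0 =>
    rw [numSYT_eq card_bot]
    have : IsEmpty (⊥ : YoungDiagram).cells := ⟨fun a => YoungDiagram.notMem_bot a.1 a.2⟩
    have : Nonempty {T : (⊥ : YoungDiagram).cells ≃ Fin 0 // StrictMono T} :=
      ⟨⟨Equiv.equivOfIsEmpty _ _, fun a => isEmptyElim a⟩⟩
    exact Nat.card_pos
  | h1 lam x nu h ih =>
    rw [numSYT_eq_sum (by rw [h.card]; omega)]
    refine lt_of_lt_of_le ih ?_
    have := Finset.single_le_sum (f := fun y => numSYT (shrink nu y)) (fun _ _ => Nat.zero_le _)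
      h.mem_convexCorners
    simpa only [h.shrink_eq] using this

/-- The convex corners after adding a box at `x`. -/
theorem GrowsAt.convexCorners_eq {lam nu : YoungDiagram} {x : ℤ} (h : GrowsAt lam x nu) :
    convexCorners nu = insert x ((convexCorners lam).filter fun y => y ≠ x + 1 ∧ y ≠ x - 1) := by
  ext z
  obtain ⟨h1, h2⟩ := h.mem_maya_left
  rw [Finset.mem_insert, Finset.mem_filter, PlancherelGrowth.mem_convexCorners,
    PlancherelGrowth.mem_convexCorners, h.mem_maya, h.mem_maya]
  by_cases e1 : z = x
  · subst e1
    simp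
  by_cases e2 : z = x + 1
  · subst e2
    simp
  by_cases e3 : z = x - 1
  · subst e3
    simp
  · simp [e1, e2, e3, show z + 1 ≠ x by omega]

/-- The transition probabilities of the Plancherel growth are given by the transition measure. -/
theorem GrowsAt.numSYT_eq {lam nu : YoungDiagram} {x : ℤ} (h : GrowsAt lam x nu) :
    (numSYT nu : ℝ) = (lam.card + 1) * transitionMeasure lam x * numSYT lam := by
  induction hn : lam.card using Nat.strong_induction_on generalizing lam nu x with
  | _ n ih =>
    subst hn
    have hx := h.mem_concaveCorners
    have hmu := transitionMeasure_ne_zero hx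
    have hf : (numSYT lam : ℝ) ≠ 0 := by exact_mod_cast (numSYT_pos lam).ne'
    have hxnot : x ∉ (convexCorners lam).filter fun y => y ≠ x + 1 ∧ y ≠ x - 1 := fun h' =>
      disjoint_corners hx (Finset.mem_filter.1 h').1
    have hterm : ∀ y ∈ (convexCorners lam).filter (fun y => y ≠ x + 1 ∧ y ≠ x - 1),
        (numSYT (shrink nu y) : ℝ) = numSYT lam * transitionMeasure lam x *
          -((∏ x' ∈ concaveCorners lam, ((y : ℝ) - x')) /
      (∏ y' ∈ (convexCorners lam).erase y, ((y : ℝ) - y')) * (1 - 1 / ((x : ℝ) - y) ^ 2)) := by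
      intro y hy
      obtain ⟨hy1, hy2, hy3⟩ := Finset.mem_filter.1 hy
      have hyx : x ≠ y := fun e => disjoint_corners hx (e ▸ hy1)
      have hynu : y ∈ convexCorners nu := by
        rw [h.convexCorners_eq]
        exact Finset.mem_insert_of_mem hy
      obtain ⟨g1, g2⟩ := h.diamond (growsAt_shrink hynu) hyx
      set rho := lam ⊓ shrink nu y
      have hc := g1.card
      have i1 := ih rho.card (by omega) g1 rfl
      have i2 := ih rho.card (by omega) g2 rfl
      have e1 := g1.transitionMeasure_of_ne g2.mem_concaveCorners hx (by omega) (by omega)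
      have e2 := g1.transitionMeasure_self
      have hP : ∏ x' ∈ concaveCorners lam, ((y : ℝ) - x') ≠ 0 :=
        prod_sub_ne_zero fun h => disjoint_corners h hy1
      have hQ : ∏ y' ∈ (convexCorners lam).erase y, ((y : ℝ) - y') ≠ 0 :=
        prod_sub_ne_zero (Finset.notMem_erase _ _)
      have d0 : (x : ℝ) - y ≠ 0 := sub_ne_zero.2 (by exact_mod_cast hyx)
      have d1 : (x : ℝ) - y - 1 ≠ 0 := fun e => hy3 (by
        exact_mod_cast (show (y : ℝ) = x - 1 by linarith))
      have d2 : (x : ℝ) - y + 1 ≠ 0 := fun e => hy2 (by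
        exact_mod_cast (show (y : ℝ) = x + 1 by linarith))
      rw [i2, i1, e1, e2, boxFactor]
      field_simp
      ring
    have hsum := sum_residues lam hx
    have hsub : ∑ y ∈ (convexCorners lam).filter (fun y => y ≠ x + 1 ∧ y ≠ x - 1),
        ((∏ x' ∈ concaveCorners lam, ((y : ℝ) - x')) /
      (∏ y' ∈ (convexCorners lam).erase y, ((y : ℝ) - y')) * (1 - 1 / ((x : ℝ) - y) ^ 2)) =
      (transitionMeasure lam x)⁻¹ - (lam.card + 1) := by
      rw [← hsum]
      refine Finset.sum_subset (Finset.filter_subset _ _) fun y hy hy' => ?_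
      have : y = x + 1 ∨ y = x - 1 := by
        by_contra hcon
        exact hy' (Finset.mem_filter.2 ⟨hy, by tauto⟩)
      rcases this with rfl | rfl <;> simp
    rw [numSYT_eq_sum (by rw [h.card]; omega), h.convexCorners_eq, Finset.sum_insert hxnot,
      h.shrink_eq]
    push_cast
    rw [Finset.sum_congr rfl hterm, ← Finset.mul_sum, Finset.sum_neg_distrib, hsub]
    field_simp
    ring

theorem GrowsAt.transitionProb_eq {lam nu : YoungDiagram} {x : ℤ} (h : GrowsAt lam x nu) :
    transitionProb lam nu = transitionMeasure lam x := by
  have hf : (numSYT lam : ℝ) ≠ 0 := by exact_mod_cast (numSYT_pos lam).ne'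
  have : (lam.card : ℝ) + 1 ≠ 0 := by positivity
  rw [transitionProb, h.numSYT_eq]
  field_simp

open Classical in
/-- The diagram with a box added at the concave corner `x`. -/
noncomputable def grow (lam : YoungDiagram) (x : ℤ) : YoungDiagram :=
  if h : ∃ nu, GrowsAt lam x nu then h.choose else lam

theorem growsAt_grow {lam : YoungDiagram} {x : ℤ} (hx : x ∈ concaveCorners lam) :
    GrowsAt lam x (grow lam x) := by
  have h := exists_growsAt hx
  rw [grow, dif_pos h]
  exact h.choose_spec

theorem GrowsAt.grow_eq {lam nu : YoungDiagram} {x : ℤ} (h : GrowsAt lam x nu) :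
    grow lam x = nu :=
  (growsAt_grow h.mem_concaveCorners).unique h

theorem transitionMeasure_ne_zero_iff {lam : YoungDiagram} {x : ℤ} :
    transitionMeasure lam x ≠ 0 ↔ x ∈ concaveCorners lam := by
  refine ⟨fun h => ?_, transitionMeasure_ne_zero⟩
  by_contra hx
  exact h (if_neg hx)

/-- The probability that the boxes added by the Plancherel growth process started at `lam` have
the `u`-coordinates `L`. -/
noncomputable def pathWeight : YoungDiagram → List ℤ → ℝ
  | _, [] => 1
  | lam, x :: L => transitionMeasure lam x * pathWeight (grow lam x) L

theorem pathWeight_append (lam : YoungDiagram) (A B : List ℤ) :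
    pathWeight lam (A ++ B) = pathWeight lam A * pathWeight (A.foldl grow lam) B := by
  induction A generalizing lam with
  | nil => simp [pathWeight]
  | cons x A ih => simp only [List.cons_append, pathWeight, ih, List.foldl_cons, mul_assoc]

theorem GrowsAt.sum_sdiff {lam nu : YoungDiagram} {x : ℤ} (h : GrowsAt lam x nu) :
    ∑ c ∈ nu.cells \ lam.cells, uCoord c = x := by
  obtain ⟨c, hc, hnu, rfl⟩ := h
  rw [hnu, Finset.insert_sdiff_of_notMem _ hc, Finset.sdiff_self]
  simp

theorem IsGrowthPath.growsAt {lam : YoungDiagram} {k : ℕ} {nu : Fin (k + 1) → YoungDiagram}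
    (h : IsGrowthPath lam nu) (i : Fin k) :
    GrowsAt (nu i.castSucc) (addedU nu i) (nu i.succ) := by
  obtain ⟨x, hx⟩ := (h.2 i).exists_growsAt
  rwa [addedU, hx.sum_sdiff]

theorem IsGrowthPath.tail {lam : YoungDiagram} {k : ℕ} {nu : Fin (k + 2) → YoungDiagram}
    (h : IsGrowthPath lam nu) : IsGrowthPath (nu 1) fun i : Fin (k + 1) => nu i.succ :=
  ⟨rfl, fun i => h.2 i.succ⟩

theorem IsGrowthPath.head {lam : YoungDiagram} {k : ℕ} {nu : Fin (k + 2) → YoungDiagram}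
    (h : IsGrowthPath lam nu) : GrowsAt lam (addedU nu 0) (nu 1) := by
  have := h.growsAt 0
  rwa [Fin.castSucc_zero, h.1] at this

theorem addedU_tail {k : ℕ} (nu : Fin (k + 2) → YoungDiagram) :
    (addedU fun i : Fin (k + 1) => nu i.succ) = fun i => addedU nu i.succ := rfl

theorem IsGrowthPath.prod_transitionProb {lam : YoungDiagram} {k : ℕ}
    {nu : Fin (k + 1) → YoungDiagram} (h : IsGrowthPath lam nu) :
    ∏ i : Fin k, transitionProb (nu i.castSucc) (nu i.succ) =
      pathWeight lam (List.ofFn (addedU nu)) := by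
  induction k generalizing lam with
  | zero => simp [pathWeight]
  | succ k ih =>
    rw [Fin.prod_univ_succ, List.ofFn_succ, pathWeight, h.head.grow_eq]
    congr 1
    · rw [Fin.castSucc_zero, h.1]
      exact h.head.transitionProb_eq
    · have := ih h.tail
      simp only [Fin.succ_castSucc, addedU_tail] at this
      exact this

theorem IsGrowthPath.ext {lam : YoungDiagram} {k : ℕ} {nu nu' : Fin (k + 1) → YoungDiagram}
    (h : IsGrowthPath lam nu) (h' : IsGrowthPath lam nu') (e : addedU nu = addedU nu') :
    nu = nu' := by
  funext i
  induction i using Fin.induction with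
  | zero => exact h.1.trans h'.1.symm
  | succ i ih =>
    have h1 := h.growsAt i
    rw [e, ih] at h1
    exact h1.unique (h'.growsAt i)

theorem exists_isGrowthPath {lam : YoungDiagram} {k : ℕ} {L : List ℤ} (hL : L.length = k)
    (h : pathWeight lam L ≠ 0) :
    ∃ nu : Fin (k + 1) → YoungDiagram, IsGrowthPath lam nu ∧ List.ofFn (addedU nu) = L := by
  induction L generalizing lam k with
  | nil =>
    obtain rfl : k = 0 := hL.symm
    exact ⟨fun _ => lam, ⟨rfl, fun i => i.elim0⟩, by simp⟩
  | cons x L ih =>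
    obtain rfl : k = L.length + 1 := hL.symm
    rw [pathWeight] at h
    have hg := growsAt_grow (transitionMeasure_ne_zero_iff.1 (left_ne_zero_of_mul h))
    obtain ⟨nu, hnu, e⟩ := ih rfl (right_ne_zero_of_mul h)
    refine ⟨Fin.cons lam nu, ⟨rfl, ?_⟩, ?_⟩
    · intro i
      cases i using Fin.cases with
      | zero =>
        simp only [Fin.castSucc_zero, Fin.cons_zero, Fin.cons_succ, hnu.1]
        exact hg.grows
      | succ i =>
        rw [Fin.cons_succ, ← Fin.succ_castSucc, Fin.cons_succ]
        exact hnu.2 i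
    · rw [List.ofFn_succ]
      refine congrArg₂ List.cons ?_ ((congrArg List.ofFn (funext fun i => ?_)).trans e)
      · simp only [addedU, Fin.castSucc_zero, Fin.cons_zero, Fin.cons_succ, hnu.1]
        exact hg.sum_sdiff
      · simp only [addedU, ← Fin.succ_castSucc, Fin.cons_succ]

theorem IsPlancherelGrowth.pathWeight_ne_zero {Ω : Type*} [MeasurableSpace Ω] {P : Measure Ω}
    {lam : YoungDiagram} {k : ℕ} {D : Fin (k + 1) → Ω → YoungDiagram}
    (hD : IsPlancherelGrowth P lam D) (ω : Ω) :
    pathWeight lam (List.ofFn (addedU fun i => D i ω)) ≠ 0 := by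
  rw [← (hD.growth ω).prod_transitionProb]
  refine Finset.prod_ne_zero_iff.2 fun i _ => ?_
  have h := (hD.growth ω).growsAt i
  rw [h.transitionProb_eq]
  exact transitionMeasure_ne_zero h.mem_concaveCorners

theorem IsPlancherelGrowth.measureReal_eq {Ω : Type*} [MeasurableSpace Ω] {P : Measure Ω}
    {lam : YoungDiagram} {k : ℕ} {D : Fin (k + 1) → Ω → YoungDiagram}
    (hD : IsPlancherelGrowth P lam D) {L : List ℤ} (hL : L.length = k) :
    P.real {ω | List.ofFn (addedU fun i => D i ω) = L} = pathWeight lam L := by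
  by_cases h : pathWeight lam L = 0
  · rw [h, show {ω | List.ofFn (addedU fun i => D i ω) = L} = ∅ from ?_, measureReal_empty]
    refine Set.eq_empty_of_forall_notMem fun ω hω => hD.pathWeight_ne_zero ω ?_
    rw [show List.ofFn (addedU fun i => D i ω) = L from hω, h]
  · obtain ⟨nu, hnu, rfl⟩ := exists_isGrowthPath hL h
    rw [← hnu.prod_transitionProb, ← hD.law nu hnu]
    congr 1
    ext ω
    constructor
    · intro h i
      exact congrFun ((hD.growth ω).ext hnu (List.ofFn_injective h)) i
    · intro h
      have : (fun i => D i ω) = nu := funext h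
      simp only [Set.mem_ofPred_eq, this]

theorem IsPlancherelGrowth.measurableSet {Ω : Type*} [MeasurableSpace Ω] {P : Measure Ω}
    {lam : YoungDiagram} {k : ℕ} {D : Fin (k + 1) → Ω → YoungDiagram}
    (hD : IsPlancherelGrowth P lam D) (L : List ℤ) :
    MeasurableSet {ω | List.ofFn (addedU fun i => D i ω) = L} := by
  by_cases h : ∃ ω0, List.ofFn (addedU fun i => D i ω0) = L
  · obtain ⟨ω0, rfl⟩ := h
    have : {ω | List.ofFn (addedU fun i => D i ω) = List.ofFn (addedU fun i => D i ω0)} =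
        ⋂ i, {ω | D i ω = D i ω0} := by
      ext ω
      simp only [Set.mem_ofPred_eq, Set.mem_iInter]
      constructor
      · intro h i
        exact congrFun ((hD.growth ω).ext (hD.growth ω0) (List.ofFn_injective h)) i
      · intro h
        rw [show (fun i => D i ω) = fun i => D i ω0 from funext h]
    rw [this]
    exact MeasurableSet.iInter fun i => hD.measurable i _
  · rw [show {ω | List.ofFn (addedU fun i => D i ω) = L} = ∅ from
      Set.eq_empty_of_forall_notMem fun ω hω => h ⟨ω, hω⟩]
    exact MeasurableSet.empty

theorem cornerSign_foldl {lam : YoungDiagram} {A : List ℤ} (h : pathWeight lam A ≠ 0) (z : ℤ) :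
    cornerSign (A.foldl grow lam) z = cornerSign lam z + (A.map fun a => boxSign a z).sum := by
  induction A generalizing lam with
  | nil => simp
  | cons x A ih =>
    rw [pathWeight] at h
    have hg := growsAt_grow (transitionMeasure_ne_zero_iff.1 (left_ne_zero_of_mul h))
    rw [List.foldl_cons, ih (right_ne_zero_of_mul h), hg.cornerSign_eq, List.map_cons,
      List.sum_cons, add_assoc]

theorem sum_boxSign {A : List ℤ} {u : ℤ} (h : A.Pairwise (· > ·)) (hu : ∀ a ∈ A, u < a) :
    (A.map fun a => boxSign a u).sum = if u + 1 ∈ A then 1 else 0 := by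
  induction A with
  | nil => simp
  | cons a A ih =>
    rw [List.pairwise_cons] at h
    have ha := hu a List.mem_cons_self
    rw [List.map_cons, List.sum_cons, ih h.2 fun b hb => hu b (List.mem_cons_of_mem _ hb)]
    simp only [List.mem_cons]
    by_cases e : u + 1 = a
    · have : u + 1 ∉ A := fun hm => absurd (h.1 _ hm) (by omega)
      obtain rfl : a = u + 1 := e.symm
      simp [boxSign, this, show u ≠ u + 1 + 1 by omega]
    · simp [boxSign, e, show u ≠ a + 1 by omega, show u ≠ a - 1 by omega, show u ≠ a by omega]

/-- Feasibility of a decreasing path in terms of the corners of the initial diagram. -/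
theorem pathWeight_ne_zero_iff {lam : YoungDiagram} {L : List ℤ} (hL : L.Pairwise (· > ·)) :
    pathWeight lam L ≠ 0 ↔ ∀ u ∈ L, cornerSign lam u + (if u + 1 ∈ L then 1 else 0) = 1 := by
  induction L using List.reverseRecOn with
  | nil => simp [pathWeight]
  | append_singleton A u ih =>
    obtain ⟨hA, -, hu⟩ := List.pairwise_append.1 hL
    have hu' : ∀ a ∈ A, u < a := fun a ha => hu a ha u (by simp)
    have e : ∀ v ∈ A ++ [u], v + 1 ∈ A ++ [u] ↔ v + 1 ∈ A := by
      intro v hv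
      have : u ≤ v := by
        rcases List.mem_append.1 hv with h | h
        · exact (hu' v h).le
        · rw [List.mem_singleton.1 h]
      simp only [List.mem_append, List.mem_singleton, or_iff_left_iff_imp]
      omega
    have hstep : pathWeight lam (A ++ [u]) ≠ 0 ↔ pathWeight lam A ≠ 0 ∧
        cornerSign lam u + (if u + 1 ∈ A then 1 else 0) = 1 := by
      rw [pathWeight_append, mul_ne_zero_iff, and_congr_right_iff]
      intro h
      rw [← sum_boxSign hA hu', ← cornerSign_foldl h, cornerSign_eq_one_iff]
      simp [pathWeight, transitionMeasure_ne_zero_iff]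
    rw [hstep, ih hA]
    constructor
    · rintro ⟨h1, h2⟩ v hv
      simp only [e v hv]
      rcases List.mem_append.1 hv with h | h
      · exact h1 v h
      · rwa [List.mem_singleton.1 h]
    · intro h
      refine ⟨fun v hv => ?_, ?_⟩
      · have := h v (List.mem_append_left _ hv)
        simpa only [e v (List.mem_append_left _ hv)] using this
      · have := h u (by simp)
        simpa only [e u (by simp)] using this

theorem mem_concaveCorners_iff_of_pathWeight_ne_zero {lam : YoungDiagram} {L : List ℤ}
    (hL : L.Pairwise (· > ·)) (h : pathWeight lam L ≠ 0) {u : ℤ} (hu : u ∈ L) :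
    u ∈ concaveCorners lam ↔ u + 1 ∉ L := by
  have := (pathWeight_ne_zero_iff hL).1 h u hu
  rw [← cornerSign_eq_one_iff]
  split_ifs at this with h1
  · simp only [h1, not_true, iff_false]
    omega
  · simp only [h1, not_false_iff, iff_true]
    omega

/-- The list of the numbers `x, x - 1, …, x - a + 1`. -/
def descRun (x : ℤ) (a : ℕ) : List ℤ := (List.range a).map fun m : ℕ => x - (m : ℤ)

/-- The concatenation of the runs `x, x - 1, …, x - a + 1`. -/
def descRuns (Q : List (ℤ × ℕ)) : List ℤ := Q.flatMap fun p => descRun p.1 p.2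

theorem mem_descRun {x u : ℤ} {a : ℕ} : u ∈ descRun x a ↔ ∃ m : ℕ, m < a ∧ x - m = u := by
  simp [descRun]

theorem length_descRun (x : ℤ) (a : ℕ) : (descRun x a).length = a := by simp [descRun]

theorem descRun_succ (x : ℤ) (a : ℕ) : descRun x (a + 1) = x :: descRun (x - 1) a := by
  simp only [descRun, List.range_succ_eq_map, List.map_cons, List.map_map, Nat.cast_zero, sub_zero,
    List.cons.injEq, true_and]
  refine List.map_congr_left fun m _ => ?_
  simp only [Function.comp_apply]
  push_cast
  ring

theorem descRuns_cons (p : ℤ × ℕ) (Q : List (ℤ × ℕ)) :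
    descRuns (p :: Q) = descRun p.1 p.2 ++ descRuns Q := rfl

theorem stringTuple_eq {l : ℕ} (x : Fin l → ℤ) (a : Fin l → ℕ) :
    stringTuple x a = descRuns (List.ofFn fun i => (x i, a i)) := by
  rw [List.ofFn_eq_map, descRuns, List.flatMap_map]
  simp [stringTuple, descRun, List.map_flatMap]
  simp only [List.map_eq_flatMap]

theorem exists_descRuns {C : Set ℤ} {L : List ℤ} {x : ℤ} (hL : (x :: L).Pairwise (· > ·))
    (h : ∀ u ∈ L, u ∈ C ∨ u + 1 ∈ x :: L) :
    ∃ a Q, x :: L = descRuns ((x, a + 1) :: Q) ∧ ∀ p ∈ Q, p.1 ∈ C ∧ 1 ≤ p.2 := by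
  induction L generalizing x with
  | nil => exact ⟨0, [], by simp [descRuns, descRun], by simp⟩
  | cons y L ih =>
    rw [List.pairwise_cons] at hL
    have hxy : x > y := hL.1 y List.mem_cons_self
    obtain ⟨a, Q, e, hQ⟩ := ih hL.2 fun u hu => by
      refine (h u (List.mem_cons_of_mem _ hu)).imp_right fun h1 => ?_
      have h2 : y > u := (List.pairwise_cons.1 hL.2).1 u hu
      exact (List.mem_cons.1 h1).resolve_left (by omega)
    by_cases hy : y ∈ C
    · refine ⟨0, (y, a + 1) :: Q, ?_, ?_⟩
      · rw [descRuns_cons, ← e]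
        simp [descRun]
      · intro p hp
        rcases List.mem_cons.1 hp with rfl | hp
        · exact ⟨hy, Nat.le_add_left _ _⟩
        · exact hQ p hp
    · have h1 := (h y List.mem_cons_self).resolve_left hy
      have h2 : y = x - 1 := by
        rcases List.mem_cons.1 h1 with h3 | h3
        · omega
        · rcases List.mem_cons.1 h3 with h4 | h4
          · omega
          · have := (List.pairwise_cons.1 hL.2).1 _ h4
            omega
      refine ⟨a + 1, Q, ?_, hQ⟩
      rw [descRuns_cons, descRun_succ, ← h2, e]
      rfl

theorem head_descRuns_mem {C : Set ℤ} {Q : List (ℤ × ℕ)} (h : ∀ p ∈ Q, p.1 ∈ C ∧ 1 ≤ p.2) {u : ℤ}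
    (hu : (descRuns Q)[0]? = some u) : u ∈ C := by
  cases Q with
  | nil => simp [descRuns] at hu
  | cons p Q =>
    obtain ⟨h1, h2⟩ := h p List.mem_cons_self
    obtain ⟨b, hb⟩ := Nat.exists_eq_add_of_le' h2
    rw [descRuns_cons, hb, descRun_succ] at hu
    simp only [List.cons_append, List.getElem?_cons_zero, Option.some.injEq] at hu
    exact hu ▸ h1

theorem descRun_append_ne {C : Set ℤ} {Q : List (ℤ × ℕ)} {R : List ℤ} {x : ℤ} {a b : ℕ}
    (ha : 1 ≤ a) (hab : a < b) (hC : ∀ m : ℕ, 1 ≤ m → m < b → x - m ∉ C)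
    (hQ : ∀ p ∈ Q, p.1 ∈ C ∧ 1 ≤ p.2) : descRun x a ++ descRuns Q ≠ descRun x b ++ R := by
  intro h
  have h1 := congrArg (fun L => L[a]?) h
  rw [List.getElem?_append_right (by rw [length_descRun]), length_descRun, Nat.sub_self,
    List.getElem?_append_left (by rwa [length_descRun])] at h1
  have h2 : (descRun x b)[a]? = some (x - a) := by
    simp [descRun, hab]
  rw [h2] at h1
  exact hC a ha hab (head_descRuns_mem hQ h1)

theorem descRuns_injective {C : Set ℤ} {Q Q' : List (ℤ × ℕ)}
    (h : ∀ p ∈ Q, (p.1 ∈ C ∧ 1 ≤ p.2) ∧ ∀ m : ℕ, 1 ≤ m → m < p.2 → p.1 - m ∉ C)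
    (h' : ∀ p ∈ Q', (p.1 ∈ C ∧ 1 ≤ p.2) ∧ ∀ m : ℕ, 1 ≤ m → m < p.2 → p.1 - m ∉ C)
    (e : descRuns Q = descRuns Q') : Q = Q' := by
  have hne : ∀ (p : ℤ × ℕ) (R : List (ℤ × ℕ)), 1 ≤ p.2 → descRuns (p :: R) ≠ [] := by
    intro p R hp h0
    have := congrArg List.length h0
    rw [descRuns_cons, List.length_append, length_descRun, List.length_nil] at this
    omega
  induction Q generalizing Q' with
  | nil =>
    cases Q' with
    | nil => rfl
    | cons p R => exact absurd e.symm (hne p R (h' p List.mem_cons_self).1.2)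
  | cons p Q ih =>
    cases Q' with
    | nil => exact absurd e (hne p Q (h p List.mem_cons_self).1.2)
    | cons p' Q' =>
      obtain ⟨x, a⟩ := p
      obtain ⟨x', a'⟩ := p'
      obtain ⟨⟨h1, h2⟩, h3⟩ := h _ List.mem_cons_self
      obtain ⟨⟨h1', h2'⟩, h3'⟩ := h' _ List.mem_cons_self
      simp only at h1 h2 h3 h1' h2' h3'
      have hQ : ∀ p ∈ Q, (p.1 ∈ C ∧ 1 ≤ p.2) ∧ ∀ m : ℕ, 1 ≤ m → m < p.2 → p.1 - m ∉ C :=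
        fun p hp => h p (List.mem_cons_of_mem _ hp)
      have hQ' : ∀ p ∈ Q', (p.1 ∈ C ∧ 1 ≤ p.2) ∧ ∀ m : ℕ, 1 ≤ m → m < p.2 → p.1 - m ∉ C :=
        fun p hp => h' p (List.mem_cons_of_mem _ hp)
      rw [descRuns_cons, descRuns_cons] at e
      have hx : x = x' := by
        obtain ⟨b, rfl⟩ := Nat.exists_eq_add_of_le' h2
        obtain ⟨b', rfl⟩ := Nat.exists_eq_add_of_le' h2'
        simp only [descRun_succ, List.cons_append, List.cons.injEq] at e
        exact e.1
      subst hx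
      have ha : a = a' := by
        rcases lt_trichotomy a a' with h4 | h4 | h4
        · exact absurd e (descRun_append_ne h2 h4 h3' fun p hp => (hQ p hp).1)
        · exact h4
        · exact absurd e.symm (descRun_append_ne h2' h4 h3 fun p hp => (hQ' p hp).1)
      subst ha
      rw [ih hQ hQ' (List.append_cancel_left e)]

theorem existsUnique_stringTuple {lam : YoungDiagram} {L : List ℤ} (hne : L ≠ [])
    (hL : L.Pairwise (· > ·)) (h : pathWeight lam L ≠ 0) :
    ∃! s : (l : ℕ) × (Fin l → ℤ) × (Fin l → ℕ),
      StrictAnti s.2.1 ∧ (∀ i, s.2.1 i ∈ concaveCorners lam) ∧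
        (∀ i, 1 ≤ s.2.2 i) ∧ ∑ i, s.2.2 i = L.length ∧ L = stringTuple s.2.1 s.2.2 := by
  have hmem := fun u (hu : u ∈ L) => mem_concaveCorners_iff_of_pathWeight_ne_zero hL h hu
  have hnon : ∀ Q : List (ℤ × ℕ), L = descRuns Q → ∀ p ∈ Q, ∀ m : ℕ, 1 ≤ m → m < p.2 →
      p.1 - m ∉ (concaveCorners lam : Set ℤ) := by
    intro Q hQ p hp m h1 h2 h3
    have hin : ∀ m : ℕ, m < p.2 → p.1 - m ∈ L := fun m hm => by
      rw [hQ]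
      exact List.mem_flatMap.2 ⟨p, hp, mem_descRun.2 ⟨m, hm, rfl⟩⟩
    refine (hmem _ (hin m h2)).1 h3 ?_
    have := hin (m - 1) (by omega)
    rwa [Nat.cast_sub h1, Nat.cast_one, ← sub_add] at this
  have hex : ∃ Q : List (ℤ × ℕ), L = descRuns Q ∧ ∀ p ∈ Q, p.1 ∈ (concaveCorners lam : Set ℤ) ∧
      1 ≤ p.2 := by
    obtain ⟨x, L', rfl⟩ := List.exists_cons_of_ne_nil hne
    obtain ⟨a, Q, e, hQ⟩ := exists_descRuns (C := (concaveCorners lam : Set ℤ)) hL fun u hu => by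
      by_cases h1 : u + 1 ∈ x :: L'
      · exact Or.inr h1
      · exact Or.inl ((hmem u (List.mem_cons_of_mem _ hu)).2 h1)
    refine ⟨_, e, fun p hp => ?_⟩
    rcases List.mem_cons.1 hp with rfl | hp
    · refine ⟨(hmem x List.mem_cons_self).2 fun h1 => ?_, Nat.le_add_left _ _⟩
      rcases List.mem_cons.1 h1 with h2 | h2
      · omega
      · have := (List.pairwise_cons.1 hL).1 _ h2
        omega
    · exact hQ p hp
  obtain ⟨Q, hQL, hQ⟩ := hex
  have hofFn : List.ofFn (fun i : Fin Q.length => ((Q.get i).1, (Q.get i).2)) = Q :=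
    List.ofFn_get Q
  refine ⟨⟨Q.length, fun i => (Q.get i).1, fun i => (Q.get i).2⟩, ⟨?_, fun i => (hQ _ (Q.get_mem i)).1,
    fun i => (hQ _ (Q.get_mem i)).2, ?_, ?_⟩, ?_⟩
  · have hp : (Q.map Prod.fst).Pairwise (· > ·) := by
      refine hL.sublist ?_
      rw [hQL]
      clear hQL hnon hofFn
      induction Q with
      | nil => exact List.Sublist.slnil
      | cons p Q ih =>
        obtain ⟨b, hb⟩ := Nat.exists_eq_add_of_le' (hQ p List.mem_cons_self).2
        rw [descRuns_cons, hb, descRun_succ, List.map_cons, List.cons_append]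
        refine List.Sublist.cons_cons _ ?_
        exact (ih fun p hp => hQ p (List.mem_cons_of_mem _ hp)).trans (List.sublist_append_right _ _)
    intro i j hij
    have := List.pairwise_iff_get.1 hp ⟨i, by simp⟩ ⟨j, by simp⟩ hij
    simpa using this
  · simp only
    rw [hQL, descRuns, List.length_flatMap, ← List.sum_ofFn]
    conv_rhs => rw [← hofFn]
    simp only [List.map_ofFn, Function.comp_def, length_descRun]
  · simp only
    rw [stringTuple_eq, hofFn, hQL]
  · rintro ⟨l, x, a⟩ ⟨-, h2, h3, -, h5⟩
    simp only at h2 h3 h5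
    rw [stringTuple_eq] at h5
    have e : List.ofFn (fun i => (x i, a i)) = Q := by
      refine descRuns_injective (C := (concaveCorners lam : Set ℤ)) (fun p hp => ⟨?_, hnon _ h5 p hp⟩)
        (fun p hp => ⟨hQ p hp, hnon _ hQL p hp⟩) (h5.symm.trans hQL)
      obtain ⟨i, rfl⟩ := (List.mem_ofFn' _ _).1 hp
      exact ⟨h2 i, h3 i⟩
    exact congrArg (fun s : (l : ℕ) × (Fin l → ℤ × ℕ) =>
      (⟨s.1, fun i => (s.2 i).1, fun i => (s.2 i).2⟩ : (l : ℕ) × (Fin l → ℤ) × (Fin l → ℕ)))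
      (List.ofFn_inj'.1 (e.trans hofFn.symm))

open Classical in
/-- The weight of a new box at `u` in a decreasing path, without the influence of the boxes added
before. -/
noncomputable def baseWeight (lam : YoungDiagram) (u : ℤ) : ℝ :=
  if u ∈ concaveCorners lam then transitionMeasure lam u else -(cauchyTransform lam u / 2)

/-- The factor for a pair of boxes at distance `d` in a decreasing path. -/
noncomputable def pairFactor (d : ℤ) : ℝ := if d = 1 then 1 else boxFactor d

/-- The product of the factors for the pairs formed from `A` and `B`. -/
noncomputable def crossFactor (A B : List ℤ) : ℝ :=
  (A.map fun s => (B.map fun t => pairFactor (s - t)).prod).prod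

/-- The explicit form of `pathWeight` for decreasing paths. -/
noncomputable def decWeight (lam : YoungDiagram) : List ℤ → ℝ
  | [] => 1
  | u :: L => baseWeight lam u * crossFactor [u] L * decWeight lam L

theorem crossFactor_nil_right (A : List ℤ) : crossFactor A [] = 1 := by
  simp [crossFactor]

theorem crossFactor_cons_left (u : ℤ) (A B : List ℤ) :
    crossFactor (u :: A) B = crossFactor [u] B * crossFactor A B := by
  simp [crossFactor]

theorem crossFactor_append_left (A A' B : List ℤ) :
    crossFactor (A ++ A') B = crossFactor A B * crossFactor A' B := by
  simp [crossFactor]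

theorem crossFactor_append_right (A B B' : List ℤ) :
    crossFactor A (B ++ B') = crossFactor A B * crossFactor A B' := by
  simp [crossFactor, List.prod_map_mul]

theorem decWeight_append (lam : YoungDiagram) (A B : List ℤ) :
    decWeight lam (A ++ B) = decWeight lam A * decWeight lam B * crossFactor A B := by
  induction A with
  | nil => simp [decWeight, crossFactor]
  | cons u A ih =>
    rw [List.cons_append, decWeight, decWeight, ih, crossFactor_append_right,
      crossFactor_cons_left u A B]
    ring

theorem cauchyTransform_foldl {lam : YoungDiagram} {A : List ℤ} (h : pathWeight lam A ≠ 0) {z : ℝ}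
    (hz : ∀ w : ℤ, z ≠ w) : cauchyTransform (A.foldl grow lam) z =
      cauchyTransform lam z * (A.map fun s : ℤ => boxFactor (z - s)).prod := by
  induction A generalizing lam with
  | nil => simp
  | cons x A ih =>
    rw [pathWeight] at h
    have hg := growsAt_grow (transitionMeasure_ne_zero_iff.1 (left_ne_zero_of_mul h))
    rw [List.foldl_cons, ih (right_ne_zero_of_mul h), hg.cauchyTransform_eq hz, List.map_cons,
      List.prod_cons, mul_assoc]

theorem tendsto_prod_boxFactor {A : List ℤ} {u : ℤ} (h1 : ∀ a ∈ A, u < a) (h2 : u + 1 ∉ A) :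
    Tendsto (fun z : ℝ => (A.map fun s : ℤ => boxFactor (z - s)).prod) (𝓝[≠] (u : ℝ))
      (𝓝 (crossFactor A [u])) := by
  have e : crossFactor A [u] = (A.map fun s : ℤ => boxFactor (u - s)).prod := by
    unfold crossFactor
    congr 1
    refine List.map_congr_left fun s hs => ?_
    have : s - u ≠ 1 := fun h => h2 (by rwa [show u + 1 = s by omega])
    rw [List.map_singleton, List.prod_singleton, pairFactor, if_neg this, ← boxFactor_neg]
    push_cast
    congr 1
    ring
  rw [e]
  refine tendsto_list_prod A fun s hs => tendsto_boxFactor ?_ ?_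
  · have := h1 s hs
    omega
  · intro h
    exact h2 (by rwa [show u + 1 = s by omega])

theorem transitionMeasure_foldl {lam : YoungDiagram} {A : List ℤ} {u : ℤ}
    (hA : A.Pairwise (· > ·)) (hu : ∀ a ∈ A, u < a) (h : pathWeight lam A ≠ 0)
    (hc : u ∈ concaveCorners (A.foldl grow lam)) :
    transitionMeasure (A.foldl grow lam) u = baseWeight lam u * crossFactor A [u] := by
  have hsign := cornerSign_foldl h u
  rw [sum_boxSign hA hu, (cornerSign_eq_one_iff _ _).2 hc] at hsign
  refine tendsto_nhds_unique (tendsto_mul_cauchyTransform hc) ?_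
  by_cases hul : u ∈ concaveCorners lam
  · have h1 : u + 1 ∉ A := fun h1 => by
      rw [if_pos h1, (cornerSign_eq_one_iff _ _).2 hul] at hsign
      omega
    rw [baseWeight, if_pos hul]
    refine ((tendsto_mul_cauchyTransform hul).mul (tendsto_prod_boxFactor hu h1)).congr' ?_
    filter_upwards [eventually_ne_intCast u] with z hz
    rw [cauchyTransform_foldl h hz, mul_assoc]
  · have h1 : u + 1 ∈ A := by
      by_contra h1
      rw [if_neg h1, add_zero] at hsign
      exact hul ((cornerSign_eq_one_iff _ _).1 hsign.symm)
    have hperm := List.perm_cons_erase h1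
    have hnd : A.Nodup := hA.imp fun h => ne_of_gt h
    have hcross : crossFactor A [u] = crossFactor (A.erase (u + 1)) [u] := by
      unfold crossFactor
      rw [(hperm.map _).prod_eq]
      simp [pairFactor]
    have ht := tendsto_prod_boxFactor (A := A.erase (u + 1)) (u := u)
      (fun a ha => hu a (List.mem_of_mem_erase ha)) hnd.not_mem_erase
    have hlim : Tendsto (fun z : ℝ => (z - u - 1) / (z - u - 2)) (𝓝[≠] (u : ℝ)) (𝓝 (1 / 2)) := by
      have : ContinuousAt (fun z : ℝ => (z - u - 1) / (z - u - 2)) (u : ℝ) :=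
        ContinuousAt.div (by fun_prop) (by fun_prop) (by norm_num)
      have := this.tendsto.mono_left (nhdsWithin_le_nhds (s := {(u : ℝ)}ᶜ))
      norm_num at this
      simpa using this
    have hlim' : Tendsto (fun z : ℝ => (z - u - 1)) (𝓝[≠] (u : ℝ)) (𝓝 (-1)) := by
      have : Continuous fun z : ℝ => (z - u - 1) := by fun_prop
      have := (this.tendsto (u : ℝ)).mono_left (nhdsWithin_le_nhds (s := {(u : ℝ)}ᶜ))
      simpa using this
    have hall := ((tendsto_cauchyTransform hul).mul (hlim'.mul hlim)).mul ht
    rw [baseWeight, if_neg hul, hcross]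
    rw [show -(cauchyTransform lam u / 2) = cauchyTransform lam u * (-1 * (1 / 2)) by ring]
    refine hall.congr' ?_
    filter_upwards [eventually_ne_intCast u] with z hz
    have h0 : z - u ≠ 0 := sub_ne_zero.2 (hz u)
    have h2 : z - u - 2 ≠ 0 := fun e => hz (u + 2) (by push_cast; linarith)
    rw [cauchyTransform_foldl h hz, (hperm.map _).prod_eq, List.map_cons, List.prod_cons, boxFactor]
    push_cast
    rw [show (z - (u + 1) - 1 : ℝ) = z - u - 2 by ring, show (z - (u + 1) + 1 : ℝ) = z - u by ring]
    field_simp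
    ring

theorem pathWeight_eq_decWeight {lam : YoungDiagram} {L : List ℤ} (hL : L.Pairwise (· > ·))
    (h : pathWeight lam L ≠ 0) : pathWeight lam L = decWeight lam L := by
  induction L using List.reverseRecOn with
  | nil => rfl
  | append_singleton A u ih =>
    obtain ⟨hA, -, hu⟩ := List.pairwise_append.1 hL
    rw [pathWeight_append] at h ⊢
    have h1 := left_ne_zero_of_mul h
    have h2 : transitionMeasure (A.foldl grow lam) u ≠ 0 := by
      simpa [pathWeight] using right_ne_zero_of_mul h
    rw [decWeight_append, ← ih hA h1, pathWeight, pathWeight, mul_one,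
      transitionMeasure_foldl hA (fun a ha => hu a ha u (by simp)) h1
        (transitionMeasure_ne_zero_iff.1 h2)]
    simp only [decWeight, crossFactor_nil_right]
    ring

theorem descRun_succ' (x : ℤ) (a : ℕ) : descRun x (a + 1) = descRun x a ++ [x - a] := by
  simp [descRun, List.range_succ]

theorem crossFactor_descRun_singleton (x : ℤ) (a : ℕ) (ha : 1 ≤ a) :
    crossFactor (descRun x a) [x - a] = 2 * a / (a + 1) := by
  induction a, ha using Nat.le_induction generalizing x with
  | base => simp [descRun, crossFactor, pairFactor]; norm_num
  | succ a ha ih =>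
    have h1 := ih (x - 1)
    have ha0 : (a : ℝ) ≠ 0 := by positivity
    rw [descRun_succ, crossFactor_cons_left, show x - ((a + 1 : ℕ) : ℤ) = x - 1 - a by push_cast; ring,
      h1]
    simp only [crossFactor, List.map_cons, List.map_nil, List.prod_cons, List.prod_nil, mul_one]
    rw [pairFactor, if_neg (by omega), boxFactor]
    push_cast
    rw [show (x : ℝ) - (x - 1 - a) - 1 = a by ring, show (x : ℝ) - (x - 1 - a) + 1 = a + 2 by ring,
      show (x : ℝ) - (x - 1 - a) = a + 1 by ring]
    field_simp
    ring

theorem decWeight_descRun {lam : YoungDiagram} {x : ℤ} (hx : x ∈ concaveCorners lam) {a : ℕ}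
    (ha : 1 ≤ a) (hX : ∀ m : ℕ, 1 ≤ m → m < a → x - (m : ℤ) ∉ concaveCorners lam) :
    decWeight lam (descRun x a) = (-1 : ℝ) ^ (a - 1) / a * transitionMeasure lam x *
      cauchyFalling lam (a - 1) ((x : ℝ) - 1) := by
  induction a, ha using Nat.le_induction with
  | base => simp [descRun, decWeight, crossFactor, baseWeight, hx, cauchyFalling]
  | succ a ha ih =>
    obtain ⟨b, rfl⟩ := Nat.exists_eq_add_of_le' ha
    rw [descRun_succ', decWeight_append, ih fun m h1 h2 => hX m h1 (by omega),
      crossFactor_descRun_singleton x _ ha]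
    simp only [decWeight, crossFactor_nil_right, mul_one]
    rw [baseWeight, if_neg (hX _ ha (Nat.lt_succ_self _))]
    simp only [Nat.add_sub_cancel]
    rw [cauchyFalling, cauchyFalling, Finset.prod_range_succ, pow_succ]
    push_cast
    rw [show (x : ℝ) - 1 - b = x - (b + 1) by ring]
    field_simp

theorem crossFactor_singleton_descRun (s y : ℤ) (b : ℕ) (h : 2 ≤ s - y) :
    crossFactor [s] (descRun y b) =
      ((s : ℝ) - y) * (s - y + b - 1) / ((s - y - 1) * (s - y + b)) := by
  have h' : (2 : ℝ) ≤ s - y := by exact_mod_cast h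
  have hb : ∀ b : ℕ, (0 : ℝ) ≤ b := fun b => Nat.cast_nonneg b
  have h1 : (s : ℝ) - y - 1 ≠ 0 := by linarith
  induction b with
  | zero =>
    have h2 : (s : ℝ) - y ≠ 0 := by linarith
    simp only [descRun, crossFactor, List.range_zero, List.map_nil, List.prod_nil, List.map_cons,
      List.prod_cons, mul_one, Nat.cast_zero, add_zero]
    field_simp
  | succ b ih =>
    have := hb b
    have h3 : (s : ℝ) - y + b ≠ 0 := by linarith
    have h4 : (s : ℝ) - y + (b + 1) ≠ 0 := by linarith
    have h5 : (s : ℝ) - y + b - 1 ≠ 0 := by linarith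
    rw [descRun_succ', crossFactor_append_right, ih]
    simp only [crossFactor, List.map_cons, List.map_nil, List.prod_cons, List.prod_nil, mul_one]
    rw [pairFactor, if_neg (by omega), boxFactor]
    push_cast
    rw [show (s : ℝ) - (y - b) - 1 = s - y + b - 1 by ring,
      show (s : ℝ) - (y - b) + 1 = s - y + (b + 1) by ring,
      show (s : ℝ) - (y - b) = s - y + b by ring]
    field_simp
    ring

theorem crossFactor_descRun (x y : ℤ) (a b : ℕ) (h1 : 2 ≤ x - y) (h2 : 1 ≤ x - y - a) :
    crossFactor (descRun x a) (descRun y b) =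
      (((x : ℝ) - y) * ((x : ℝ) - y - a + b)) / (((x : ℝ) - y + b) * ((x : ℝ) - y - a)) := by
  have h1' : (2 : ℝ) ≤ x - y := by exact_mod_cast h1
  have hb : (0 : ℝ) ≤ b := Nat.cast_nonneg b
  have e1 : (x : ℝ) - y + b ≠ 0 := by linarith
  induction a with
  | zero =>
    have e2 : (x : ℝ) - y ≠ 0 := by linarith
    simp only [descRun, crossFactor, List.range_zero, List.map_nil, List.prod_nil, Nat.cast_zero,
      sub_zero]
    field_simp
  | succ a ih =>
    have h2' : (1 : ℝ) ≤ x - y - (a + 1) := by exact_mod_cast h2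
    have e3 : (x : ℝ) - y - a ≠ 0 := by linarith
    have e4 : (x : ℝ) - y - (a + 1) ≠ 0 := by linarith
    have e5 : (x : ℝ) - y - a + b ≠ 0 := by linarith
    push_cast at h2
    rw [descRun_succ', crossFactor_append_left, ih (by omega),
      crossFactor_singleton_descRun _ _ _ (by omega)]
    push_cast
    rw [show (x : ℝ) - a - y - 1 = x - y - (a + 1) by ring,
      show (x : ℝ) - a - y + b - 1 = x - y - (a + 1) + b by ring,
      show (x : ℝ) - a - y + b = x - y - a + b by ring,
      show (x : ℝ) - a - y = x - y - a by ring]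
    field_simp

theorem stringTuple_succ {l : ℕ} (x : Fin (l + 1) → ℤ) (a : Fin (l + 1) → ℕ) :
    stringTuple x a = descRun (x 0) (a 0) ++ stringTuple (fun i => x i.succ) fun i => a i.succ := by
  rw [stringTuple_eq, stringTuple_eq, List.ofFn_succ, descRuns_cons]

theorem theta_succ {l : ℕ} (x : Fin (l + 1) → ℤ) (a : Fin (l + 1) → ℕ) :
    theta x a = (∏ j : Fin l, (((x 0 : ℝ) - x j.succ) * ((x 0 : ℝ) - x j.succ - a 0 + a j.succ)) /
      (((x 0 : ℝ) - x j.succ + a j.succ) * ((x 0 : ℝ) - x j.succ - a 0))) *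
        theta (fun i => x i.succ) fun i => a i.succ := by
  rw [theta, Fin.prod_univ_succ, Fin.prod_Ioi_zero]
  simp only [Fin.prod_Ioi_succ]
  rfl

theorem crossFactor_stringTuple {l : ℕ} (A : List ℤ) (x : Fin l → ℤ) (a : Fin l → ℕ) :
    crossFactor A (stringTuple x a) = ∏ j, crossFactor A (descRun (x j) (a j)) := by
  induction l with
  | zero => simp [stringTuple, crossFactor]
  | succ l ih => rw [stringTuple_succ, crossFactor_append_right, ih, Fin.prod_univ_succ]

theorem decWeight_stringTuple {lam : YoungDiagram} {l : ℕ} (x : Fin l → ℤ) (a : Fin l → ℕ)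
    (hx : ∀ i, x i ∈ concaveCorners lam) (ha : ∀ i, 1 ≤ a i)
    (hX : ∀ (i : Fin l) (m : ℕ), 1 ≤ m → m < a i → x i - (m : ℤ) ∉ concaveCorners lam)
    (hsep : ∀ i j, i < j → 1 ≤ x i - x j - a i) :
    decWeight lam (stringTuple x a) = theta x a *
      ∏ i, ((-1 : ℝ) ^ (a i - 1) / (a i : ℝ) * transitionMeasure lam (x i) *
            cauchyFalling lam (a i - 1) ((x i : ℝ) - 1)) := by
  induction l with
  | zero => simp [stringTuple, decWeight, theta]
  | succ l ih =>
    rw [stringTuple_succ, decWeight_append, decWeight_descRun (hx 0) (ha 0) (hX 0),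
      ih _ _ (fun i => hx i.succ) (fun i => ha i.succ) (fun i => hX i.succ)
        (fun i j h => hsep _ _ (Fin.succ_lt_succ_iff.2 h)), theta_succ, Fin.prod_univ_succ,
      crossFactor_stringTuple]
    have : ∀ j : Fin l, crossFactor (descRun (x 0) (a 0)) (descRun (x j.succ) (a j.succ)) = _ :=
      fun j => by
        have h1 := hsep 0 j.succ (Fin.succ_pos j)
        have h2 := ha 0
        exact crossFactor_descRun _ _ _ _ (by omega) h1
    rw [Finset.prod_congr rfl fun j _ => this j]
    ring

theorem exists_convexCorner_between {lam : YoungDiagram} {x x' : ℤ} (hx : x ∈ concaveCorners lam)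
    (hx' : x' ∈ concaveCorners lam) (h : x < x') : ∃ y ∈ convexCorners lam, x < y ∧ y < x' := by
  rw [mem_concaveCorners] at hx hx'
  by_contra hcon
  push Not at hcon
  have : ∀ z, x + 1 ≤ z → z ≤ x' → z ∉ maya lam := by
    intro z hz
    induction z, hz using Int.leInduction with
    | base => exact fun _ => hx.2
    | succ z hz ih =>
      intro hz' hm
      have := hcon z ((mem_convexCorners lam z).2 ⟨ih (by omega), hm⟩) (by omega)
      omega
  exact this x' h le_rfl hx'.1

theorem pathWeight_stringTuple {lam : YoungDiagram} {l : ℕ} {x : Fin l → ℤ} {a : Fin l → ℕ}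
    (hanti : StrictAnti x) (hx : ∀ i, x i ∈ concaveCorners lam) (ha : ∀ i, 1 ≤ a i)
    (hX : ∀ (i : Fin l) (m : ℕ), 1 ≤ m → m < a i → x i - (m : ℤ) ∉ concaveCorners lam) :
    pathWeight lam (stringTuple x a) = theta x a *
      ∏ i, ((-1 : ℝ) ^ (a i - 1) / (a i : ℝ) * transitionMeasure lam (x i) *
            cauchyFalling lam (a i - 1) ((x i : ℝ) - 1)) := by
  have hmem : ∀ u, u ∈ stringTuple x a ↔ ∃ i, ∃ m : ℕ, m < a i ∧ x i - m = u := by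
    intro u
    simp [stringTuple_eq, descRuns, List.mem_flatMap, List.mem_ofFn', mem_descRun]
  have hlt : ∀ i j, i < j → ∀ m : ℕ, m < a i → x j < x i - m := by
    intro i j hij m hm
    by_contra hle
    have h1 := hanti hij
    refine hX i (x i - x j).toNat (by omega) (by omega) ?_
    rw [show x i - ((x i - x j).toNat : ℤ) = x j by omega]
    exact hx j
  have hpw : (stringTuple x a).Pairwise (· > ·) := by
    rw [stringTuple_eq, descRuns, List.pairwise_flatMap]
    constructor
    · rintro p -
      rw [descRun, List.pairwise_map]
      refine List.pairwise_lt_range.imp fun h => ?_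
      omega
    · rw [List.pairwise_ofFn]
      intro i j hij u hu v hv
      obtain ⟨m, hm, rfl⟩ := mem_descRun.1 hu
      obtain ⟨m', hm', rfl⟩ := mem_descRun.1 hv
      have := hlt i j hij m hm
      simp only
      omega
  by_cases h0 : pathWeight lam (stringTuple x a) = 0
  · rw [h0]
    have h1 : ∃ i, ∃ m : ℕ, 1 ≤ m ∧ m < a i ∧ x i - m ∈ convexCorners lam := by
      by_contra hcon
      push Not at hcon
      refine (pathWeight_ne_zero_iff hpw).2 (fun u hu => ?_) h0
      obtain ⟨i, m, hm, rfl⟩ := (hmem u).1 hu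
      rcases Nat.eq_zero_or_pos m with rfl | hm0
      · have h2 : x i - ((0 : ℕ) : ℤ) + 1 ∉ stringTuple x a := by
          intro h
          obtain ⟨j, m', hm', e⟩ := (hmem _).1 h
          rcases lt_trichotomy i j with h3 | rfl | h3
          · have := hanti h3
            omega
          · omega
          · have h4 := hlt j i h3 m' hm'
            obtain ⟨y, hy1, hy2, hy3⟩ := exists_convexCorner_between (hx i) (hx j) (hanti h3)
            refine hcon j (x j - y).toNat (by omega) (by omega) ?_
            rwa [show x j - ((x j - y).toNat : ℤ) = y by omega]
        rw [if_neg h2, Nat.cast_zero, sub_zero, (cornerSign_eq_one_iff _ _).2 (hx i), add_zero]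
      · have h2 : x i - (m : ℤ) + 1 ∈ stringTuple x a :=
          (hmem _).2 ⟨i, m - 1, by omega, by omega⟩
        have h3 := hX i m hm0 hm
        have h4 := hcon i m hm0 hm
        rw [if_pos h2, cornerSign, if_neg h3, if_neg h4]
        norm_num
    obtain ⟨i, m, hm1, hm2, hy⟩ := h1
    have hz : cauchyFalling lam (a i - 1) ((x i : ℝ) - 1) = 0 := by
      refine Finset.prod_eq_zero (Finset.mem_range.2 (show m - 1 < a i - 1 by omega)) ?_
      rw [cauchyTransform, Finset.prod_eq_zero hy, zero_div]
      rw [Nat.cast_sub hm1]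
      push_cast
      ring
    rw [Finset.prod_eq_zero (Finset.mem_univ i) (by rw [hz, mul_zero]), mul_zero]
  · rw [pathWeight_eq_decWeight hpw h0]
    refine decWeight_stringTuple x a hx ha hX fun i j hij => ?_
    have h1 := hlt i j hij (a i - 1) (by have := ha i; omega)
    have h2 : x j + 1 ∉ stringTuple x a :=
      (mem_concaveCorners_iff_of_pathWeight_ne_zero hpw h0
        ((hmem _).2 ⟨j, 0, ha j, by simp⟩)).1 (hx j)
    have h3 : x i - (a i - 1 : ℕ) ≠ x j + 1 := fun e =>
      h2 (e ▸ (hmem _).2 ⟨i, a i - 1, by have := ha i; omega, rfl⟩)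
    have := ha i
    omega

section Insertion

variable {lam : YoungDiagram}

theorem lt_bump (T : lam.cells → ℝ) (i : ℕ) {w : WithTop ℝ} (hw : w ≠ ⊤) : w < bump T i w := by
  rw [bump, Finset.lt_inf_iff (lt_top_iff_ne_top.2 hw)]
  exact fun c hc => (Finset.mem_filter.1 hc).2.2

theorem le_bump (T : lam.cells → ℝ) (i : ℕ) (w : WithTop ℝ) : w ≤ bump T i w :=
  Finset.le_inf fun _ hc => (Finset.mem_filter.1 hc).2.2.le

theorem bump_le {T : lam.cells → ℝ} {i : ℕ} {w : WithTop ℝ} {c : lam.cells} (hc : c.1.1 = i)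
    (hw : w < T c) : bump T i w ≤ T c :=
  Finset.inf_le (f := fun c => (T c : WithTop ℝ)) (Finset.mem_filter.2 ⟨Finset.mem_univ _, hc, hw⟩)

theorem exists_eq_bump {T : lam.cells → ℝ} {i : ℕ} {w : WithTop ℝ} (h : bump T i w ≠ ⊤) :
    ∃ c : lam.cells, c.1.1 = i ∧ w < T c ∧ bump T i w = T c := by
  have hne : (Finset.univ.filter fun c : lam.cells => c.1.1 = i ∧ w < (T c : WithTop ℝ)).Nonempty := by
    by_contra h0
    rw [Finset.not_nonempty_iff_eq_empty] at h0
    exact h (by rw [bump, h0, Finset.inf_empty])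
  obtain ⟨c, hc, e⟩ := Finset.exists_mem_eq_inf _ hne fun c : lam.cells => (T c : WithTop ℝ)
  obtain ⟨-, h1, h2⟩ := Finset.mem_filter.1 hc
  exact ⟨c, h1, h2, e⟩

theorem bump_mono (T : lam.cells → ℝ) (i : ℕ) {w w' : WithTop ℝ} (h : w ≤ w') :
    bump T i w ≤ bump T i w' :=
  Finset.inf_mono fun c hc => by
    rw [Finset.mem_filter] at hc ⊢
    exact ⟨hc.1, hc.2.1, h.trans_lt hc.2.2⟩

theorem bumpSeq_monotone (T : lam.cells → ℝ) (z : ℝ) : Monotone (bumpSeq T z) :=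
  monotone_nat_of_le_succ fun i => le_bump T i _

theorem bumpSeq_mono (T : lam.cells → ℝ) {z z' : ℝ} (h : z ≤ z') (i : ℕ) :
    bumpSeq T z i ≤ bumpSeq T z' i := by
  induction i with
  | zero => exact WithTop.coe_le_coe.2 h
  | succ i ih => exact bump_mono T i ih

/-- The row in which the row insertion of `z` into `T` stops. -/
noncomputable def stopRow (T : lam.cells → ℝ) (z : ℝ) : ℕ := sInf {i | bumpSeq T z (i + 1) = ⊤}

theorem newBox_eq (T : lam.cells → ℝ) (z : ℝ) :
    newBox T z = (stopRow T z, lam.rowLen (stopRow T z)) := rfl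

theorem bumpSeq_eq_top_iff (T : lam.cells → ℝ) (z : ℝ) (i : ℕ) :
    bumpSeq T z i = ⊤ ↔ stopRow T z < i := by
  have hs : bumpSeq T z (stopRow T z + 1) = ⊤ := Nat.sInf_mem (exists_bumpSeq_eq_top T z)
  constructor
  · intro h
    rcases i with _ | i
    · exact absurd h (WithTop.coe_ne_top)
    · exact Nat.lt_succ_of_le (Nat.sInf_le h)
  · intro h
    exact top_le_iff.1 (hs ▸ bumpSeq_monotone T z h)

theorem bumpSeq_lt {T : lam.cells → ℝ} {z : ℝ} {i j : ℕ} (hij : i < j)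
    (hi : i ≤ stopRow T z) : bumpSeq T z i < bumpSeq T z j :=
  (lt_bump T i fun h => absurd ((bumpSeq_eq_top_iff T z i).1 h) (by omega)).trans_le
    (bumpSeq_monotone T z hij)

theorem exists_eq_bumpSeq {T : lam.cells → ℝ} {z : ℝ} {i : ℕ} (h : i < stopRow T z) :
    ∃ c : lam.cells, c.1.1 = i ∧ bumpSeq T z (i + 1) = T c := by
  obtain ⟨c, h1, -, h2⟩ := exists_eq_bump (T := T) (i := i) (w := bumpSeq T z i) fun h' =>
    absurd ((bumpSeq_eq_top_iff T z (i + 1)).1 h') (by omega)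
  exact ⟨c, h1, h2⟩

theorem bumpSeq_succ_le {T : lam.cells → ℝ} {z : ℝ} {c : lam.cells}
    (hw : bumpSeq T z c.1.1 < T c) : bumpSeq T z (c.1.1 + 1) ≤ T c :=
  bump_le rfl hw

theorem stopRow_anti (T : lam.cells → ℝ) {z z' : ℝ} (h : z ≤ z') : stopRow T z' ≤ stopRow T z := by
  rw [← Nat.lt_succ_iff, ← bumpSeq_eq_top_iff]
  have h1 := (bumpSeq_eq_top_iff T z (stopRow T z + 1)).2 (Nat.lt_succ_self _)
  exact top_le_iff.1 (h1 ▸ bumpSeq_mono T h _)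

theorem uCoord_newBox_mono (T : lam.cells → ℝ) {z z' : ℝ} (h : z ≤ z') :
    uCoord (newBox T z) ≤ uCoord (newBox T z') :=
  (rowLen_sub_strictAnti lam).antitone (stopRow_anti T h)

/-- The bumping route moves weakly to the left. -/
theorem bumpSeq_le_below {T : lam.cells → ℝ} (hT : StrictMono T) {z : ℝ} {i j : ℕ}
    (h0 : (i, j) ∈ lam.cells) (e0 : bumpSeq T z (i + 1) = T ⟨(i, j), h0⟩)
    (h : (i + 1, j) ∈ lam.cells) : bumpSeq T z (i + 2) ≤ T ⟨(i + 1, j), h⟩ := by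
  refine bumpSeq_succ_le (c := ⟨(i + 1, j), h⟩) ?_
  simp only [e0]
  exact WithTop.coe_lt_coe.2 (hT (Prod.mk_lt_mk.2 (Or.inl ⟨Nat.lt_succ_self i, le_rfl⟩)))

theorem newBox_mem_addableBoxes {T : lam.cells → ℝ} (hT : StrictMono T) (z : ℝ) :
    newBox T z ∈ addableBoxes lam := by
  rw [newBox_eq, mem_addableBoxes_iff]
  refine ⟨rfl, ?_⟩
  rcases hr : stopRow T z with _ | i
  · exact Or.inl rfl
  · right
    obtain ⟨⟨⟨i', j⟩, hc⟩, rfl, e⟩ := exists_eq_bumpSeq (T := T) (z := z) (i := i) (by omega)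
    simp only at e hr
    have h1 : lam.rowLen (i' + 1) ≤ j := by
      by_contra hlt
      have h := bumpSeq_le_below hT hc e (YoungDiagram.mem_iff_lt_rowLen.2 (not_le.1 hlt))
      rw [(bumpSeq_eq_top_iff T z (i' + 2)).2 (by omega)] at h
      exact absurd (top_le_iff.1 h) WithTop.coe_ne_top
    exact h1.trans_lt (YoungDiagram.mem_iff_lt_rowLen.1 hc)

open Classical in
/-- The entries of the tableau that results from the row insertion of `z` into `T`. -/
noncomputable def rowInsert (T : lam.cells → ℝ) (z : ℝ) (c : ℕ × ℕ) : ℝ :=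
  if h : c ∈ lam.cells then
    if (T ⟨c, h⟩ : WithTop ℝ) = bumpSeq T z (c.1 + 1) then (bumpSeq T z c.1).untopD 0 else T ⟨c, h⟩
  else (bumpSeq T z c.1).untopD 0

theorem coe_untopD_bumpSeq {T : lam.cells → ℝ} {z : ℝ} {i : ℕ} (h : i ≤ stopRow T z) :
    (((bumpSeq T z i).untopD 0 : ℝ) : WithTop ℝ) = bumpSeq T z i := by
  obtain ⟨a, ha⟩ := WithTop.ne_top_iff_exists.1 (show bumpSeq T z i ≠ ⊤ from fun h' =>
    absurd ((bumpSeq_eq_top_iff T z i).1 h') (by omega))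
  rw [← ha, WithTop.untopD_coe]

/-- An entry after the insertion is either unchanged or a number that has been inserted into its
row. -/
theorem rowInsert_cases (T : lam.cells → ℝ) (z : ℝ) {c : ℕ × ℕ}
    (hc : c ∈ insert (newBox T z) lam.cells) :
    (∃ h : c ∈ lam.cells, (T ⟨c, h⟩ : WithTop ℝ) ≠ bumpSeq T z (c.1 + 1) ∧
      rowInsert T z c = T ⟨c, h⟩) ∨
    (c.1 ≤ stopRow T z ∧ (rowInsert T z c : WithTop ℝ) = bumpSeq T z c.1 ∧
      (∀ h : c ∈ lam.cells, (T ⟨c, h⟩ : WithTop ℝ) = bumpSeq T z (c.1 + 1)) ∧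
      (c ∉ lam.cells → c = newBox T z)) := by
  by_cases h : c ∈ lam.cells
  · by_cases e : (T ⟨c, h⟩ : WithTop ℝ) = bumpSeq T z (c.1 + 1)
    · right
      have h1 : c.1 ≤ stopRow T z := by
        by_contra h2
        rw [(bumpSeq_eq_top_iff T z (c.1 + 1)).2 (by omega)] at e
        exact WithTop.coe_ne_top e
      refine ⟨h1, ?_, fun _ => e, fun h' => absurd h h'⟩
      rw [rowInsert, dif_pos h, if_pos e, coe_untopD_bumpSeq h1]
    · left
      refine ⟨h, e, ?_⟩
      rw [rowInsert, dif_pos h, if_neg e]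
  · right
    have h1 := (Finset.mem_insert.1 hc).resolve_right h
    have h2 : c.1 ≤ stopRow T z := by rw [h1, newBox_eq]
    refine ⟨h2, ?_, fun h' => absurd h' h, fun _ => h1⟩
    rw [rowInsert, dif_neg h, coe_untopD_bumpSeq h2]

theorem coe_rowInsert_newBox {T : lam.cells → ℝ} (hT : StrictMono T) (z : ℝ) :
    (rowInsert T z (newBox T z) : WithTop ℝ) = bumpSeq T z (stopRow T z) := by
  have h : newBox T z ∉ lam.cells := ((mem_addableBoxes _ _).1 (newBox_mem_addableBoxes hT z)).1
  rw [rowInsert, dif_neg h, coe_untopD_bumpSeq (by rw [newBox_eq])]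
  rfl

/-- Every number inserted into a row is found there afterwards. -/
theorem exists_rowInsert_eq {T : lam.cells → ℝ} (hT : StrictMono T) {z : ℝ} {i : ℕ}
    (hi : i ≤ stopRow T z) :
    ∃ c ∈ insert (newBox T z) lam.cells, c.1 = i ∧ (rowInsert T z c : WithTop ℝ) = bumpSeq T z i := by
  rcases hi.lt_or_eq with h | rfl
  · obtain ⟨c, rfl, e⟩ := exists_eq_bumpSeq h
    have hc : c.1 ∈ insert (newBox T z) lam.cells := Finset.mem_insert_of_mem c.2
    refine ⟨c.1, hc, rfl, ?_⟩
    rcases rowInsert_cases T z hc with ⟨h0, h1, h2⟩ | ⟨h0, h1, h2⟩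
    · exact absurd e.symm h1
    · exact h1
  · exact ⟨_, Finset.mem_insert_self _ _, rfl, coe_rowInsert_newBox hT z⟩

theorem row_eq_of_bumpSeq_eq {T : lam.cells → ℝ} (hTi : Function.Injective T) {z : ℝ}
    (hz : ∀ c, T c ≠ z) {c : lam.cells} {i : ℕ} (h : (T c : WithTop ℝ) = bumpSeq T z i) :
    c.1.1 + 1 = i := by
  rcases i with _ | i
  · exact absurd (WithTop.coe_injective h) (hz c)
  · obtain ⟨d, rfl, e⟩ := exists_eq_bumpSeq (T := T) (z := z) (i := i) (by
      by_contra h1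
      rw [(bumpSeq_eq_top_iff T z (i + 1)).2 (by omega)] at h
      exact WithTop.coe_ne_top h)
    rw [hTi (WithTop.coe_injective (h.trans e))]

/-- A number inserted into a row below the first one comes from a box that is weakly to the
right. -/
theorem exists_box_above {T : lam.cells → ℝ} (hT : StrictMono T) {z : ℝ} {i j : ℕ}
    (hc : (i + 1, j) ∈ insert (newBox T z) lam.cells)
    (h1 : ∀ h : (i + 1, j) ∈ lam.cells, (T ⟨(i + 1, j), h⟩ : WithTop ℝ) = bumpSeq T z (i + 2))
    (h2 : (i + 1, j) ∉ lam.cells → (i + 1, j) = newBox T z) (hi : i + 1 ≤ stopRow T z) :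
    ∃ j0, j ≤ j0 ∧ ∃ h : (i, j0) ∈ lam.cells, bumpSeq T z (i + 1) = T ⟨(i, j0), h⟩ := by
  obtain ⟨⟨⟨i', j0⟩, h⟩, rfl, e⟩ := exists_eq_bumpSeq (T := T) (z := z) (i := i) hi
  simp only at e hc h1 h2 hi
  refine ⟨j0, ?_, h, e⟩
  by_contra hlt
  push Not at hlt
  by_cases hm : (i' + 1, j) ∈ lam.cells
  · have hm0 : (i' + 1, j0) ∈ lam.cells := lam.isLowerSet (Prod.mk_le_mk.2 ⟨le_rfl, hlt.le⟩) hm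
    have h3 := bumpSeq_le_below hT h e hm0
    rw [← h1 hm, WithTop.coe_le_coe] at h3
    exact absurd (hT (show (⟨(i' + 1, j0), hm0⟩ : lam.cells) < ⟨(i' + 1, j), hm⟩ from
      Prod.mk_lt_mk.2 (Or.inr ⟨le_rfl, hlt⟩))) h3.not_gt
  · have h3 := h2 hm
    rw [newBox_eq, Prod.mk.injEq] at h3
    have hm0 : (i' + 1, j0) ∈ lam.cells := by
      rw [YoungDiagram.mem_cells, YoungDiagram.mem_iff_lt_rowLen]
      rw [← h3.1] at h3
      omega
    have h4 := bumpSeq_le_below hT h e hm0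
    rw [(bumpSeq_eq_top_iff T z (i' + 2)).2 (by omega)] at h4
    exact absurd (top_le_iff.1 h4) WithTop.coe_ne_top

theorem rowInsert_lt_of_row {T : lam.cells → ℝ} (hT : StrictMono T) (hTi : Function.Injective T)
    {z : ℝ} (hz : ∀ c, T c ≠ z) {i j l : ℕ} (hc : (i, j) ∈ insert (newBox T z) lam.cells)
    (hd : (i, l) ∈ insert (newBox T z) lam.cells) (hjl : j < l) :
    rowInsert T z (i, j) < rowInsert T z (i, l) := by
  have hcl : (i, j) ∈ lam.cells := by
    rcases Finset.mem_insert.1 hd with h | h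
    · rw [newBox_eq, Prod.mk.injEq] at h
      rw [YoungDiagram.mem_cells, YoungDiagram.mem_iff_lt_rowLen, h.1, ← h.2]
      exact hjl
    · exact lam.isLowerSet (Prod.mk_le_mk.2 ⟨le_rfl, hjl.le⟩) h
  have hTT : ∀ h : (i, l) ∈ lam.cells, T ⟨(i, j), hcl⟩ < T ⟨(i, l), h⟩ := fun h =>
    hT (Prod.mk_lt_mk.2 (Or.inr ⟨le_rfl, hjl⟩))
  rw [← WithTop.coe_lt_coe]
  rcases rowInsert_cases T z hc with ⟨c0, c1, c2⟩ | ⟨c1, c2, c3, c4⟩ <;>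
    rcases rowInsert_cases T z hd with ⟨d0, d1, d2⟩ | ⟨d1, d2, d3, d4⟩
  · rw [c2, d2]
    exact WithTop.coe_lt_coe.2 (hTT d0)
  · rw [c2, d2]
    refine lt_of_le_of_ne ?_ fun e => ?_
    · by_contra hlt
      have h1 := bumpSeq_succ_le (c := ⟨(i, j), hcl⟩) (not_le.1 hlt)
      by_cases hm : (i, l) ∈ lam.cells
      · rw [← d3 hm, WithTop.coe_le_coe] at h1
        exact absurd (hTT hm) h1.not_gt
      · have h2 := d4 hm
        rw [newBox_eq, Prod.mk.injEq] at h2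
        rw [(bumpSeq_eq_top_iff T z (i + 1)).2 (by omega)] at h1
        exact absurd (top_le_iff.1 h1) WithTop.coe_ne_top
    · have := row_eq_of_bumpSeq_eq hTi hz e
      simp at this
  · rw [c2, d2]
    refine (bumpSeq_lt (Nat.lt_succ_self i) c1).trans ?_
    rw [← c3 hcl]
    exact WithTop.coe_lt_coe.2 (hTT d0)
  · exfalso
    have h1 := c3 hcl
    by_cases hm : (i, l) ∈ lam.cells
    · rw [← d3 hm] at h1
      exact absurd (hTT hm) (WithTop.coe_injective h1).not_lt
    · have h2 := d4 hm
      rw [newBox_eq, Prod.mk.injEq] at h2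
      rw [(bumpSeq_eq_top_iff T z (i + 1)).2 (by omega)] at h1
      exact WithTop.coe_ne_top h1

theorem rowInsert_lt_of_col {T : lam.cells → ℝ} (hT : StrictMono T) (hTi : Function.Injective T)
    {z : ℝ} {i k j : ℕ} (hc : (i, j) ∈ insert (newBox T z) lam.cells)
    (hd : (k, j) ∈ insert (newBox T z) lam.cells) (hik : i < k) :
    rowInsert T z (i, j) < rowInsert T z (k, j) := by
  have hcl : (i, j) ∈ lam.cells := by
    rcases Finset.mem_insert.1 hd with h | h
    · exact ((mem_addableBoxes _ _).1 (newBox_mem_addableBoxes hT z)).2 _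
        (h ▸ Prod.mk_lt_mk.2 (Or.inl ⟨hik, le_rfl⟩))
    · exact lam.isLowerSet (Prod.mk_le_mk.2 ⟨hik.le, le_rfl⟩) h
  have hTT : ∀ h : (k, j) ∈ lam.cells, T ⟨(i, j), hcl⟩ < T ⟨(k, j), h⟩ := fun h =>
    hT (Prod.mk_lt_mk.2 (Or.inl ⟨hik, le_rfl⟩))
  rw [← WithTop.coe_lt_coe]
  rcases rowInsert_cases T z hc with ⟨c0, c1, c2⟩ | ⟨c1, c2, c3, c4⟩ <;>
    rcases rowInsert_cases T z hd with ⟨d0, d1, d2⟩ | ⟨d1, d2, d3, d4⟩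
  · rw [c2, d2]
    exact WithTop.coe_lt_coe.2 (hTT d0)
  · obtain ⟨m, rfl⟩ := Nat.exists_eq_add_of_le' (Nat.succ_le_of_lt (Nat.zero_lt_of_lt hik))
    obtain ⟨j0, hj0, h0, e0⟩ := exists_box_above hT hd d3 d4 d1
    have hle : (⟨(i, j), hcl⟩ : lam.cells) ≤ ⟨(m, j0), h0⟩ :=
      Prod.mk_le_mk.2 ⟨Nat.le_of_lt_succ hik, hj0⟩
    rw [c2, d2]
    simp only
    rw [e0]
    refine lt_of_le_of_ne (WithTop.coe_le_coe.2 (hT.monotone hle)) fun e => c1 ?_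
    have e' := hTi (WithTop.coe_injective e)
    rw [e, ← e0]
    simp only [Subtype.mk.injEq, Prod.mk.injEq] at e'
    rw [e'.1]
  · rw [c2, d2]
    refine (bumpSeq_lt (Nat.lt_succ_self i) c1).trans ?_
    rw [← c3 hcl]
    exact WithTop.coe_lt_coe.2 (hTT d0)
  · rw [c2, d2]
    exact bumpSeq_lt hik c1

theorem rowInsert_strictMono {T : lam.cells → ℝ} (hT : StrictMono T) (hTi : Function.Injective T)
    {z : ℝ} (hz : ∀ c, T c ≠ z) {nu : YoungDiagram} (hnu : nu.cells = insert (newBox T z) lam.cells) :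
    StrictMono fun c : nu.cells => rowInsert T z c := by
  rintro ⟨⟨i, j⟩, hc⟩ ⟨⟨k, l⟩, hd⟩ hcd
  have hle : i ≤ k ∧ j ≤ l := Prod.mk_le_mk.1 hcd.le
  have hm : (i, l) ∈ nu.cells := nu.isLowerSet (Prod.mk_le_mk.2 ⟨hle.1, le_rfl⟩) hd
  simp only
  rw [hnu] at hc hd hm
  rcases hle.1.lt_or_eq with h1 | rfl
  · rcases hle.2.lt_or_eq with h2 | rfl
    · exact (rowInsert_lt_of_row hT hTi hz hc hm h2).trans (rowInsert_lt_of_col hT hTi hm hd h1)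
    · exact rowInsert_lt_of_col hT hTi hc hd h1
  · rcases hle.2.lt_or_eq with h2 | rfl
    · exact rowInsert_lt_of_row hT hTi hz hc hd h2
    · exact absurd hcd (lt_irrefl _)

theorem rowInsert_injOn {T : lam.cells → ℝ} (hTi : Function.Injective T) {z : ℝ}
    (hz : ∀ c, T c ≠ z) : Set.InjOn (rowInsert T z) (insert (newBox T z) lam.cells : Finset _) := by
  have aux : ∀ c d, c ∈ insert (newBox T z) lam.cells → d ∈ insert (newBox T z) lam.cells →
      rowInsert T z c = rowInsert T z d →
      ∀ h : c ∈ lam.cells, (T ⟨c, h⟩ : WithTop ℝ) ≠ bumpSeq T z (c.1 + 1) →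
      rowInsert T z c = T ⟨c, h⟩ → c = d := by
    intro c d hc hd e c0 c1 c2
    rcases rowInsert_cases T z hd with ⟨d0, d1, d2⟩ | ⟨d1, d2, d3, d4⟩
    · rw [c2, d2] at e
      exact congrArg Subtype.val (hTi e)
    · rw [← e, c2] at d2
      have := row_eq_of_bumpSeq_eq hTi hz d2
      rw [← this] at d2
      exact absurd d2 c1
  intro c hc d hd e
  rcases rowInsert_cases T z hc with ⟨c0, c1, c2⟩ | ⟨c1, c2, c3, c4⟩
  · exact aux c d hc hd e c0 c1 c2
  rcases rowInsert_cases T z hd with ⟨d0, d1, d2⟩ | ⟨d1, d2, d3, d4⟩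
  · exact (aux d c hd hc e.symm d0 d1 d2).symm
  rw [e, d2] at c2
  have hrow : c.1 = d.1 := by
    rcases lt_trichotomy c.1 d.1 with h | h | h
    · exact absurd c2 (bumpSeq_lt h c1).ne'
    · exact h
    · exact absurd c2 (bumpSeq_lt h d1).ne
  have aux2 : ∀ c d : ℕ × ℕ, c.1 = d.1 → c ∉ lam.cells → (c ∉ lam.cells → c = newBox T z) →
      (∀ h : d ∈ lam.cells, (T ⟨d, h⟩ : WithTop ℝ) = bumpSeq T z (d.1 + 1)) →
      d ∉ lam.cells := by
    intro c d hcd hc hc' hd hdl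
    have h1 := hd hdl
    rw [← hcd, hc' hc, newBox_eq, (bumpSeq_eq_top_iff T z _).2 (Nat.lt_succ_self _)] at h1
    exact WithTop.coe_ne_top h1
  by_cases hcl : c ∈ lam.cells
  · by_cases hdl : d ∈ lam.cells
    · have h1 := c3 hcl
      rw [hrow, ← d3 hdl] at h1
      exact congrArg Subtype.val (hTi (WithTop.coe_injective h1))
    · exact absurd hcl (aux2 d c hrow.symm hdl d4 c3)
  · rw [c4 hcl, d4 (aux2 c d hrow hcl c4 d3)]

theorem rowInsert_mem_range (T : lam.cells → ℝ) (z : ℝ) {c : ℕ × ℕ}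
    (hc : c ∈ insert (newBox T z) lam.cells) :
    ∃ o : Option lam.cells, rowInsert T z c = o.elim z T := by
  rcases rowInsert_cases T z hc with ⟨c0, c1, c2⟩ | ⟨c1, c2, -⟩
  · exact ⟨some ⟨c, c0⟩, c2⟩
  · rcases hi : c.1 with _ | i
    · rw [hi] at c2
      exact ⟨none, WithTop.coe_injective c2⟩
    · obtain ⟨d, -, e⟩ := exists_eq_bumpSeq (T := T) (z := z) (i := i) (by omega)
      rw [hi, e] at c2
      exact ⟨some d, WithTop.coe_injective c2⟩

theorem exists_equiv_rowInsert {T : lam.cells → ℝ} (hTi : Function.Injective T) {z : ℝ}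
    (hz : ∀ c, T c ≠ z) {nu : YoungDiagram} (hcard : nu.card = lam.card + 1)
    (hnu : nu.cells = insert (newBox T z) lam.cells) :
    ∃ e : nu.cells ≃ Option lam.cells, ∀ c : nu.cells, rowInsert T z c = (e c).elim z T := by
  choose f hf using fun c : nu.cells => rowInsert_mem_range T z (c := c) (by rw [← hnu]; exact c.2)
  have hinj : Function.Injective f := by
    intro c d h
    have h1 : rowInsert T z c = rowInsert T z d := by rw [hf, hf, h]
    exact Subtype.ext (rowInsert_injOn hTi hz (by simp [← hnu])
      (by simp [← hnu]) h1)
  refine ⟨Equiv.ofBijective f ((Fintype.bijective_iff_injective_and_card f).2 ⟨hinj, ?_⟩), hf⟩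
  rw [Fintype.card_option, Fintype.card_coe, Fintype.card_coe]
  exact hcard

theorem bumpSeq_le_of_rowInsert_eq {T S : lam.cells → ℝ} (hS : StrictMono S)
    {z w : ℝ} (hb : newBox T z = newBox S w)
    (h : ∀ c ∈ insert (newBox T z) lam.cells, rowInsert T z c = rowInsert S w c) {i : ℕ}
    (hi : i < stopRow T z) (e : bumpSeq T z (i + 1) = bumpSeq S w (i + 1)) :
    bumpSeq S w i ≤ bumpSeq T z i := by
  have hr : stopRow T z = stopRow S w := congrArg Prod.fst hb
  obtain ⟨d, hd, rfl, e'⟩ := exists_rowInsert_eq hS (z := w) (i := i) (by omega)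
  have hlt : (rowInsert T z d : WithTop ℝ) < bumpSeq T z (d.1 + 1) := by
    rw [h d (hb ▸ hd), e', e]
    exact bumpSeq_lt (Nat.lt_succ_self _) (by omega)
  rw [← e', ← h d (hb ▸ hd)]
  rcases rowInsert_cases T z (hb ▸ hd) with ⟨c0, c1, c2⟩ | ⟨c1, c2, -⟩
  · rw [c2] at hlt ⊢
    by_contra hcon
    exact absurd (bumpSeq_succ_le (c := ⟨d, c0⟩) (not_le.1 hcon)) hlt.not_ge
  · exact c2.le

/-- Row insertion is injective. -/
theorem rowInsert_injective {T S : lam.cells → ℝ} (hT : StrictMono T) (hS : StrictMono S)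
    (hTi : Function.Injective T) (hSi : Function.Injective S)
    {z w : ℝ} (hz : ∀ c, T c ≠ z) (hw : ∀ c, S c ≠ w) (hb : newBox T z = newBox S w)
    (h : ∀ c ∈ insert (newBox T z) lam.cells, rowInsert T z c = rowInsert S w c) :
    T = S ∧ z = w := by
  have hr : stopRow T z = stopRow S w := congrArg Prod.fst hb
  have hle : ∀ i ≤ stopRow T z, bumpSeq T z i = bumpSeq S w i := by
    intro i hi
    induction hi using Nat.decreasingInduction with
    | self =>
      rw [← coe_rowInsert_newBox hT, h _ (Finset.mem_insert_self _ _), hb, coe_rowInsert_newBox hS, hr]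
    | of_succ i hi ih =>
      refine le_antisymm ?_ (bumpSeq_le_of_rowInsert_eq hS hb h hi ih)
      exact bumpSeq_le_of_rowInsert_eq hT hb.symm
        (fun c hc => (h c (hb ▸ hc)).symm) (hr ▸ hi) ih.symm
  have hall : ∀ i, bumpSeq T z i = bumpSeq S w i := by
    intro i
    rcases le_or_gt i (stopRow T z) with hi | hi
    · exact hle i hi
    · rw [(bumpSeq_eq_top_iff T z i).2 hi, (bumpSeq_eq_top_iff S w i).2 (hr ▸ hi)]
  have hrec : ∀ (T : lam.cells → ℝ) (z : ℝ), Function.Injective T → (∀ c, T c ≠ z) →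
      ∀ c : lam.cells, ((rowInsert T z c : WithTop ℝ) = bumpSeq T z c.1.1 ∧
        (T c : WithTop ℝ) = bumpSeq T z (c.1.1 + 1)) ∨
        ((rowInsert T z c : WithTop ℝ) ≠ bumpSeq T z c.1.1 ∧ T c = rowInsert T z c) := by
    intro T z hTi hz c
    rcases rowInsert_cases T z (Finset.mem_insert_of_mem c.2) with ⟨c0, c1, c2⟩ | ⟨c1, c2, c3, -⟩
    · right
      refine ⟨fun e => ?_, c2.symm⟩
      rw [c2] at e
      have h5 := row_eq_of_bumpSeq_eq hTi hz e
      simp at h5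
    · exact Or.inl ⟨c2, c3 c.2⟩
  refine ⟨funext fun c => ?_, WithTop.coe_injective (hall 0)⟩
  have h1 := hrec T z hTi hz c
  have h2 := hrec S w hSi hw c
  rw [h c (Finset.mem_insert_of_mem c.2), hall, hall] at h1
  rcases h1 with ⟨a1, a2⟩ | ⟨a1, a2⟩ <;> rcases h2 with ⟨b1, b2⟩ | ⟨b1, b2⟩
  · exact WithTop.coe_injective (a2.trans b2.symm)
  · exact absurd a1 b1
  · exact absurd b1 a1
  · rw [a2, b2]

/-- The row bumping lemma, for the insertion of a smaller number. -/
theorem uCoord_newBox_rowInsert_of_lt {T : lam.cells → ℝ} (hT : StrictMono T) {z w : ℝ}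
    {nu : YoungDiagram} (hnu : nu.cells = insert (newBox T z) lam.cells)
    (hwz : w < z) : uCoord (newBox (fun c : nu.cells => rowInsert T z c) w) ≤
      uCoord (newBox T z) - 1 := by
  set T' : nu.cells → ℝ := fun c => rowInsert T z c with hT'
  have key : ∀ i ≤ stopRow T z, bumpSeq T' w i < bumpSeq T z i := by
    intro i
    induction i with
    | zero => exact fun _ => WithTop.coe_lt_coe.2 hwz
    | succ i ih =>
      intro hi
      obtain ⟨d, hd, rfl, e⟩ := exists_rowInsert_eq hT (z := z) (i := i) (by omega)
      have h1 := ih (by omega)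
      rw [← e] at h1
      refine lt_of_le_of_lt (bumpSeq_succ_le (T := T') (c := ⟨d, hnu ▸ hd⟩) h1) ?_
      exact e.trans_lt (bumpSeq_lt (Nat.lt_succ_self _) (by omega))
  have hlast : stopRow T z < stopRow T' w := by
    obtain ⟨d, hd, hdr, e⟩ := exists_rowInsert_eq hT (z := z) (i := stopRow T z) le_rfl
    have h1 := key _ le_rfl
    rw [← e, ← hdr] at h1
    have h2 := bumpSeq_succ_le (T := T') (c := ⟨d, hnu ▸ hd⟩) h1
    by_contra hcon
    rw [(bumpSeq_eq_top_iff T' w _).2 (by simp only; omega)] at h2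
    exact absurd (top_le_iff.1 h2) WithTop.coe_ne_top
  have hc : newBox T z ∉ lam.cells := ((mem_addableBoxes _ _).1 (newBox_mem_addableBoxes hT z)).1
  have hg : GrowsAt lam (uCoord (newBox T z)) nu := ⟨_, hc, hnu, rfl⟩
  have h1 := rowLen_sub_strictAnti nu hlast
  have h2 : uCoord (newBox T z) ≠ uCoord (newBox T' w) := fun e => by
    have h3 := hg.mem_maya (uCoord (newBox T z))
    have h4 : uCoord (newBox T z) ∈ maya nu := ⟨stopRow T' w, e.symm⟩
    simp [h4] at h3
  rw [newBox_eq] at hnu hc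
  simp only [rowLen_of_insert hc hnu (stopRow T z), if_true] at h1
  simp only [newBox_eq, uCoord] at h1 h2 ⊢
  push_cast at h1
  omega

/-- The row bumping lemma, for the insertion of a larger number. -/
theorem uCoord_newBox_rowInsert_of_ge {T : lam.cells → ℝ} (hT : StrictMono T) {z w : ℝ}
    {nu : YoungDiagram} (hnu : nu.cells = insert (newBox T z) lam.cells)
    (hzw : z ≤ w) :
    uCoord (newBox T z) < uCoord (newBox (fun c : nu.cells => rowInsert T z c) w) := by
  set T' : nu.cells → ℝ := fun c => rowInsert T z c with hT'
  have key : ∀ i, bumpSeq T z i ≤ bumpSeq T' w i := by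
    intro i
    induction i with
    | zero => exact WithTop.coe_le_coe.2 hzw
    | succ i ih =>
      refine Finset.le_inf fun d hd => ?_
      obtain ⟨-, rfl, h1⟩ := Finset.mem_filter.1 hd
      have h2 := ih.trans_lt h1
      rcases rowInsert_cases T z (c := d) (by rw [← hnu]; exact d.2) with ⟨c0, c1, c2⟩ | ⟨c1, c2, c3⟩
      · have h3 : T' d = T ⟨d, c0⟩ := c2
        rw [h3] at h2 ⊢
        exact bumpSeq_succ_le (c := ⟨d, c0⟩) h2
      · exact absurd c2 h2.ne'
  have hlast : stopRow T' w ≤ stopRow T z := by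
    rw [← Nat.lt_succ_iff, ← bumpSeq_eq_top_iff]
    exact top_le_iff.1 (((bumpSeq_eq_top_iff T z _).2 (Nat.lt_succ_self _)).symm.le.trans (key _))
  have hc : newBox T z ∉ lam.cells := ((mem_addableBoxes _ _).1 (newBox_mem_addableBoxes hT z)).1
  have h1 := (rowLen_sub_strictAnti nu).antitone hlast
  rw [newBox_eq] at hnu hc
  simp only [rowLen_of_insert hc hnu (stopRow T z), if_true] at h1
  simp only [newBox_eq, uCoord] at h1 ⊢
  push_cast at h1
  omega

theorem threshold_rowInsert {T : lam.cells → ℝ} (hT : StrictMono T) {z : ℝ}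
    (hz : z ∈ Set.Icc (0 : ℝ) 1) {nu : YoungDiagram}
    (hnu : nu.cells = insert (newBox T z) lam.cells) :
    threshold (fun c : nu.cells => rowInsert T z c) ((uCoord (newBox T z) : ℝ) - 1) = z := by
  have : {w : ℝ | w ∈ Set.Icc (0 : ℝ) 1 ∧
      (uCoord (newBox (fun c : nu.cells => rowInsert T z c) w) : ℝ) ≤
        (uCoord (newBox T z) : ℝ) - 1} = Set.Ico 0 z := by
    ext w
    constructor
    · rintro ⟨h1, h2⟩
      refine ⟨h1.1, ?_⟩
      by_contra h3
      have h4 := uCoord_newBox_rowInsert_of_ge hT hnu (not_lt.1 h3)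
      have h5 : uCoord (newBox (fun c : nu.cells => rowInsert T z c) w) ≤ uCoord (newBox T z) - 1 := by
        exact_mod_cast h2
      omega
    · rintro ⟨h1, h2⟩
      refine ⟨⟨h1, h2.le.trans hz.2⟩, ?_⟩
      exact_mod_cast uCoord_newBox_rowInsert_of_lt hT hnu h2
  rw [threshold, this]
  rcases hz.1.eq_or_lt with rfl | h
  · simp
  · exact csSup_Ico h

end Insertion

section Volume

variable {ι : Type*}

theorem ae_injective [Fintype ι] : ∀ᵐ T : ι → ℝ, Function.Injective T := by
  have h : ∀ i j : ι, i ≠ j → ∀ᵐ T : ι → ℝ, T i ≠ T j := by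
    classical
    intro i j hij
    have h0 := Measure.addHaar_submodule (volume : Measure (ι → ℝ))
      (LinearMap.ker ((LinearMap.proj i : (ι → ℝ) →ₗ[ℝ] ℝ) - LinearMap.proj j)) (by
        intro htop
        have h1 : (Pi.single i 1 : ι → ℝ) ∈
            LinearMap.ker ((LinearMap.proj i : (ι → ℝ) →ₗ[ℝ] ℝ) - LinearMap.proj j) := by
          rw [htop]
          trivial
        simp [LinearMap.mem_ker, hij.symm] at h1)
    rw [ae_iff]
    convert h0 using 2
    ext T
    simp [LinearMap.mem_ker, LinearMap.sub_apply, sub_eq_zero]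
  have h' : ∀ᵐ T : ι → ℝ, ∀ i j : ι, i ≠ j → T i ≠ T j := by
    rw [ae_all_iff]
    intro i
    rw [ae_all_iff]
    intro j
    by_cases hij : i = j
    · simp [hij]
    · filter_upwards [h i j hij] with T hT _ using hT
  filter_upwards [h'] with T hT i j hij
  by_contra hne
  exact hT i j hne hij

/-- The points of the unit cube whose coordinates are ordered as prescribed by `e`. -/
def orderCell {n : ℕ} (e : ι ≃ Fin n) : Set (ι → ℝ) :=
  {T | (∀ c, T c ∈ Set.Icc (0 : ℝ) 1) ∧ StrictMono (T ∘ e.symm)}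

theorem measurableSet_strictMono_comp {κ : Type*} [Finite κ] [Preorder κ] (f : κ → ι) :
    MeasurableSet {T : ι → ℝ | StrictMono (T ∘ f)} := by
  have : {T : ι → ℝ | StrictMono (T ∘ f)} =
      ⋂ a, ⋂ b, ⋂ (_ : a < b), {T : ι → ℝ | T (f a) < T (f b)} := by
    ext T
    simp [StrictMono]
  rw [this]
  have := Finite.to_countable (α := κ)
  refine MeasurableSet.iInter fun a => MeasurableSet.iInter fun b => MeasurableSet.iInter fun _ => ?_
  exact measurableSet_lt (measurable_pi_apply _) (measurable_pi_apply _)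

theorem measurableSet_unitCube [Fintype ι] : MeasurableSet {T : ι → ℝ | ∀ c, T c ∈ Set.Icc (0 : ℝ) 1} := by
  have : {T : ι → ℝ | ∀ c, T c ∈ Set.Icc (0 : ℝ) 1} = Set.univ.pi fun _ => Set.Icc 0 1 := by
    ext T
    simp only [Set.mem_pi, Set.mem_ofPred_eq, Set.mem_univ, true_imp_iff]
  rw [this]
  exact MeasurableSet.univ_pi fun _ => measurableSet_Icc

theorem volume_unitCube [Fintype ι] : volume {T : ι → ℝ | ∀ c, T c ∈ Set.Icc (0 : ℝ) 1} = 1 := by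
  have : {T : ι → ℝ | ∀ c, T c ∈ Set.Icc (0 : ℝ) 1} = Set.univ.pi fun _ => Set.Icc 0 1 := by
    ext T
    simp only [Set.mem_pi, Set.mem_ofPred_eq, Set.mem_univ, true_imp_iff]
  rw [this, volume_pi_pi]
  simp

theorem measurableSet_orderCell [Fintype ι] {n : ℕ} (e : ι ≃ Fin n) : MeasurableSet (orderCell e) :=
  measurableSet_unitCube.inter (measurableSet_strictMono_comp _)

theorem volume_orderCell [Fintype ι] {n : ℕ} (e : ι ≃ Fin n) :
    volume (orderCell e) = volume (orderCell (Equiv.refl (Fin n))) := by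
  have h := volume_measurePreserving_piCongrLeft (fun _ : Fin n => ℝ) e
  rw [← h.measure_preimage (measurableSet_orderCell _).nullMeasurableSet]
  congr 1
  ext T
  have h1 : (MeasurableEquiv.piCongrLeft (fun _ : Fin n => ℝ) e) T = T ∘ e.symm := by
    funext i
    obtain ⟨j, rfl⟩ := e.surjective i
    rw [MeasurableEquiv.coe_piCongrLeft, Equiv.piCongrLeft_apply_apply]
    simp
  simp only [orderCell, Set.mem_preimage, Set.mem_ofPred_eq, h1]
  refine and_congr ⟨fun h i => h _, fun h c => ?_⟩ Iff.rfl
  simpa using h (e c)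

theorem disjoint_orderCell {n : ℕ} {e e' : ι ≃ Fin n} (h : e ≠ e') :
    Disjoint (orderCell e) (orderCell e') := by
  rw [Set.disjoint_left]
  intro T hT hT'
  have h1 : T ∘ e.symm = T ∘ e'.symm := by
    refine (StrictMono.range_inj hT.2 hT'.2).1 ?_
    rw [Set.range_comp, Set.range_comp, e.symm.range_eq_univ, e'.symm.range_eq_univ]
  have hinj : Function.Injective T := by
    have := hT.2.injective.comp e.injective
    simpa [Function.comp_assoc] using this
  have h2 : e.symm = e'.symm := Equiv.ext fun i => hinj (congrFun h1 i)
  exact h (by rw [← e.symm_symm, h2, e'.symm_symm])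

theorem exists_strictMono_comp [Fintype ι] {n : ℕ} (hn : Fintype.card ι = n) {T : ι → ℝ}
    (hT : Function.Injective T) : ∃ e : ι ≃ Fin n, StrictMono (T ∘ e.symm) := by
  let _ : LinearOrder ι := LinearOrder.lift' T hT
  exact ⟨(monoEquivOfFin ι hn).symm.toEquiv, fun a b hab => (monoEquivOfFin ι hn).strictMono hab⟩

theorem volume_eq_card_mul [Fintype ι] {n : ℕ} {E : Set (ι ≃ Fin n)} {A : Set (ι → ℝ)}
    (hA : ∀ T, Function.Injective T → (T ∈ A ↔ ∃ e ∈ E, T ∈ orderCell e)) :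
    volume A = Nat.card E * volume (orderCell (Equiv.refl (Fin n))) := by
  classical
  have h : A =ᵐ[volume] ⋃ e : E, orderCell e.1 := by
    filter_upwards [ae_injective (ι := ι)] with T hT
    refine propext ((hA T hT).trans ?_)
    change _ ↔ T ∈ ⋃ e : E, orderCell e.1
    simp
  have : Finite E := inferInstance
  have := Fintype.ofFinite E
  rw [measure_congr h, measure_iUnion (fun e e' hne => disjoint_orderCell fun h => hne (Subtype.ext h))
    fun e => measurableSet_orderCell _, tsum_fintype]
  simp only [volume_orderCell]
  rw [Finset.sum_const, Finset.card_univ, nsmul_eq_mul, Nat.card_eq_fintype_card]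

theorem volume_orderCell_mul (n : ℕ) :
    (n.factorial : ENNReal) * volume (orderCell (Equiv.refl (Fin n))) = 1 := by
  have h := volume_eq_card_mul (ι := Fin n) (n := n) (E := Set.univ)
    (A := {T | ∀ c, T c ∈ Set.Icc (0 : ℝ) 1}) fun T hT => ?_
  · rw [volume_unitCube, Nat.card_univ, Nat.card_eq_fintype_card,
      Fintype.card_equiv (Equiv.refl _), Fintype.card_fin] at h
    exact h.symm
  · constructor
    · intro h
      obtain ⟨e, he⟩ := exists_strictMono_comp (Fintype.card_fin n) hT
      exact ⟨e, trivial, h, he⟩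
    · rintro ⟨e, -, h⟩
      exact h.1

end Volume

theorem measurableSet_poissonizedTableaux (lam : YoungDiagram) :
    MeasurableSet (poissonizedTableaux lam) :=
  measurableSet_unitCube.inter (measurableSet_strictMono_comp id)

theorem factorial_mul_volume (lam : YoungDiagram) :
    (lam.card.factorial : ENNReal) * volume (poissonizedTableaux lam) = numSYT lam := by
  rw [volume_eq_card_mul (n := lam.card) (E := {e | StrictMono e}), ← mul_assoc,
    mul_comm (lam.card.factorial : ENNReal), mul_assoc, volume_orderCell_mul, mul_one]
  · rfl
  · intro T hT
    constructor
    · rintro ⟨h1, h2⟩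
      obtain ⟨e, he⟩ := exists_strictMono_comp (n := lam.card) (Fintype.card_coe _) hT
      refine ⟨e, fun a b hab => ?_, h1, he⟩
      rw [← he.lt_iff_lt]
      simpa using h2 hab
    · rintro ⟨e, he, h1, h2⟩
      refine ⟨h1, fun a b hab => ?_⟩
      simpa using h2 (he hab)

/-- The volume of the set of Poissonized tableaux. -/
noncomputable def tableauVolume (lam : YoungDiagram) : ℝ :=
  volume.real (poissonizedTableaux lam)

theorem factorial_mul_tableauVolume (lam : YoungDiagram) :
    (lam.card.factorial : ℝ) * tableauVolume lam = numSYT lam := by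
  have := congrArg ENNReal.toReal (factorial_mul_volume lam)
  simpa [tableauVolume, Measure.real] using this

theorem volume_poissonizedTableaux_ne_top (lam : YoungDiagram) :
    volume (poissonizedTableaux lam) ≠ ⊤ := by
  have h : poissonizedTableaux lam ⊆ {T | ∀ c, T c ∈ Set.Icc (0 : ℝ) 1} := fun T hT => hT.1
  refine ne_top_of_le_ne_top ?_ (measure_mono h)
  rw [volume_unitCube]
  exact ENNReal.one_ne_top

theorem tableauVolume_pos (lam : YoungDiagram) : 0 < tableauVolume lam := by
  have h := factorial_mul_tableauVolume lam
  have h1 : (0 : ℝ) < numSYT lam := by exact_mod_cast numSYT_pos lam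
  have h2 : (0 : ℝ) < lam.card.factorial := by positivity
  rw [← h] at h1
  exact pos_of_mul_pos_right h1 h2.le

theorem GrowsAt.tableauVolume_eq {lam nu : YoungDiagram} {x : ℤ} (h : GrowsAt lam x nu) :
    tableauVolume nu = transitionMeasure lam x * tableauVolume lam := by
  have h1 := factorial_mul_tableauVolume lam
  have h2 := factorial_mul_tableauVolume nu
  rw [h.numSYT_eq, ← h1, h.card, Nat.factorial_succ] at h2
  push_cast at h2
  have h3 : ((lam.card : ℝ) + 1) * lam.card.factorial ≠ 0 := by positivity
  apply mul_left_cancel₀ h3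
  rw [h2]
  ring

section InsertionMap

variable {lam : YoungDiagram}

theorem bump_eq (T : lam.cells → ℝ) (i : ℕ) (w : WithTop ℝ) :
    bump T i w = Finset.univ.inf fun c : lam.cells =>
      if c.1.1 = i ∧ w < (T c : WithTop ℝ) then (T c : WithTop ℝ) else ⊤ := by
  refine le_antisymm (Finset.le_inf fun c _ => ?_) (Finset.le_inf fun c hc => ?_)
  · split_ifs with h
    · exact bump_le h.1 h.2
    · exact le_top
  · obtain ⟨-, h⟩ := Finset.mem_filter.1 hc
    refine (Finset.inf_le (Finset.mem_univ c)).trans ?_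
    rw [if_pos h]

theorem measurable_finsetInf {α κ : Type*} [MeasurableSpace α] (s : Finset κ)
    {f : κ → α → WithTop ℝ} (hf : ∀ c, Measurable (f c)) :
    Measurable fun a => s.inf fun c => f c a := by
  classical
  induction s using Finset.induction_on with
  | empty => simp only [Finset.inf_empty, measurable_const]
  | insert c s _ ih =>
    simp only [Finset.inf_insert]
    exact (hf c).min ih

theorem measurable_bumpSeq (i : ℕ) :
    Measurable fun q : (lam.cells → ℝ) × ℝ => bumpSeq q.1 q.2 i := by
  have hT : ∀ c : lam.cells, Measurable fun q : (lam.cells → ℝ) × ℝ => (q.1 c : WithTop ℝ) :=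
    fun c => ((measurable_pi_apply c).comp measurable_fst).withTop_coe
  induction i with
  | zero => exact measurable_snd.withTop_coe
  | succ i ih =>
    simp only [bumpSeq, bump_eq]
    refine measurable_finsetInf _ fun c => ?_
    by_cases hc : c.1.1 = i
    · simp only [hc, true_and]
      exact Measurable.ite (measurableSet_lt ih (hT c)) (hT c) measurable_const
    · simp only [hc, false_and, if_false, measurable_const]

theorem measurable_stopRow : Measurable fun q : (lam.cells → ℝ) × ℝ => stopRow q.1 q.2 := by
  refine measurable_to_countable' fun r => ?_
  have : (fun q : (lam.cells → ℝ) × ℝ => stopRow q.1 q.2) ⁻¹' {r} =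
      {q | bumpSeq q.1 q.2 (r + 1) = ⊤} ∩ {q | bumpSeq q.1 q.2 r = ⊤}ᶜ := by
    ext q
    simp only [Set.mem_preimage, Set.mem_singleton_iff, Set.mem_inter_iff, Set.mem_ofPred_eq,
      Set.mem_compl_iff, bumpSeq_eq_top_iff]
    omega
  rw [this]
  exact (measurable_bumpSeq _ (measurableSet_singleton ⊤)).inter
    (measurable_bumpSeq _ (measurableSet_singleton ⊤)).compl

theorem measurable_uCoord_newBox :
    Measurable fun q : (lam.cells → ℝ) × ℝ => uCoord (newBox q.1 q.2) :=
  (Measurable.of_discrete (f := fun r : ℕ => uCoord (r, lam.rowLen r))).comp measurable_stopRow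

theorem measurable_rowInsert (c : ℕ × ℕ) :
    Measurable fun q : (lam.cells → ℝ) × ℝ => rowInsert q.1 q.2 c := by
  unfold rowInsert
  by_cases hc : c ∈ lam.cells
  · have hT : Measurable fun q : (lam.cells → ℝ) × ℝ => q.1 ⟨c, hc⟩ :=
      (measurable_pi_apply _).comp measurable_fst
    simp only [hc, dif_pos]
    exact Measurable.ite (measurableSet_eq_fun hT.withTop_coe (measurable_bumpSeq _))
      ((measurable_bumpSeq _).untopD 0) hT
  · simp only [hc, dif_neg, not_false_iff]
    exact (measurable_bumpSeq _).untopD 0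

/-- The pairs of a tableau and a number, all of whose entries are different. -/
def genericPairs (lam : YoungDiagram) : Set ((lam.cells → ℝ) × ℝ) :=
  {q | q.1 ∈ poissonizedTableaux lam ∧ q.2 ∈ Set.Icc (0 : ℝ) 1 ∧ Function.Injective q.1 ∧
    ∀ c, q.1 c ≠ q.2}

/-- The generic pairs for which the row insertion creates a box with `u`-coordinate `x`. -/
def insertionDomain (lam : YoungDiagram) (x : ℤ) : Set ((lam.cells → ℝ) × ℝ) :=
  genericPairs lam ∩ {q | uCoord (newBox q.1 q.2) = x}

theorem measurableSet_genericPairs : MeasurableSet (genericPairs lam) := by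
  have e : genericPairs lam = (poissonizedTableaux lam ×ˢ Set.Icc (0 : ℝ) 1) ∩
      ((⋂ c, ⋂ d, ⋂ (_ : c ≠ d), {q : (lam.cells → ℝ) × ℝ | q.1 c = q.1 d}ᶜ) ∩
        ⋂ c, {q : (lam.cells → ℝ) × ℝ | q.1 c = q.2}ᶜ) := by
    ext q
    simp only [genericPairs, Set.mem_ofPred_eq, Set.mem_inter_iff, Set.mem_prod, Set.mem_iInter,
      Set.mem_compl_iff, and_assoc]
    refine and_congr_right fun _ => and_congr_right fun _ => and_congr_left fun _ => ?_
    exact ⟨fun h c d hcd e => hcd (h e), fun h c d e => by_contra fun hcd => h c d hcd e⟩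
  rw [e]
  have hT : ∀ c : lam.cells, Measurable fun q : (lam.cells → ℝ) × ℝ => q.1 c :=
    fun c => (measurable_pi_apply c).comp measurable_fst
  refine ((measurableSet_poissonizedTableaux lam).prod measurableSet_Icc).inter
    (MeasurableSet.inter ?_ ?_)
  · exact MeasurableSet.iInter fun c => MeasurableSet.iInter fun d => MeasurableSet.iInter fun _ =>
      (measurableSet_eq_fun (hT c) (hT d)).compl
  · exact MeasurableSet.iInter fun c => (measurableSet_eq_fun (hT c) measurable_snd).compl

theorem measurableSet_insertionDomain (x : ℤ) : MeasurableSet (insertionDomain lam x) :=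
  measurableSet_genericPairs.inter (measurable_uCoord_newBox (measurableSet_singleton x))

/-- The reordering of coordinates given by `e`. -/
noncomputable def reorder {nu : YoungDiagram} (e : nu.cells ≃ Option lam.cells) :
    ((lam.cells → ℝ) × ℝ) ≃ᵐ (nu.cells → ℝ) :=
  (MeasurableEquiv.piOptionEquivProd fun _ : Option lam.cells => ℝ).symm.trans
    (MeasurableEquiv.piCongrLeft (fun _ : nu.cells => ℝ) e.symm)

theorem piOptionEquivProd_symm_apply (q : (lam.cells → ℝ) × ℝ) (o : Option lam.cells) :
    (MeasurableEquiv.piOptionEquivProd fun _ : Option lam.cells => ℝ).symm q o = o.elim q.2 q.1 := by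
  cases o <;> rfl

theorem reorder_apply {nu : YoungDiagram} (e : nu.cells ≃ Option lam.cells)
    (q : (lam.cells → ℝ) × ℝ) (c : nu.cells) : reorder e q c = (e c).elim q.2 q.1 := by
  obtain ⟨o, rfl⟩ := e.symm.surjective c
  rw [reorder, MeasurableEquiv.trans_apply, MeasurableEquiv.piCongrLeft_apply_apply,
    piOptionEquivProd_symm_apply, Equiv.apply_symm_apply]

theorem measurePreserving_piOptionEquivProd_symm :
    MeasurePreserving (MeasurableEquiv.piOptionEquivProd fun _ : Option lam.cells => ℝ).symm
      volume volume :=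
  ⟨MeasurableEquiv.measurable _, Measure.pi_map_piOptionEquivProd fun _ => volume⟩

theorem measurePreserving_reorder {nu : YoungDiagram} (e : nu.cells ≃ Option lam.cells) :
    MeasurePreserving (reorder e) volume volume :=
  (volume_measurePreserving_piCongrLeft (fun _ : nu.cells => ℝ) e.symm).comp
    measurePreserving_piOptionEquivProd_symm

theorem ae_generic : ∀ᵐ q : (lam.cells → ℝ) × ℝ, Function.Injective q.1 ∧ ∀ c, q.1 c ≠ q.2 := by
  have h := (measurePreserving_piOptionEquivProd_symm (lam := lam)).quasiMeasurePreserving.ae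
    (ae_injective (ι := Option lam.cells))
  filter_upwards [h] with q hq
  constructor
  · intro c d hcd
    have := @hq (some c) (some d) (by rw [piOptionEquivProd_symm_apply, piOptionEquivProd_symm_apply]; exact hcd)
    exact Option.some_injective _ this
  · intro c hc
    have := @hq (some c) none (by rw [piOptionEquivProd_symm_apply, piOptionEquivProd_symm_apply]; exact hc)
    simp at this

theorem genericPairs_ae_eq :
    genericPairs lam =ᵐ[volume] (poissonizedTableaux lam ×ˢ Set.Icc (0 : ℝ) 1 : Set _) := by
  filter_upwards [ae_generic (lam := lam)] with q hq
  refine propext ⟨fun h => ⟨h.1, h.2.1⟩, fun h => ⟨h.1, h.2, hq.1, hq.2⟩⟩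

theorem volume_genericPairs : volume (genericPairs lam) = volume (poissonizedTableaux lam) := by
  rw [measure_congr genericPairs_ae_eq, Measure.volume_eq_prod, Measure.prod_prod, Real.volume_Icc]
  simp

theorem genericPairs_eq_biUnion :
    genericPairs lam = ⋃ x ∈ concaveCorners lam, insertionDomain lam x := by
  ext q
  simp only [insertionDomain, Set.mem_iUnion, Set.mem_inter_iff, Set.mem_ofPred_eq, exists_prop]
  constructor
  · intro h
    exact ⟨_, Finset.mem_image_of_mem _ (newBox_mem_addableBoxes h.1.2 _), h, rfl⟩
  · rintro ⟨x, -, h, -⟩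
    exact h

theorem disjoint_insertionDomain {x y : ℤ} (h : x ≠ y) :
    Disjoint (insertionDomain lam x) (insertionDomain lam y) := by
  rw [Set.disjoint_left]
  rintro q ⟨-, h1⟩ ⟨-, h2⟩
  exact h (h1.symm.trans h2)

theorem sum_volume_insertionDomain :
    ∑ x ∈ concaveCorners lam, volume (insertionDomain lam x) = volume (poissonizedTableaux lam) := by
  rw [← volume_genericPairs, genericPairs_eq_biUnion, measure_biUnion_finset]
  · exact fun x _ y _ h => disjoint_insertionDomain h
  · exact fun x _ => measurableSet_insertionDomain x

variable {x : ℤ} {nu : YoungDiagram}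

theorem GrowsAt.cells_eq (h : GrowsAt lam x nu) {q : (lam.cells → ℝ) × ℝ}
    (hq : q ∈ insertionDomain lam x) : nu.cells = insert (newBox q.1 q.2) lam.cells := by
  obtain ⟨c, hc, hnu, hx⟩ := h
  rw [hnu, eq_of_mem_addableBoxes (mem_addableBoxes_of_insert hc hnu)
    (newBox_mem_addableBoxes hq.1.1.2 q.2) (hx.trans hq.2.symm)]

/-- The tableau that results from the insertion. -/
noncomputable def insertMap (nu : YoungDiagram) (q : (lam.cells → ℝ) × ℝ) : nu.cells → ℝ :=
  fun c => rowInsert q.1 q.2 c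

theorem measurable_insertMap : Measurable (insertMap nu : (lam.cells → ℝ) × ℝ → nu.cells → ℝ) :=
  measurable_pi_lambda _ fun c => measurable_rowInsert c

/-- The pairs on which the insertion permutes the entries as prescribed by `e`. -/
def reorderDomain (x : ℤ) (e : nu.cells ≃ Option lam.cells) : Set ((lam.cells → ℝ) × ℝ) :=
  insertionDomain lam x ∩ {q | insertMap nu q = reorder e q}

theorem measurableSet_reorderDomain (e : nu.cells ≃ Option lam.cells) :
    MeasurableSet (reorderDomain x e) :=
  (measurableSet_insertionDomain x).inter
    (measurableSet_eq_fun measurable_insertMap (reorder e).measurable)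

theorem GrowsAt.iUnion_reorderDomain (h : GrowsAt lam x nu) :
    ⋃ e : nu.cells ≃ Option lam.cells, reorderDomain x e = insertionDomain lam x := by
  ext q
  simp only [reorderDomain, Set.mem_iUnion, Set.mem_inter_iff, Set.mem_ofPred_eq]
  constructor
  · rintro ⟨e, h, -⟩
    exact h
  · intro hq
    obtain ⟨e, he⟩ := exists_equiv_rowInsert hq.1.2.2.1 hq.1.2.2.2 h.card (h.cells_eq hq)
    refine ⟨e, hq, funext fun c => ?_⟩
    rw [reorder_apply]
    exact he c

theorem elim_injective {q : (lam.cells → ℝ) × ℝ} (hq : q ∈ genericPairs lam) :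
    Function.Injective fun o : Option lam.cells => o.elim q.2 q.1 := by
  obtain ⟨-, -, h1, h2⟩ := hq
  rintro (_ | c) (_ | d) h
  · rfl
  · exact absurd h.symm (h2 d)
  · exact absurd h (h2 c)
  · exact congrArg some (h1 h)

theorem eq_of_reorder_eq {q : (lam.cells → ℝ) × ℝ} (hq : q ∈ genericPairs lam)
    {e e' : nu.cells ≃ Option lam.cells} (h : reorder e q = reorder e' q) : e = e' := by
  ext1 c
  have := congrFun h c
  rw [reorder_apply, reorder_apply] at this
  exact elim_injective hq this

theorem disjoint_reorderDomain {e e' : nu.cells ≃ Option lam.cells} (h : e ≠ e') :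
    Disjoint (reorderDomain x e) (reorderDomain x e') := by
  rw [Set.disjoint_left]
  rintro q ⟨h1, h2⟩ ⟨-, h3⟩
  exact h (eq_of_reorder_eq h1.1 (h2.symm.trans h3))

theorem GrowsAt.insertMap_injOn (h : GrowsAt lam x nu) :
    Set.InjOn (insertMap nu) (insertionDomain lam x) := by
  intro q hq q' hq' e
  have hb : newBox q.1 q.2 = newBox q'.1 q'.2 :=
    eq_of_mem_addableBoxes (newBox_mem_addableBoxes hq.1.1.2 q.2)
      (newBox_mem_addableBoxes hq'.1.1.2 q'.2) (hq.2.trans hq'.2.symm)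
  have := rowInsert_injective hq.1.1.2 hq'.1.1.2 hq.1.2.2.1 hq'.1.2.2.1 hq.1.2.2.2 hq'.1.2.2.2 hb
    fun c hc => congrFun e ⟨c, by rw [h.cells_eq hq]; exact hc⟩
  exact Prod.ext this.1 this.2

theorem GrowsAt.disjoint_image (h : GrowsAt lam x nu) {e e' : nu.cells ≃ Option lam.cells}
    (he : e ≠ e') : Disjoint (reorder e '' reorderDomain x e) (reorder e' '' reorderDomain x e') := by
  rw [Set.disjoint_left]
  rintro _ ⟨q, ⟨h1, h2⟩, rfl⟩ ⟨q', ⟨h3, h4⟩, h5⟩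
  have h6 : q' = q := h.insertMap_injOn h3 h1 (h4.trans (h5.trans h2.symm))
  subst h6
  exact he (eq_of_reorder_eq h1.1 h5.symm)

theorem measurableSet_image_reorderDomain (e : nu.cells ≃ Option lam.cells) :
    MeasurableSet (reorder e '' reorderDomain x e) :=
  (reorder e).measurableSet_image.2 (measurableSet_reorderDomain e)

theorem GrowsAt.lintegral_insertMap_aux (h : GrowsAt lam x nu) (f : (nu.cells → ℝ) → ENNReal) :
    ∫⁻ q in insertionDomain lam x, f (insertMap nu q) =
      ∫⁻ T in ⋃ e : nu.cells ≃ Option lam.cells, reorder e '' reorderDomain x e, f T := by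
  rw [← h.iUnion_reorderDomain, lintegral_iUnion measurableSet_reorderDomain
    (fun e e' he => disjoint_reorderDomain he), lintegral_iUnion measurableSet_image_reorderDomain
    (fun e e' he => h.disjoint_image he)]
  refine tsum_congr fun e => ?_
  rw [← (measurePreserving_reorder e).setLIntegral_comp_emb (reorder e).measurableEmbedding]
  refine setLIntegral_congr_fun (measurableSet_reorderDomain e) fun q hq => ?_
  rw [hq.2]

theorem GrowsAt.iUnion_image_subset (h : GrowsAt lam x nu) :
    ⋃ e : nu.cells ≃ Option lam.cells, reorder e '' reorderDomain x e ⊆ poissonizedTableaux nu := by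
  refine Set.iUnion_subset fun e => ?_
  rintro _ ⟨q, ⟨h1, h2⟩, rfl⟩
  constructor
  · intro c
    rw [reorder_apply]
    cases e c with
    | none => exact h1.1.2.1
    | some d => exact h1.1.1.1 d
  · rw [← show insertMap nu q = reorder e q from h2]
    exact rowInsert_strictMono h1.1.1.2 h1.1.2.2.1 h1.1.2.2.2 (h.cells_eq h1)

theorem GrowsAt.volume_iUnion_image (h : GrowsAt lam x nu) :
    volume (⋃ e : nu.cells ≃ Option lam.cells, reorder e '' reorderDomain x e) =
      volume (insertionDomain lam x) := by
  have := h.lintegral_insertMap_aux fun _ => 1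
  simpa using this.symm

theorem GrowsAt.volume_insertionDomain (h : GrowsAt lam x nu) :
    volume (insertionDomain lam x) = volume (poissonizedTableaux nu) := by
  have hle : ∀ {x : ℤ} {nu : YoungDiagram}, GrowsAt lam x nu →
      volume.real (insertionDomain lam x) ≤ transitionMeasure lam x * tableauVolume lam := by
    intro x nu h
    rw [← h.tableauVolume_eq, measureReal_def, ← h.volume_iUnion_image]
    exact measureReal_mono h.iUnion_image_subset (volume_poissonizedTableaux_ne_top nu)
  have hfin : ∀ {x : ℤ} {nu : YoungDiagram}, GrowsAt lam x nu →
      volume (insertionDomain lam x) ≠ ⊤ := by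
    intro x nu h
    rw [← h.volume_iUnion_image]
    exact ne_top_of_le_ne_top (volume_poissonizedTableaux_ne_top nu)
      (measure_mono h.iUnion_image_subset)
  have hsum : ∑ x ∈ concaveCorners lam, volume.real (insertionDomain lam x) =
      ∑ x ∈ concaveCorners lam, transitionMeasure lam x * tableauVolume lam := by
    rw [← Finset.sum_mul, sum_transitionMeasure, one_mul, tableauVolume, measureReal_def,
      ← sum_volume_insertionDomain, ENNReal.toReal_sum]
    · rfl
    · intro x hx
      exact hfin (growsAt_grow hx)
  have := (Finset.sum_eq_sum_iff_of_le fun y hy => hle (growsAt_grow hy)).1 hsum x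
    h.mem_concaveCorners
  rw [← h.tableauVolume_eq, tableauVolume, measureReal_def, measureReal_def] at this
  exact (ENNReal.toReal_eq_toReal_iff' (hfin h) (volume_poissonizedTableaux_ne_top nu)).1 this

/-- Row insertion preserves the volume. -/
theorem GrowsAt.lintegral_insertMap (h : GrowsAt lam x nu) (f : (nu.cells → ℝ) → ENNReal) :
    ∫⁻ q in insertionDomain lam x, f (insertMap nu q) = ∫⁻ T in poissonizedTableaux nu, f T := by
  rw [h.lintegral_insertMap_aux]
  refine setLIntegral_congr (ae_eq_of_subset_of_measure_ge h.iUnion_image_subset ?_ ?_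
    (volume_poissonizedTableaux_ne_top nu))
  · rw [h.volume_iUnion_image, h.volume_insertionDomain]
  · exact (MeasurableSet.iUnion measurableSet_image_reorderDomain).nullMeasurableSet

theorem GrowsAt.threshold_insertMap (h : GrowsAt lam x nu) {q : (lam.cells → ℝ) × ℝ}
    (hq : q ∈ insertionDomain lam x) : threshold (insertMap nu q) ((x : ℝ) - 1) = q.2 := by
  have := threshold_rowInsert hq.1.1.2 hq.1.2.1 (h.cells_eq hq)
  rwa [show uCoord (newBox q.1 q.2) = x from hq.2] at this

end InsertionMap

section Moments

variable {lam : YoungDiagram}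

/-- The numbers whose insertion creates a box with `u`-coordinate at most `u₀`. -/
def lowInsertions (T : lam.cells → ℝ) (u₀ : ℝ) : Set ℝ :=
  {z : ℝ | z ∈ Set.Icc (0 : ℝ) 1 ∧ (uCoord (newBox T z) : ℝ) ≤ u₀}

theorem threshold_mem_Icc (T : lam.cells → ℝ) (u₀ : ℝ) : threshold T u₀ ∈ Set.Icc (0 : ℝ) 1 :=
  ⟨Real.sSup_nonneg fun _ hz => hz.1.1, Real.sSup_le (fun _ hz => hz.1.2) zero_le_one⟩

theorem lowInsertions_ae_eq (T : lam.cells → ℝ) (u₀ : ℝ) :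
    lowInsertions T u₀ =ᵐ[volume] Set.Ioc 0 (threshold T u₀) := by
  have hbdd : BddAbove (lowInsertions T u₀) := ⟨1, fun _ hz => hz.1.2⟩
  have h1 : lowInsertions T u₀ ⊆ Set.Icc 0 (threshold T u₀) := fun z hz =>
    ⟨hz.1.1, le_csSup hbdd hz⟩
  have h2 : Set.Ioo 0 (threshold T u₀) ⊆ lowInsertions T u₀ := by
    intro z hz
    have hne : (lowInsertions T u₀).Nonempty := by
      by_contra h
      rw [Set.not_nonempty_iff_eq_empty] at h
      have h3 : threshold T u₀ = sSup (lowInsertions T u₀) := rfl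
      rw [h3, h, Real.sSup_empty] at hz
      exact absurd (hz.1.trans hz.2) (lt_irrefl _)
    obtain ⟨w, hw, hzw⟩ := exists_lt_of_lt_csSup hne hz.2
    refine ⟨⟨hz.1.le, hzw.le.trans hw.1.2⟩, le_trans ?_ hw.2⟩
    exact_mod_cast uCoord_newBox_mono T hzw.le
  refine Filter.EventuallyLE.antisymm ?_ ?_
  · exact (LE.le.eventuallyLE h1).trans Ioc_ae_eq_Icc.symm.le
  · exact Ioo_ae_eq_Ioc.symm.le.trans (LE.le.eventuallyLE h2)

theorem lintegral_lowInsertions (T : lam.cells → ℝ) (u₀ : ℝ) (k : ℕ) :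
    ∫⁻ z in lowInsertions T u₀, ENNReal.ofReal (z ^ k / k.factorial) =
      ENNReal.ofReal (threshold T u₀ ^ (k + 1) / (k + 1).factorial) := by
  have h0 := (threshold_mem_Icc T u₀).1
  rw [setLIntegral_congr (lowInsertions_ae_eq T u₀), ← ofReal_integral_eq_lintegral_ofReal]
  · rw [← intervalIntegral.integral_of_le h0, intervalIntegral.integral_div, integral_pow,
      Nat.factorial_succ]
    push_cast
    congr 1
    have : (k.factorial : ℝ) ≠ 0 := by positivity
    have : (k : ℝ) + 1 ≠ 0 := by positivity
    field_simp
    simp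
  · refine IntegrableOn.integrable ?_
    exact ((continuous_pow k).div_const _).integrableOn_Ioc
  · filter_upwards [ae_restrict_mem measurableSet_Ioc] with z hz
    have := hz.1.le
    positivity

/-- The pairs for which the insertion creates a box with `u`-coordinate at most `u₀`. -/
def lowPairs (lam : YoungDiagram) (u₀ : ℝ) : Set ((lam.cells → ℝ) × ℝ) :=
  (poissonizedTableaux lam ×ˢ Set.Icc (0 : ℝ) 1) ∩ {q | (uCoord (newBox q.1 q.2) : ℝ) ≤ u₀}

theorem measurableSet_lowPairs (u₀ : ℝ) : MeasurableSet (lowPairs lam u₀) :=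
  ((measurableSet_poissonizedTableaux lam).prod measurableSet_Icc).inter
    (measurableSet_le ((Measurable.of_discrete (f := fun z : ℤ => (z : ℝ))).comp
      measurable_uCoord_newBox) measurable_const)

theorem lintegral_lowPairs_right (u₀ : ℝ) (k : ℕ) (T : lam.cells → ℝ) :
    ∫⁻ z, (lowPairs lam u₀).indicator (fun q => ENNReal.ofReal (q.2 ^ k / k.factorial)) (T, z) =
      (poissonizedTableaux lam).indicator
        (fun T => ENNReal.ofReal (threshold T u₀ ^ (k + 1) / (k + 1).factorial)) T := by
  by_cases hT : T ∈ poissonizedTableaux lam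
  · have hS : MeasurableSet (lowInsertions T u₀) := by
      have : lowInsertions T u₀ = Prod.mk T ⁻¹' lowPairs lam u₀ := by
        ext z
        simp [lowInsertions, lowPairs, hT]
      rw [this]
      exact measurable_prodMk_left (measurableSet_lowPairs u₀)
    rw [Set.indicator_of_mem hT, ← lintegral_lowInsertions, ← lintegral_indicator hS]
    refine lintegral_congr fun z => ?_
    by_cases hz : z ∈ lowInsertions T u₀
    · rw [Set.indicator_of_mem hz, Set.indicator_of_mem (show (T, z) ∈ lowPairs lam u₀ from
        ⟨⟨hT, hz.1⟩, hz.2⟩)]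
    · rw [Set.indicator_of_notMem hz, Set.indicator_of_notMem]
      exact fun h => hz ⟨h.1.2, h.2⟩
  · rw [Set.indicator_of_notMem hT, ← lintegral_zero]
    refine lintegral_congr fun z => Set.indicator_of_notMem (fun h => hT h.1.1) _

theorem measurable_lowPairs_indicator (u₀ : ℝ) (k : ℕ) : Measurable
    ((lowPairs lam u₀).indicator fun q => ENNReal.ofReal (q.2 ^ k / k.factorial)) :=
  Measurable.indicator (by fun_prop) (measurableSet_lowPairs u₀)

theorem aemeasurable_threshold (u₀ : ℝ) :
    AEMeasurable (fun T : lam.cells → ℝ => threshold T u₀)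
      (volume.restrict (poissonizedTableaux lam)) := by
  refine ⟨fun T => (∫⁻ z, (lowPairs lam u₀).indicator
    (fun q => ENNReal.ofReal (q.2 ^ 0 / (Nat.factorial 0 : ℕ))) (T, z)).toReal, ?_, ?_⟩
  · exact (measurable_lowPairs_indicator u₀ 0).lintegral_prod_right'.ennreal_toReal
  · filter_upwards [ae_restrict_mem (measurableSet_poissonizedTableaux lam)] with T hT
    rw [lintegral_lowPairs_right, Set.indicator_of_mem hT]
    simp [ENNReal.toReal_ofReal (threshold_mem_Icc T u₀).1]

/-- The `k`-th moment of the threshold, divided by `k!`, with respect to the Lebesgue measure. -/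
noncomputable def thresholdMoment (k : ℕ) (lam : YoungDiagram) (u₀ : ℝ) : ENNReal :=
  ∫⁻ T in poissonizedTableaux lam, ENNReal.ofReal (threshold T u₀ ^ k / k.factorial)

theorem lowPairs_ae_eq (u₀ : ℝ) : lowPairs lam u₀ =ᵐ[volume]
    ⋃ x ∈ (concaveCorners lam).filter (fun x : ℤ => (x : ℝ) ≤ u₀), insertionDomain lam x := by
  filter_upwards [ae_generic (lam := lam)] with q hq
  change (q ∈ lowPairs lam u₀) = (q ∈ ⋃ x ∈ (concaveCorners lam).filter (fun x : ℤ => (x : ℝ) ≤ u₀),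
    insertionDomain lam x)
  simp only [lowPairs, insertionDomain, genericPairs, Set.mem_iUnion, Set.mem_inter_iff,
    Set.mem_ofPred_eq, exists_prop, Finset.mem_filter, Set.mem_prod, eq_iff_iff]
  constructor
  · rintro ⟨⟨h1, h2⟩, h3⟩
    exact ⟨_, ⟨Finset.mem_image_of_mem _ (newBox_mem_addableBoxes h1.2 _), h3⟩, ⟨h1, h2, hq⟩, rfl⟩
  · rintro ⟨x, ⟨-, h1⟩, ⟨h2, h3, -⟩, h4⟩
    exact ⟨⟨h2, h3⟩, by rwa [h4]⟩

theorem thresholdMoment_succ (k : ℕ) (lam : YoungDiagram) (u₀ : ℝ) :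
    thresholdMoment (k + 1) lam u₀ =
      ∑ x ∈ (concaveCorners lam).filter (fun x : ℤ => (x : ℝ) ≤ u₀),
        thresholdMoment k (grow lam x) ((x : ℝ) - 1) := by
  have h1 : thresholdMoment (k + 1) lam u₀ =
      ∫⁻ q in lowPairs lam u₀, ENNReal.ofReal (q.2 ^ k / k.factorial) := by
    rw [← lintegral_indicator (measurableSet_lowPairs u₀), Measure.volume_eq_prod,
      lintegral_prod _ (measurable_lowPairs_indicator u₀ k).aemeasurable]
    simp only [lintegral_lowPairs_right]
    rw [lintegral_indicator (measurableSet_poissonizedTableaux lam), thresholdMoment]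
  rw [h1, setLIntegral_congr (lowPairs_ae_eq u₀), lintegral_biUnion_finset]
  · refine Finset.sum_congr rfl fun x hx => ?_
    have hg := growsAt_grow (Finset.mem_filter.1 hx).1
    rw [thresholdMoment, ← hg.lintegral_insertMap]
    refine setLIntegral_congr_fun (measurableSet_insertionDomain x) fun q hq => ?_
    simp only [hg.threshold_insertMap hq]
  · exact fun x _ y _ h => disjoint_insertionDomain h
  · exact fun x _ => measurableSet_insertionDomain x

theorem transitionMeasure_nonneg (lam : YoungDiagram) (x : ℤ) : 0 ≤ transitionMeasure lam x := by
  by_cases hx : x ∈ concaveCorners lam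
  · have h := (growsAt_grow hx).tableauVolume_eq
    have h1 := tableauVolume_pos (grow lam x)
    rw [h] at h1
    exact (pos_of_mul_pos_left h1 (tableauVolume_pos lam).le).le
  · rw [transitionMeasure, if_neg hx]

/-- The decreasing paths with `k` boxes whose `u`-coordinates are at most `u₀`. -/
noncomputable def decPaths : ℕ → YoungDiagram → ℝ → Finset (List ℤ)
  | 0, _, _ => {[]}
  | k + 1, lam, u₀ => ((concaveCorners lam).filter fun x : ℤ => (x : ℝ) ≤ u₀).biUnion fun x =>
      (decPaths k (grow lam x) ((x : ℝ) - 1)).image (List.cons x)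

theorem of_mem_decPaths {k : ℕ} {lam : YoungDiagram} {u₀ : ℝ} {L : List ℤ}
    (h : L ∈ decPaths k lam u₀) :
    L.length = k ∧ L.Pairwise (· > ·) ∧ ∀ a ∈ L, (a : ℝ) ≤ u₀ := by
  induction k generalizing lam u₀ L with
  | zero =>
    rw [decPaths, Finset.mem_singleton] at h
    subst h
    simp
  | succ k ih =>
    simp only [decPaths, Finset.mem_biUnion, Finset.mem_filter, Finset.mem_image] at h
    obtain ⟨x, ⟨-, hx⟩, L', hL', rfl⟩ := h
    obtain ⟨h1, h2, h3⟩ := ih hL'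
    refine ⟨by rw [List.length_cons, h1], List.pairwise_cons.2 ⟨fun a ha => ?_, h2⟩, fun a ha => ?_⟩
    · have := h3 a ha
      have h4 : (a : ℝ) < x := by linarith
      exact_mod_cast h4
    · rcases List.mem_cons.1 ha with rfl | ha
      · exact hx
      · have := h3 a ha
        linarith

theorem mem_decPaths {k : ℕ} {lam : YoungDiagram} {u₀ : ℝ} {L : List ℤ} (h0 : pathWeight lam L ≠ 0)
    (h1 : L.length = k) (h2 : L.Pairwise (· > ·)) (h3 : ∀ a ∈ L, (a : ℝ) ≤ u₀) :
    L ∈ decPaths k lam u₀ := by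
  induction L generalizing lam u₀ k with
  | nil =>
    subst h1
    simp [decPaths]
  | cons x L ih =>
    subst h1
    rw [pathWeight] at h0
    rw [List.pairwise_cons] at h2
    simp only [List.length_cons, decPaths, Finset.mem_biUnion, Finset.mem_filter, Finset.mem_image]
    refine ⟨x, ⟨transitionMeasure_ne_zero_iff.1 (left_ne_zero_of_mul h0), h3 x List.mem_cons_self⟩, L,
      ih (right_ne_zero_of_mul h0) rfl h2.2 fun a ha => ?_, rfl⟩
    have h4 : a ≤ x - 1 := by
      have := h2.1 a ha
      omega
    exact_mod_cast h4

theorem sum_decPaths_succ (k : ℕ) (lam : YoungDiagram) (u₀ : ℝ) :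
    ∑ L ∈ decPaths (k + 1) lam u₀, pathWeight lam L =
      ∑ x ∈ (concaveCorners lam).filter (fun x : ℤ => (x : ℝ) ≤ u₀), transitionMeasure lam x *
        ∑ L ∈ decPaths k (grow lam x) ((x : ℝ) - 1), pathWeight (grow lam x) L := by
  rw [decPaths, Finset.sum_biUnion]
  · refine Finset.sum_congr rfl fun x _ => ?_
    rw [Finset.sum_image (fun a _ b _ h => (List.cons.inj h).2), Finset.mul_sum]
    rfl
  · intro x _ y _ hxy
    rw [Function.onFun, Finset.disjoint_left]
    intro L hL hL'
    obtain ⟨A, -, rfl⟩ := Finset.mem_image.1 hL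
    obtain ⟨B, -, hB⟩ := Finset.mem_image.1 hL'
    exact hxy (List.cons.inj hB).1.symm

theorem pathWeight_nonneg (lam : YoungDiagram) (L : List ℤ) : 0 ≤ pathWeight lam L := by
  induction L generalizing lam with
  | nil => exact zero_le_one
  | cons x L ih => exact mul_nonneg (transitionMeasure_nonneg lam x) (ih _)

theorem thresholdMoment_eq (k : ℕ) (lam : YoungDiagram) (u₀ : ℝ) :
    thresholdMoment k lam u₀ =
      ENNReal.ofReal ((∑ L ∈ decPaths k lam u₀, pathWeight lam L) * tableauVolume lam) := by
  induction k generalizing lam u₀ with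
  | zero =>
    simp [thresholdMoment, decPaths, pathWeight, tableauVolume,
      ofReal_measureReal (volume_poissonizedTableaux_ne_top lam)]
  | succ k ih =>
    rw [thresholdMoment_succ, sum_decPaths_succ, Finset.sum_mul, ENNReal.ofReal_sum_of_nonneg]
    · refine Finset.sum_congr rfl fun x hx => ?_
      rw [ih, (growsAt_grow (Finset.mem_filter.1 hx).1).tableauVolume_eq]
      congr 1
      ring
    · intro x _
      exact mul_nonneg (mul_nonneg (transitionMeasure_nonneg _ _)
        (Finset.sum_nonneg fun L _ => pathWeight_nonneg _ L)) (tableauVolume_pos lam).le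

theorem measureReal_strictAnti {Ω : Type*} [MeasurableSpace Ω] {P : Measure Ω}
    [IsProbabilityMeasure P] {lam : YoungDiagram} {k : ℕ} {D : Fin (k + 1) → Ω → YoungDiagram}
    (hD : IsPlancherelGrowth P lam D) (hk : 1 ≤ k) (u₀ : ℝ) :
    P.real {ω | (addedU (fun i => D i ω) ⟨0, hk⟩ : ℝ) ≤ u₀ ∧ StrictAnti (addedU fun i => D i ω)} =
      ∑ L ∈ decPaths k lam u₀, pathWeight lam L := by
  have hset : {ω | (addedU (fun i => D i ω) ⟨0, hk⟩ : ℝ) ≤ u₀ ∧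
      StrictAnti (addedU fun i => D i ω)} =
      ⋃ L ∈ decPaths k lam u₀, {ω | List.ofFn (addedU fun i => D i ω) = L} := by
    ext ω
    simp only [Set.mem_ofPred_eq, Set.mem_iUnion, exists_prop, exists_eq_right']
    set u := addedU fun i => D i ω with hu
    constructor
    · rintro ⟨h1, h2⟩
      refine mem_decPaths (hD.pathWeight_ne_zero ω) (List.length_ofFn) ?_ ?_
      · exact List.pairwise_ofFn.2 fun i j hij => h2 hij
      · intro a ha
        obtain ⟨i, rfl⟩ := (List.mem_ofFn' _ _).1 ha
        refine le_trans ?_ h1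
        exact_mod_cast h2.antitone (Fin.mk_le_of_le_val (Nat.zero_le _))
    · intro h
      obtain ⟨-, h2, h3⟩ := of_mem_decPaths h
      exact ⟨h3 _ ((List.mem_ofFn' _ _).2 ⟨_, rfl⟩), fun i j hij => List.pairwise_ofFn.1 h2 hij⟩
  rw [hset, measureReal_biUnion_finset]
  · exact Finset.sum_congr rfl fun L hL => hD.measureReal_eq (of_mem_decPaths hL).1
  · intro L _ L' _ h
    rw [Function.onFun, Set.disjoint_left]
    rintro ω h1 h2
    exact h (Eq.trans (Eq.symm h1) h2)
  · exact fun L _ => hD.measurableSet L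

theorem integrable_threshold_pow (k : ℕ) (u₀ : ℝ) :
    Integrable (fun T : lam.cells → ℝ => threshold T u₀ ^ k)
      (volume.restrict (poissonizedTableaux lam)) := by
  have : IsFiniteMeasure (volume.restrict (poissonizedTableaux lam)) :=
    ⟨by rw [Measure.restrict_apply_univ]; exact (volume_poissonizedTableaux_ne_top lam).lt_top⟩
  refine Integrable.of_bound (C := 1) ((aemeasurable_threshold u₀).pow_const k).aestronglyMeasurable
    (Filter.Eventually.of_forall fun T => ?_)
  obtain ⟨h1, h2⟩ := threshold_mem_Icc T u₀
  rw [Real.norm_of_nonneg (pow_nonneg h1 k)]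
  exact pow_le_one₀ h1 h2

theorem integral_threshold_pow (k : ℕ) (u₀ : ℝ) :
    ∫ T in poissonizedTableaux lam, threshold T u₀ ^ k =
      k.factorial * ((∑ L ∈ decPaths k lam u₀, pathWeight lam L) * tableauVolume lam) := by
  have h1 : ∫ T in poissonizedTableaux lam, threshold T u₀ ^ k / k.factorial =
      (∑ L ∈ decPaths k lam u₀, pathWeight lam L) * tableauVolume lam := by
    rw [integral_eq_lintegral_of_nonneg_ae]
    · have h := thresholdMoment_eq k lam u₀
      rw [thresholdMoment] at h
      rw [h, ENNReal.toReal_ofReal]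
      exact mul_nonneg (Finset.sum_nonneg fun L _ => pathWeight_nonneg _ L) (tableauVolume_pos lam).le
    · refine Filter.Eventually.of_forall fun T => ?_
      have := (threshold_mem_Icc T u₀).1
      simp only [Pi.zero_apply]
      positivity
    · exact ((integrable_threshold_pow k u₀).div_const _).aestronglyMeasurable
  rw [integral_div] at h1
  have : (k.factorial : ℝ) ≠ 0 := by positivity
  rw [← h1]
  field_simp

end Moments

end PlancherelGrowth

theorem mainTheorem2 {Ω : Type*} [MeasurableSpace Ω] (P : MeasureTheory.Measure Ω)
    [MeasureTheory.IsProbabilityMeasure P] (lam : YoungDiagram) (k : ℕ) (hk : 1 ≤ k)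
    (D : Fin (k + 1) → Ω → YoungDiagram) (hD : PlancherelGrowth.IsPlancherelGrowth P lam D)
    (U : Ω → Fin k → ℤ) (hU : ∀ ω, U ω = PlancherelGrowth.addedU fun i => D i ω) :
    -- (a)
    (∀ u₀ : ℝ,
      MeasureTheory.Integrable (fun T => PlancherelGrowth.threshold T u₀ ^ k)
          (PlancherelGrowth.uniformTableau lam) ∧
        ∫ T, PlancherelGrowth.threshold T u₀ ^ k ∂(PlancherelGrowth.uniformTableau lam) =
          (k.factorial : ℝ) * P.real {ω | (U ω ⟨0, hk⟩ : ℝ) ≤ u₀ ∧ StrictAnti (U ω)}) ∧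
    -- (b)
    (∀ ω, StrictAnti (U ω) →
      ∃! s : (l : ℕ) × (Fin l → ℤ) × (Fin l → ℕ),
        StrictAnti s.2.1 ∧ (∀ i, s.2.1 i ∈ PlancherelGrowth.concaveCorners lam) ∧
          (∀ i, 1 ≤ s.2.2 i) ∧ ∑ i, s.2.2 i = k ∧
          List.ofFn (U ω) = PlancherelGrowth.stringTuple s.2.1 s.2.2) ∧
    -- (c)
    (∀ (l : ℕ) (x : Fin l → ℤ) (a : Fin l → ℕ),
      StrictAnti x → (∀ i, x i ∈ PlancherelGrowth.concaveCorners lam) →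
      (∀ i, 1 ≤ a i) → ∑ i, a i = k →
      (∀ (i : Fin l) (m : ℕ), 1 ≤ m → m < a i →
        x i - (m : ℤ) ∉ PlancherelGrowth.concaveCorners lam) →
      P.real {ω | List.ofFn (U ω) = PlancherelGrowth.stringTuple x a} =
        PlancherelGrowth.theta x a *
          ∏ i, ((-1 : ℝ) ^ (a i - 1) / (a i : ℝ) * PlancherelGrowth.transitionMeasure lam (x i) *
            PlancherelGrowth.cauchyFalling lam (a i - 1) ((x i : ℝ) - 1))) := by
  open PlancherelGrowth in
  obtain rfl : U = fun ω => addedU fun i => D i ω := funext hU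
  refine ⟨fun u₀ => ?_, fun ω h => ?_, fun l x a h1 h2 h3 h4 h5 => ?_⟩
  · have hpos := tableauVolume_pos lam
    have hne : volume (poissonizedTableaux lam) ≠ 0 := fun h => by
      simp [tableauVolume, Measure.real, h] at hpos
    constructor
    · exact (integrable_threshold_pow k u₀).smul_measure (ENNReal.inv_ne_top.2 hne)
    · rw [measureReal_strictAnti hD hk, uniformTableau, ProbabilityTheory.cond, integral_smul_measure,
        integral_threshold_pow, ENNReal.toReal_inv, smul_eq_mul,
        show (volume (poissonizedTableaux lam)).toReal = tableauVolume lam from rfl]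
      field_simp
  · have hlen : (List.ofFn (addedU fun i => D i ω)).length = k := List.length_ofFn
    have := existsUnique_stringTuple (lam := lam) (L := List.ofFn (addedU fun i => D i ω))
      (fun h0 => by rw [h0] at hlen; simp at hlen; omega)
      (List.pairwise_ofFn.2 fun i j hij => h hij) (hD.pathWeight_ne_zero ω)
    rwa [hlen] at this
  · rw [hD.measureReal_eq, pathWeight_stringTuple h1 h2 h3 h5]
    rw [stringTuple_eq, descRuns, List.length_flatMap, ← h4, ← List.sum_ofFn, List.map_ofFn]
    simp only [Function.comp_def, length_descRun]
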